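/- **Theorem (soundness and adequacy).** Let $\mathbb V$ be the monoid, under composition, of monotone maps $\mathbb N\cup\{\infty\}\to\mathbb N\cup\{\infty\}$ preserving suprema of $\omega$-chains, let $\mathsf{vSet}=[\mathbb V^{\mathrm{op}},\mathsf{Set}]$ be the category of presheaves on the one-object category $\mathbb V$ (write $X(\mathrm V)$ for the value of $X$ at the object), and let $\Delta_{\mathsf{vSet}}$ be the splitting of the idempotent $r_1:i\mapsto\min(i,1)$ on the representable presheaf, with the point $\top:1\to\Delta_{\mathsf{vSet}}$ given by the constant map $1$. A subobject of $A$ is *semidecidable* if it is a pullback of $\top$ along some map $A\to\Delta_{\mathsf{vSet}}$. Let $L$ be the strong monad with $(LX)(\mathrm V)=\{\bot\}+\sum_{n\in\mathbb N}X(\mathrm V)$, where $s$ in the $n$-th summand stands for the chain $s$ preceded by $n$ copies of $\bot$: $e\in\mathbb V$ fixes $\bot$, and sends $s$ in summand $n$ to $X(e')(s)$ in summand $k$, where $k\in\mathbb N$ is least with $e(k)\ge n$ and $e'(i)=e(k+i)-n$, or to $\bot$ if there is no such $k$. Its unit $\eta$ sends $s$ to $s$ in summand $0$, its multiplication adds the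 indices, its strength $A\times LB\to L(A\times B)$ sends $(a,s)$ with $s$ in summand $n$ to $(A(i\mapsto n+i)(a),s)$ in summand $n$, and it has points $\bot_X:1\to LX$. Let $\bar\omega$ be the limit of $1\xleftarrow{!}L1\xleftarrow{L!}L^21\leftarrow\cdots$, let $\omega$ be the colimit of $1\xrightarrow{\bot}L1\xrightarrow{L\bot}L^21\to\cdots$, let $i:\omega\to\bar\omega$ be the canonical map, and let $\infty:1\to\bar\omega$ be the point induced by iterating $\eta$. An object $X$ is *$L$-complete* if, for every object $A$, every map $A\times\omega\to X$ factors uniquely through $\mathrm{id}_A\times i$. $\mathsf{PCF_v}$ is the fine-grained call-by-value language with types $\tau::=\mathsf 0\mid\mathsf 1\mid\mathsf{nat}\mid\tau+\tau\mid\tau\times\tau\mid\tau\to\tau$, values $$v,w::=x\mid\star\mid\mathsf{inl}\,v\mid\mathsf{inr}\,v\mid(v,w)\mid\mathsf{zero}\mid\mathsf{succ}\,v\mid\lambda x.t\mid\mathsf{rec}\,f\,x.\,t,$$ and computations $$\begin{aligned}t,u::={}&\mathsf{case}\,v\,\mathsf{of}\,\{\}\mid\mathsf{return}\,v\mid\mathsf{case}\,v\,\mathsf{of}\,\{\mathsf{inl}\,x.t;\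 \mathsf{inr}\,y.u\}\mid\pi_1v\mid\pi_2v\mid v\,w\\&\mid\mathsf{case}\,v\,\mathsf{of}\,\{\mathsf{zero}.t;\ \mathsf{succ}\,x.u\}\mid\mathsf{let}\,x=t\,\mathsf{in}\,u,\end{aligned}$$ with the usual simple typing (terms are taken with their typing derivations). Evaluation $t\Downarrow_\tau v$, between closed computations and closed values of type $\tau$, is the least relation such that $\mathsf{return}\,v\Downarrow v$; $\pi_j(v_1,v_2)\Downarrow v_j$; $(\lambda x.t)\,v\Downarrow w$ if $t[v/x]\Downarrow w$; $(\mathsf{rec}\,f\,x.\,t)\,v\Downarrow w$ if $t[(\mathsf{rec}\,f\,x.\,t)/f,\,v/x]\Downarrow w$; $\mathsf{let}\,x=t\,\mathsf{in}\,u\Downarrow w$ if $t\Downarrow v$ and $u[v/x]\Downarrow w$ for some $v$; and a case expression on $\mathsf{inl}\,v$, $\mathsf{inr}\,v$, $\mathsf{zero}$ or $\mathsf{succ}\,v$ evaluates to $w$ if the selected branch, with $v$ substituted for its variable (if any), does. A *ground type* is a type in which $\to$ does not occur. Put $[\![\mathsf 0]\!]=0$, $[\![\mathsf 1]\!]=1$,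 $[\![\mathsf{nat}]\!]=\sum_0^\infty 1$, $[\![\sigma+\tau]\!]=[\![\sigma]\!]+[\![\tau]\!]$, $[\![\sigma\times\tau]\!]=[\![\sigma]\!]\times[\![\tau]\!]$, $[\![\sigma\to\tau]\!]=([\![\sigma]\!]\Rightarrow L[\![\tau]\!])$. Values $\Gamma\vdash v:\tau$ and computations $\Gamma\vdash t:\tau$ are interpreted in the standard way, by structural recursion, as maps $[\![v]\!]:[\![\Gamma]\!]\to[\![\tau]\!]$ and $[\![t]\!]:[\![\Gamma]\!]\to L[\![\tau]\!]$, where $\mathsf{rec}\,f\,x.\,t$ of type $\sigma\to\tau$ is interpreted as follows. With $X=[\![\sigma\to\tau]\!]$, with its pointwise $L$-algebra structure $\alpha:LX\to X$, and with $g:[\![\Gamma]\!]\times X\to X$ the transpose of $[\![t]\!]$, put $F=\eta\circ g\circ(\mathrm{id}\times\alpha):[\![\Gamma]\!]\times LX\to LX$. The maps $\mathsf{ap}_n:[\![\Gamma]\!]\times L^n1\to LX$ given by $\mathsf{ap}_0=\bot$ and $\mathsf{ap}_{n+1}=\mu\circ L(F)\circ L(\pi_1,\mathsf{ap}_n)\circ\mathrm{strength}$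 determine a map $[\![\Gamma]\!]\times\omega\to LX$; if $LX$ is $L$-complete this has a unique extension to $[\![\Gamma]\!]\times\bar\omega$, and $[\![\mathsf{rec}\,f\,x.\,t]\!]$ is $\alpha$ composed with the value of this extension at $\infty$. Then $(\mathsf{vSet},\Delta_{\mathsf{vSet}})$ gives a sound and adequate model of $\mathsf{PCF_v}$: 1. (Model) It is a normal model: each semidecidable subobject has a unique classifying map to $\Delta_{\mathsf{vSet}}$, every $0\rightarrowtail A$ is semidecidable, and semidecidable monomorphisms are closed under composition; $L$, with the structure above, is the corresponding lifting monad (the unit $\eta_B:B\to LB$ classifies partial maps into $B$ with semidecidable domain, and the remaining structure is the one induced by partial maps); and $L(\sum_0^\infty1)$ is $L$-complete. Moreover $L[\![\tau]\!]$ is $L$-complete for every type $\tau$, so that the interpretation above is defined. 2. (Soundness) For every type $\tau$, closed computation $t$ and closed value $v$ of type $\tau$, if $t\Downarrow_\tau v$ then $[\![t]\!]=\eta_{[\![\tau]\!]}\circ[\![v]\!]$. 3. (Adequacy) For every ground type $\tau$, closed computation $t$ and closed value $v$ of type $\tau$, if $[\![t]\!]=\eta_{[\![\tau]\!]}\circ[\![v]\!]$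 then $t\Downarrow_\tau v$. -/

import Mathlib

open CategoryTheory MonoidalCategory CartesianMonoidalCategory Limits Opposite
open OmegaCompletePartialOrder

noncomputable section

/-! ## The monoid of continuous endomaps of `ℕ ∪ {∞}` -/

/-- Monotone maps `ℕ∞ → ℕ∞` that preserve suprema of `ω`-chains. -/
abbrev VEnd : Type := ℕ∞ →𝒄 ℕ∞

namespace VEnd

/-- The product of the monoid is composition of functions: `(d * e) i = d (e i)`. -/
instance : Monoid VEnd where
  one := ContinuousHom.id
  mul d e := d.comp e
  one_mul _ := rfl
  mul_one _ := rfl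
  mul_assoc _ _ _ := rfl

theorem one_apply (i : ℕ∞) : (1 : VEnd) i = i := rfl

theorem mul_apply (d e : VEnd) (i : ℕ∞) : (d * e) i = d (e i) := rfl

/-- A monotone map is continuous as soon as it is continuous at `∞`. -/
def ofMonotone (f : ℕ∞ → ℕ∞) (hf : Monotone f)
    (htop : ∀ b : ℕ∞, (∀ n : ℕ, f n ≤ b) → f ⊤ ≤ b) : VEnd where
  toFun := f
  monotone' := hf
  map_ωSup' c := by
    apply le_antisymm
    · have hb : ∀ i, f (c i) ≤ ωSup (c.map ⟨f, hf⟩) := fun i => le_ωSup (c.map ⟨f, hf⟩) i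
      by_cases h : ∃ i, ωSup c ≤ c i
      · obtain ⟨i, hi⟩ := h
        exact (hf hi).trans (hb i)
      · push Not at h
        have key : ∀ n : ℕ, ∃ i, (n : ℕ∞) ≤ c i := by
          intro n
          induction n with
          | zero => exact ⟨0, by simp⟩
          | succ n ih =>
            obtain ⟨i, hi⟩ := ih
            obtain ⟨j, hj⟩ : ∃ j, c i < c j := by
              by_contra hcon
              push Not at hcon
              exact absurd (ωSup_le c (c i) hcon) (not_le.mpr (h i))
            refine ⟨j, ?_⟩
            push_cast
            exact Order.add_one_le_of_lt (lt_of_le_of_lt hi hj)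
        refine (hf le_top).trans (htop _ fun n => ?_)
        obtain ⟨i, hi⟩ := key n
        exact (hf hi).trans (hb i)
    · exact ωSup_le _ _ fun i => hf (le_ωSup c i)

theorem exists_le_of_le_top (e : VEnd) (n : ℕ) (h : (n : ℕ∞) ≤ e ⊤) :
    ∃ k : ℕ, (n : ℕ∞) ≤ e k := by
  by_contra hcon
  push Not at hcon
  cases n with
  | zero => exact absurd (hcon 0) (by simp)
  | succ n =>
    let c : Chain ℕ∞ := ⟨fun k : ℕ => (k : ℕ∞), fun a b hab => Nat.cast_le.mpr hab⟩
    have hc : ωSup c = ⊤ := by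
      refine top_le_iff.mp (le_of_forall_lt fun a ha => ?_)
      lift a to ℕ using ha.ne
      exact lt_of_lt_of_le (Nat.cast_lt.mpr (Nat.lt_succ_self a)) (le_ωSup c (a + 1))
    have h2 : e ⊤ ≤ (n : ℕ∞) := by
      rw [← hc, e.continuous]
      exact ωSup_le _ _ fun k => Order.le_of_lt_add_one (by exact_mod_cast hcon k)
    exact absurd (h.trans h2) (by push_cast; exact not_le.mpr (by exact_mod_cast Nat.lt_succ_self n))

/-- The translation `i ↦ n + i`. -/
def add (n : ℕ) : VEnd :=
  ofMonotone (fun i => n + i) (fun _ _ h => add_le_add_right h _) (fun b h => by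
    have : b = ⊤ := by
      by_contra hb
      lift b to ℕ using hb
      have := h (b + 1)
      norm_cast at this
      omega
    simp [this])

/-- The truncated translation `i ↦ i - n`. -/
def sub (n : ℕ) : VEnd :=
  ofMonotone (fun i => i - n) (fun _ _ h => tsub_le_tsub_right h _) (fun b h => by
    have : b = ⊤ := by
      by_contra hb
      lift b to ℕ using hb
      have := h (n + b + 1)
      norm_cast at this
      omega
    simp [this])

/-- The map `r₁` with `0 ↦ 0` and `i ↦ 1` for `i ≥ 1`. -/
def r1 : VEnd :=
  ofMonotone (fun i => min i 1) (fun _ _ h => min_le_min_right _ h) (fun b h => by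
    simpa using h 1)

/-- The constant maps. -/
def const (i : ℕ∞) : VEnd := ofMonotone (fun _ => i) (fun _ _ _ => le_rfl) (fun _ h => h 0)

@[simp] theorem add_apply (n : ℕ) (i : ℕ∞) : add n i = n + i := rfl
@[simp] theorem sub_apply (n : ℕ) (i : ℕ∞) : sub n i = i - n := rfl
@[simp] theorem r1_apply (i : ℕ∞) : r1 i = min i 1 := rfl
@[simp] theorem const_apply (i j : ℕ∞) : const i j = i := rfl

theorem sub_mul_add (n : ℕ) : sub n * add n = 1 := by
  ext i
  exact (ENat.addLECancellable_of_ne_top (ENat.natCast_ne_top n)).add_tsub_cancel_left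

theorem add_mul_sub_mul (n : ℕ) (e : VEnd) (h : ∀ i, (n : ℕ∞) ≤ e i) :
    add n * (sub n * e) = e := by
  ext i
  simp only [mul_apply, add_apply, sub_apply]
  exact add_tsub_cancel_of_le (h i)

theorem add_mul_add (m n : ℕ) : add m * add n = add (m + n) := by
  ext i
  simp [mul_apply, add_assoc]

theorem add_zero_eq : add 0 = 1 := by
  ext i
  simp [one_apply]

/-- `e.Hits n k`: `k` is the least natural number with `n ≤ e k`. -/
def Hits (e : VEnd) (n k : ℕ) : Prop := (n : ℕ∞) ≤ e k ∧ ∀ j < k, e j < n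

theorem Hits.unique {e : VEnd} {n k k' : ℕ} (h : e.Hits n k) (h' : e.Hits n k') : k = k' := by
  rcases lt_trichotomy k k' with hlt | rfl | hlt
  · exact absurd h.1 (not_le.mpr (h'.2 k hlt))
  · rfl
  · exact absurd h'.1 (not_le.mpr (h.2 k' hlt))

theorem exists_hits {e : VEnd} {n : ℕ} {i : ℕ∞} (h : (n : ℕ∞) ≤ e i) : ∃ k, e.Hits n k := by
  classical
  have h' := exists_le_of_le_top e n (h.trans (e.monotone le_top))
  exact ⟨Nat.find h', Nat.find_spec h', fun j hj => not_le.mp (Nat.find_min h' hj)⟩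

theorem Hits.le {e : VEnd} {n k : ℕ} (h : e.Hits n k) {i : ℕ∞} (hi : (k : ℕ∞) ≤ i) :
    (n : ℕ∞) ≤ e i := h.1.trans (e.monotone hi)

theorem Hits.le_of_le {e : VEnd} {n k : ℕ} (h : e.Hits n k) {i : ℕ∞} (hi : (n : ℕ∞) ≤ e i) :
    (k : ℕ∞) ≤ i := by
  by_contra hlt
  push Not at hlt
  lift i to ℕ using hlt.ne_top
  exact absurd hi (not_le.mpr (h.2 i (by exact_mod_cast hlt)))

theorem Hits.mul {d e : VEnd} {n k j : ℕ} (hd : d.Hits n k) (he : e.Hits k j) :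
    (d * e).Hits n j :=
  ⟨hd.le he.1, fun i hi => by
    by_contra hcon
    exact absurd (hd.le_of_le (not_lt.mp hcon)) (not_le.mpr (he.2 i hi))⟩

/-- The map `i ↦ e (k + i) - n`. -/
def shift (e : VEnd) (n k : ℕ) : VEnd := sub n * (e * add k)

@[simp] theorem shift_apply (e : VEnd) (n k : ℕ) (i : ℕ∞) : e.shift n k i = e (k + i) - n := rfl

theorem Hits.add_mul_shift {e : VEnd} {n k : ℕ} (h : e.Hits n k) :
    add n * e.shift n k = e * add k :=
  add_mul_sub_mul n _ fun _ => h.le le_self_add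

theorem Hits.shift_mul {d e : VEnd} {n k j : ℕ} (he : e.Hits k j) :
    (d * e).shift n j = d.shift n k * e.shift k j := by
  ext i
  change d (e (j + i)) - n = d (k + (e (j + i) - k)) - n
  rw [add_tsub_cancel_of_le (he.le le_self_add)]

theorem hits_zero (e : VEnd) : e.Hits 0 0 := ⟨by simp, fun _ h => absurd h (by simp)⟩

theorem shift_zero (e : VEnd) : e.shift 0 0 = e := by
  ext i
  simp

theorem hits_one (n : ℕ) : (1 : VEnd).Hits n n :=
  ⟨le_rfl, fun _ h => Nat.cast_lt.mpr h⟩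

theorem shift_one (n : ℕ) : (1 : VEnd).shift n n = 1 := sub_mul_add n

theorem Hits.add {e : VEnd} {n k m j : ℕ} (h : e.Hits n k) (h' : (e.shift n k).Hits m j) :
    e.Hits (n + m) (k + j) := by
  refine ⟨?_, fun i hi => ?_⟩
  · have h1 := h'.1
    rw [shift_apply] at h1
    have h2 : (n : ℕ∞) ≤ e (k + j) := h.le le_self_add
    rw [Nat.cast_add, Nat.cast_add, ← add_tsub_cancel_of_le h2]
    exact add_le_add_right h1 _
  · by_contra hcon
    rw [not_lt, Nat.cast_add] at hcon
    have hk : (k : ℕ∞) ≤ i := h.le_of_le (le_self_add.trans hcon)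
    have hk' : k ≤ i := Nat.cast_le.mp hk
    obtain ⟨l, rfl⟩ := Nat.exists_eq_add_of_le hk'
    have hl := h'.2 l (by omega)
    rw [shift_apply] at hl
    refine absurd hl (not_lt.mpr ?_)
    rw [Nat.cast_add] at hcon
    exact (ENat.addLECancellable_natCast n).le_tsub_of_add_le_left hcon

theorem shift_shift (e : VEnd) (n k m j : ℕ) :
    (e.shift n k).shift m j = e.shift (n + m) (k + j) := by
  ext i
  simp only [shift_apply, Nat.cast_add, tsub_tsub, add_assoc]

end VEnd

/-! ## Recursion in a cartesian closed category with a pointed strong monad -/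

universe v u

/-- A strong monad with a point `⊥_A : 1 ⟶ L A` that is natural and is preserved by the strength
and the multiplication. -/
structure PointedStrongMonad (C : Type u) [Category.{v} C] [CartesianMonoidalCategory C] where
  L : Monad C
  str (A B : C) : A ⊗ L.obj B ⟶ L.obj (A ⊗ B)
  str_natural {A A' B B' : C} (f : A ⟶ A') (g : B ⟶ B') :
    (f ⊗ₘ L.map g) ≫ str A' B' = str A B ≫ L.map (f ⊗ₘ g)
  str_unit (B : C) : str (𝟙_ C) B ≫ L.map (λ_ B).hom = (λ_ (L.obj B)).hom
  str_assoc (A B D : C) :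
    (α_ A B (L.obj D)).hom ≫ A ◁ str B D ≫ str A (B ⊗ D) =
      str (A ⊗ B) D ≫ L.map (α_ A B D).hom
  str_eta (A B : C) : A ◁ L.η.app B ≫ str A B = L.η.app (A ⊗ B)
  str_mu (A B : C) :
    A ◁ L.μ.app B ≫ str A B = str A (L.obj B) ≫ L.map (str A B) ≫ L.μ.app (A ⊗ B)
  bot (A : C) : 𝟙_ C ⟶ L.obj A
  bot_natural {A B : C} (f : A ⟶ B) : bot A ≫ L.map f = bot B
  str_bot (A B : C) : A ◁ bot B ≫ str A B = toUnit _ ≫ bot (A ⊗ B)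
  mu_bot (A : C) : bot (L.obj A) ≫ L.μ.app A = bot A

namespace PointedStrongMonad

variable {C : Type u} [Category.{v} C] [CartesianMonoidalCategory C] (M : PointedStrongMonad C)

/-- The object `Lⁿ 1`. -/
def pow : ℕ → C
  | 0 => 𝟙_ C
  | n + 1 => M.L.obj (pow n)

/-- The map `Lⁿ(!) : Lⁿ⁺¹ 1 ⟶ Lⁿ 1`. -/
def down : ∀ n, M.pow (n + 1) ⟶ M.pow n
  | 0 => toUnit _
  | n + 1 => M.L.map (down n)

/-- The map `Lⁿ(⊥) : Lⁿ 1 ⟶ Lⁿ⁺¹ 1`. -/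
def up : ∀ n, M.pow n ⟶ M.pow (n + 1)
  | 0 => M.bot (𝟙_ C)
  | n + 1 => M.L.map (up n)

/-- The diagram `1 ⟵ L 1 ⟵ L L 1 ⟵ ⋯`. -/
abbrev downSeq : ℕᵒᵖ ⥤ C := Functor.ofOpSequence M.down

/-- The diagram `1 ⟶ L 1 ⟶ L L 1 ⟶ ⋯`. -/
abbrev upSeq : ℕ ⥤ C := Functor.ofSequence M.up

/-- The canonical comparison maps `Lᵐ 1 ⟶ Lⁿ 1`: the composite of the maps `up` if `m ≤ n` and the
composite of the maps `down` if `n ≤ m`, see `trans_self`, `trans_succ` and `down_trans`. -/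
def trans : ∀ m n, M.pow m ⟶ M.pow n
  | 0, 0 => 𝟙 _
  | 0, n + 1 => M.bot (M.pow n)
  | _ + 1, 0 => toUnit _
  | m + 1, n + 1 => M.L.map (trans m n)

theorem trans_self (n : ℕ) : M.trans n n = 𝟙 _ := by
  induction n with
  | zero => rfl
  | succ n ih => exact (congrArg (fun f => M.L.map f) ih).trans (M.L.map_id _)

theorem trans_succ {m n : ℕ} (h : m ≤ n) : M.trans m (n + 1) = M.trans m n ≫ M.up n := by
  induction m generalizing n with
  | zero =>
    cases n with
    | zero => exact (Category.id_comp (M.bot (𝟙_ C))).symm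
    | succ n => exact (M.bot_natural (M.up n)).symm
  | succ m ih =>
    cases n with
    | zero => omega
    | succ n =>
      exact (congrArg (fun f => M.L.map f) (ih (Nat.le_of_succ_le_succ h))).trans
        (M.L.map_comp _ _)

theorem down_trans {m n : ℕ} (h : n ≤ m) : M.trans (m + 1) n = M.down m ≫ M.trans m n := by
  induction m generalizing n with
  | zero =>
    obtain rfl : n = 0 := by omega
    exact toUnit_unique _ _
  | succ m ih =>
    cases n with
    | zero => exact toUnit_unique _ _
    | succ n =>
      exact (congrArg (fun f => M.L.map f) (ih (Nat.le_of_succ_le_succ h))).trans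
        (M.L.map_comp _ _)

theorem trans_down (m n : ℕ) : M.trans m (n + 1) ≫ M.down n = M.trans m n := by
  induction m generalizing n with
  | zero =>
    cases n with
    | zero => exact toUnit_unique _ _
    | succ n => exact M.bot_natural (M.down n)
  | succ m ih =>
    cases n with
    | zero => exact toUnit_unique _ _
    | succ n =>
      exact (M.L.map_comp _ _).symm.trans (congrArg (fun f => M.L.map f) (ih n))

theorem up_trans (m n : ℕ) : M.up m ≫ M.trans (m + 1) n = M.trans m n := by
  induction m generalizing n with
  | zero =>
    cases n with
    | zero => exact toUnit_unique _ _
    | succ n => exact M.bot_natural (M.trans 0 n)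
  | succ m ih =>
    cases n with
    | zero => exact toUnit_unique _ _
    | succ n =>
      exact (M.L.map_comp _ _).symm.trans (congrArg (fun f => M.L.map f) (ih n))

/-- The point of `Lⁿ 1` given by iterating the unit. -/
def inftyApp : ∀ n, 𝟙_ C ⟶ M.pow n
  | 0 => 𝟙 _
  | n + 1 => inftyApp n ≫ M.L.η.app (M.pow n)

theorem inftyApp_down (n : ℕ) : M.inftyApp (n + 1) ≫ M.down n = M.inftyApp n := by
  induction n with
  | zero => exact toUnit_unique _ _
  | succ n ih =>
    have h : M.down n ≫ M.L.η.app (M.pow n) = M.L.η.app (M.pow (n + 1)) ≫ M.L.map (M.down n) :=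
      M.L.η.naturality (M.down n)
    exact (Category.assoc _ _ _).trans <| (congrArg (M.inftyApp (n + 1) ≫ ·) h.symm).trans <|
      (Category.assoc _ _ _).symm.trans (congrArg (· ≫ M.L.η.app (M.pow n)) ih)

variable {Γ X : C}

/-- The approximations `Γ × Lⁿ 1 ⟶ L X` of a fixed point of `f`. -/
def ap (f : Γ ⊗ M.L.obj X ⟶ M.L.obj X) : ∀ n, Γ ⊗ M.pow n ⟶ M.L.obj X
  | 0 => toUnit _ ≫ M.bot X
  | n + 1 => M.str Γ (M.pow n) ≫ M.L.map (lift (fst _ _) (ap f n)) ≫ M.L.map f ≫ M.L.μ.app X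

theorem bot_ap {B : C} (g : Γ ⊗ B ⟶ Γ ⊗ M.L.obj X) (f : Γ ⊗ M.L.obj X ⟶ M.L.obj X) :
    Γ ◁ M.bot B ≫ M.str Γ B ≫ M.L.map g ≫ M.L.map f ≫ M.L.μ.app X = toUnit _ ≫ M.bot X := by
  rw [← Category.assoc, M.str_bot, Category.assoc, ← Category.assoc (M.bot _),
    M.bot_natural, ← Category.assoc (M.bot _), M.bot_natural, M.mu_bot]

theorem map_ap {B B' : C} (u : B ⟶ B') (g : Γ ⊗ B' ⟶ M.L.obj X)
    (f : Γ ⊗ M.L.obj X ⟶ M.L.obj X) :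
    Γ ◁ M.L.map u ≫ M.str Γ B' ≫ M.L.map (lift (fst _ _) g) ≫ M.L.map f ≫ M.L.μ.app X =
      M.str Γ B ≫ M.L.map (lift (fst _ _) (Γ ◁ u ≫ g)) ≫ M.L.map f ≫ M.L.μ.app X := by
  have h := M.str_natural (𝟙 Γ) u
  rw [id_tensorHom, id_tensorHom] at h
  rw [← Category.assoc, h, Category.assoc, ← Category.assoc (M.L.map _), ← Functor.map_comp,
    comp_lift, whiskerLeft_fst]

theorem ap_up (f : Γ ⊗ M.L.obj X ⟶ M.L.obj X) (n : ℕ) :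
    Γ ◁ M.up n ≫ M.ap f (n + 1) = M.ap f n := by
  induction n with
  | zero => exact M.bot_ap _ f
  | succ n ih =>
    refine (M.map_ap (M.up n) (M.ap f (n + 1)) f).trans ?_
    rw [ih]
    rfl

section Omega

variable [HasLimitsOfShape ℕᵒᵖ C] [HasColimitsOfShape ℕ C]

/-- The extended vertical natural numbers. -/
def omegaBar : C := limit M.downSeq

/-- The finite vertical natural numbers. -/
def omega : C := colimit M.upSeq

/-- The canonical cone with apex `Lᵐ 1` over the diagram defining `ω̄`. -/
def powCone (m : ℕ) : Cone M.downSeq where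
  pt := M.pow m
  π := NatTrans.ofOpSequence (F := (Functor.const ℕᵒᵖ).obj (M.pow m)) (M.trans m) fun n => by
    rw [Functor.ofOpSequence_map_homOfLE_succ]
    exact (Category.id_comp _).trans (M.trans_down m n).symm

/-- The canonical map `Lᵐ 1 ⟶ ω̄`. -/
def toOmegaBar (m : ℕ) : M.pow m ⟶ M.omegaBar := limit.lift M.downSeq (M.powCone m)

set_option linter.unusedSectionVars false in
theorem toOmegaBar_π (m : ℕ) (n : ℕᵒᵖ) :
    M.toOmegaBar m ≫ limit.π M.downSeq n = M.trans m n.unop :=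
  limit.lift_π (M.powCone m) n

theorem up_toOmegaBar (m : ℕ) : M.up m ≫ M.toOmegaBar (m + 1) = M.toOmegaBar m :=
  limit.hom_ext fun n => (Category.assoc _ _ _).trans <|
    (congrArg (M.up m ≫ ·) (M.toOmegaBar_π (m + 1) n)).trans <|
      (M.up_trans m n.unop).trans (M.toOmegaBar_π m n).symm

/-- The cocone with apex `ω̄` over the diagram defining `ω`. -/
def inclCocone : Cocone M.upSeq where
  pt := M.omegaBar
  ι := NatTrans.ofSequence (G := (Functor.const ℕ).obj M.omegaBar) M.toOmegaBar fun n => by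
    rw [Functor.ofSequence_map_homOfLE_succ]
    exact (M.up_toOmegaBar n).trans (Category.comp_id _).symm

/-- The comparison map `i : ω ⟶ ω̄`. -/
def incl : M.omega ⟶ M.omegaBar := colimit.desc M.upSeq M.inclCocone

/-- The cone with apex `1` over the diagram defining `ω̄`. -/
def inftyCone : Cone M.downSeq where
  pt := 𝟙_ C
  π := NatTrans.ofOpSequence (F := (Functor.const ℕᵒᵖ).obj (𝟙_ C)) M.inftyApp fun n => by
    rw [Functor.ofOpSequence_map_homOfLE_succ]
    exact (Category.id_comp _).trans (M.inftyApp_down n).symm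

/-- The point `∞ : 1 ⟶ ω̄`. -/
def infty : 𝟙_ C ⟶ M.omegaBar := limit.lift M.downSeq M.inftyCone

/-- `X` is `L`-complete: every map `A × ω ⟶ X` factors uniquely through
`id × i : A × ω ⟶ A × ω̄`, for every object `A`. -/
def IsComplete (X : C) : Prop :=
  ∀ (A : C) (f : A ⊗ M.omega ⟶ X), ∃! g : A ⊗ M.omegaBar ⟶ X, A ◁ M.incl ≫ g = f

variable [MonoidalClosed C]

/-- The approximations, as a cocone with apex `Γ ⇒ L X` over the diagram defining `ω`. -/
def apCocone (f : Γ ⊗ M.L.obj X ⟶ M.L.obj X) : Cocone M.upSeq where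
  pt := (ihom Γ).obj (M.L.obj X)
  ι := NatTrans.ofSequence (G := (Functor.const ℕ).obj ((ihom Γ).obj (M.L.obj X)))
    (fun n => MonoidalClosed.curry (M.ap f n)) fun n => by
      rw [Functor.ofSequence_map_homOfLE_succ]
      refine Eq.trans ?_ (Category.comp_id _).symm
      exact (MonoidalClosed.curry_natural_left _ _).symm.trans
        (congrArg MonoidalClosed.curry (M.ap_up f n))

/-- The map `Γ × ω ⟶ L X` determined by the approximations. -/
def apOmega (f : Γ ⊗ M.L.obj X ⟶ M.L.obj X) : Γ ⊗ M.omega ⟶ M.L.obj X :=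
  MonoidalClosed.uncurry (colimit.desc M.upSeq (M.apCocone f))

/-- The unique extension of `apOmega` to `Γ × ω̄`. -/
def apBar (hX : M.IsComplete (M.L.obj X)) (f : Γ ⊗ M.L.obj X ⟶ M.L.obj X) :
    Γ ⊗ M.omegaBar ⟶ M.L.obj X :=
  (hX Γ (M.apOmega f)).choose

/-- The fixed point `ξ_f : Γ ⟶ L X` of `f : Γ × L X ⟶ L X`, that is, the extended chain of
approximations evaluated at `∞`. -/
def xi (hX : M.IsComplete (M.L.obj X)) (f : Γ ⊗ M.L.obj X ⟶ M.L.obj X) : Γ ⟶ M.L.obj X :=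
  lift (𝟙 Γ) (toUnit Γ ≫ M.infty) ≫ M.apBar hX f

/-- The fixed point `φ_g : Γ ⟶ X` of `g : Γ × X ⟶ X`, for an `L`-algebra structure
`a : L X ⟶ X`. -/
def phi (hX : M.IsComplete (M.L.obj X)) (a : M.L.obj X ⟶ X) (g : Γ ⊗ X ⟶ X) : Γ ⟶ X :=
  M.xi hX (Γ ◁ a ≫ g ≫ M.L.η.app X) ≫ a

end Omega

variable [MonoidalClosed C]

/-- The object `A ⇒ L B` of partial functions. -/
abbrev arr (A B : C) : C := (ihom A).obj (M.L.obj B)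

/-- The `L`-algebra structure `L (A ⇒ L B) ⟶ (A ⇒ L B)`. -/
def arrAlg (A B : C) : M.L.obj (M.arr A B) ⟶ M.arr A B :=
  MonoidalClosed.curry
    (M.str A (M.arr A B) ≫ M.L.map ((ihom.ev A).app (M.L.obj B)) ≫ M.L.μ.app B)

/-- The fixed point `rec_F : Γ ⟶ (A ⇒ L B)` of `F : A × ((A ⇒ L B) × Γ) ⟶ L B`. -/
def recMap [HasLimitsOfShape ℕᵒᵖ C] [HasColimitsOfShape ℕ C] {Γ A B : C}
    (h : M.IsComplete (M.L.obj (M.arr A B))) (F : A ⊗ (M.arr A B ⊗ Γ) ⟶ M.L.obj B) :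
    Γ ⟶ M.arr A B :=
  M.phi h (M.arrAlg A B) (lift (snd _ _) (fst _ _) ≫ MonoidalClosed.curry F)

/-- Kleisli composition with a parameter: `f : Γ ⟶ L A` followed by `g : A × Γ ⟶ L B`. -/
def bind {Γ A B : C} (f : Γ ⟶ M.L.obj A) (g : A ⊗ Γ ⟶ M.L.obj B) : Γ ⟶ M.L.obj B :=
  lift (𝟙 Γ) f ≫ M.str Γ A ≫ M.L.map (lift (snd _ _) (fst _ _) ≫ g) ≫ M.L.μ.app B

end PointedStrongMonad

/-! ## Generic semidecidable subobjects, lifting monads and normal models -/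

section Normal

variable {C : Type u} [Category.{v} C] [CartesianMonoidalCategory C] {D : C}

/-- `m : A' ⟶ A` is a pullback of `t : 1 ⟶ D` along some map `A ⟶ D`. -/
def IsSemidecidable (t : 𝟙_ C ⟶ D) {A' A : C} (m : A' ⟶ A) : Prop :=
  ∃ φ : A ⟶ D, IsPullback m (toUnit A') φ t

/-- `t : 1 ⟶ D` is a generic semidecidable subobject. -/
structure IsGenericSemidecidable (t : 𝟙_ C ⟶ D) : Prop where
  unique {A' A : C} (m : A' ⟶ A) (hm : IsSemidecidable t m) :
    ∃! φ : A ⟶ D, IsPullback m (toUnit A') φ t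
  initial {Z A : C} (hZ : Nonempty (IsInitial Z)) (m : Z ⟶ A) : IsSemidecidable t m
  comp {A'' A' A : C} (m : A'' ⟶ A') (n : A' ⟶ A) (hm : IsSemidecidable t m)
    (hn : IsSemidecidable t n) : IsSemidecidable t (m ≫ n)

/-- `M` is the lifting monad of `t : 1 ⟶ D`: the unit `η_B : B ⟶ L B` classifies the partial maps
into `B` with semidecidable domain, and the remaining structure is the one induced by partial
maps. -/
structure IsLiftingMonad (t : 𝟙_ C ⟶ D) (M : PointedStrongMonad C) : Prop where
  unit (B : C) : IsSemidecidable t (M.L.η.app B)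
  classify {A' A B : C} (m : A' ⟶ A) (hm : IsSemidecidable t m) (f : A' ⟶ B) :
    ∃! g : A ⟶ M.L.obj B, IsPullback m f g (M.L.η.app B)
  map {A B : C} (f : A ⟶ B) : IsPullback (M.L.η.app A) f (M.L.map f) (M.L.η.app B)
  mul (B : C) : IsPullback (M.L.η.app B ≫ M.L.η.app (M.L.obj B)) (𝟙 B) (M.L.μ.app B)
    (M.L.η.app B)
  str (A B : C) : IsPullback (A ◁ M.L.η.app B) (𝟙 (A ⊗ B)) (M.str A B) (M.L.η.app (A ⊗ B))
  bot {Z : C} (hZ : IsInitial Z) (B : C) :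
    IsPullback (toUnit Z) (hZ.to B) (M.bot B) (M.L.η.app B)

/-- The conditions, on a topos with `t : 1 ⟶ D` and lifting monad `M`, for a normal model:
`t` is a generic semidecidable subobject and `L N` is complete, where `N = 1 + 1 + ⋯`. -/
structure IsNormalModel [HasLimitsOfShape ℕᵒᵖ C] [HasColimitsOfShape ℕ C]
    [HasCoproduct fun _ : ℕ => 𝟙_ C] (t : 𝟙_ C ⟶ D) (M : PointedStrongMonad C) : Prop where
  generic : IsGenericSemidecidable t
  lifting : IsLiftingMonad t M
  complete : M.IsComplete (M.L.obj (∐ fun _ : ℕ => 𝟙_ C))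

end Normal

/-! ## Presheaves on `VEnd`, and the lifting monad -/

/-- The category of presheaves on the one-object category with endomorphism monoid `VEnd`. -/
abbrev VSet : Type 1 := (SingleObj VEnd)ᵒᵖ ⥤ Type

namespace VSet

/-- The set of abstract chains of a presheaf. -/
abbrev el (X : VSet) : Type := X.obj (op (SingleObj.star VEnd))

/-- The (right) action of the monoid `VEnd`. -/
def act (X : VSet) (e : VEnd) (x : X.el) : X.el :=
  X.map (Quiver.Hom.op (show SingleObj.star VEnd ⟶ SingleObj.star VEnd from e)) x

theorem act_one (X : VSet) (x : X.el) : X.act 1 x = x :=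
  congrArg (fun f => f x) (X.map_id (op (SingleObj.star VEnd)))

theorem act_mul (X : VSet) (d e : VEnd) (x : X.el) : X.act (d * e) x = X.act e (X.act d x) :=
  congrArg (fun f => f x) (X.map_comp
    (Quiver.Hom.op (show SingleObj.star VEnd ⟶ SingleObj.star VEnd from d))
    (Quiver.Hom.op (show SingleObj.star VEnd ⟶ SingleObj.star VEnd from e)))

/-- The underlying function of a morphism. -/
def fn {X Y : VSet} (f : X ⟶ Y) (x : X.el) : Y.el := f.app (op (SingleObj.star VEnd)) x

theorem fn_act {X Y : VSet} (f : X ⟶ Y) (e : VEnd) (x : X.el) :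
    fn f (X.act e x) = Y.act e (fn f x) :=
  congrArg (fun g => g x)
    (f.naturality (Quiver.Hom.op (show SingleObj.star VEnd ⟶ SingleObj.star VEnd from e)))

theorem hom_ext {X Y : VSet} {f g : X ⟶ Y} (h : ∀ x, fn f x = fn g x) : f = g := by
  ext c x
  exact h x

/-- The presheaf given by a set with a right action of `VEnd`. -/
def ofAct (S : Type) (a : VEnd → S → S) (h1 : ∀ x, a 1 x = x)
    (hmul : ∀ d e x, a (d * e) x = a e (a d x)) : VSet where
  obj _ := S
  map f := ↾(a f.unop)
  map_id _ := by
    ext x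
    exact h1 x
  map_comp f g := by
    ext x
    exact hmul f.unop g.unop x

/-- The morphism given by an equivariant function. -/
def homMk {X Y : VSet} (f : X.el → Y.el) (h : ∀ e x, f (X.act e x) = Y.act e (f x)) : X ⟶ Y where
  app _ := ↾f
  naturality _ _ e := by
    ext x
    exact h e.unop x

/-- The object `Δ`, the splitting of the idempotent `r₁` of the representable presheaf. -/
def Delta : VSet :=
  ofAct {d : VEnd // VEnd.r1 * d = d} (fun e d => ⟨d.1 * e, congrArg (· * e) d.2⟩)
    (fun _ => rfl) (fun _ _ _ => rfl)

/-- The point `⊤ : 1 ⟶ Δ`, the constant map with value `1`. -/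
def truth : 𝟙_ VSet ⟶ Delta :=
  homMk (fun _ => (⟨VEnd.const 1, by ext i; simp [VEnd.mul_apply]⟩ : {d : VEnd // VEnd.r1 * d = d}))
    (fun _ _ => rfl)

open Classical in
/-- The action on `{⊥} + ∑ n, X(V)ₙ`: the element `⊥` is `none`, and `s` in the `n`-th copy of
`X(V)` is `some (n, s)`, which stands for the chain `s` preceded by `n` copies of `⊥`. -/
def liftAct (X : VSet) (e : VEnd) : Option (ℕ × X.el) → Option (ℕ × X.el)
  | none => none
  | some (n, s) =>
    if h : ∃ k, e.Hits n k then some (h.choose, X.act (e.shift n h.choose) s) else none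

theorem liftAct_none (X : VSet) (e : VEnd) : X.liftAct e none = none := rfl

theorem liftAct_hits (X : VSet) {e : VEnd} {n k : ℕ} (hk : e.Hits n k) (s : X.el) :
    X.liftAct e (some (n, s)) = some (k, X.act (e.shift n k) s) := by
  have h : ∃ k, e.Hits n k := ⟨k, hk⟩
  obtain rfl : h.choose = k := h.choose_spec.unique hk
  simp only [liftAct, dif_pos h]

theorem liftAct_not (X : VSet) {e : VEnd} {n : ℕ} (h : ¬ ∃ k, e.Hits n k) (s : X.el) :
    X.liftAct e (some (n, s)) = none := by
  simp only [liftAct, dif_neg h]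

/-- The object `L X`. -/
def liftObj (X : VSet) : VSet :=
  ofAct (Option (ℕ × X.el)) X.liftAct
    (by
      rintro (_ | ⟨n, s⟩)
      · rfl
      · rw [liftAct_hits X (VEnd.hits_one n), VEnd.shift_one, act_one])
    (by
      rintro d e (_ | ⟨n, s⟩)
      · rfl
      · by_cases hd : ∃ k, d.Hits n k
        · obtain ⟨k, hk⟩ := hd
          rw [liftAct_hits X hk]
          by_cases he : ∃ j, e.Hits k j
          · obtain ⟨j, hj⟩ := he
            rw [liftAct_hits X hj, liftAct_hits X (hk.mul hj), hj.shift_mul, act_mul]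
          · rw [liftAct_not X he, liftAct_not X]
            rintro ⟨j, hj⟩
            exact he (VEnd.exists_hits (hk.le_of_le hj.1))
        · rw [liftAct_not X hd, liftAct_none, liftAct_not X]
          rintro ⟨j, hj⟩
          exact hd (VEnd.exists_hits hj.1))

theorem liftObj_act_none (X : VSet) (e : VEnd) :
    X.liftObj.act e (none : Option (ℕ × X.el)) = (none : Option (ℕ × X.el)) := rfl

/-- Equivariance of a function on `L X` need only be checked on the following cases. -/
theorem lift_cases {X : VSet} {P : VEnd → Option (ℕ × X.el) → Prop}
    (h0 : ∀ e, P e none) (h1 : ∀ e n s k, e.Hits n k → P e (some (n, s)))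
    (h2 : ∀ e n s, (¬ ∃ k, e.Hits n k) → P e (some (n, s))) (e : VEnd) (x : Option (ℕ × X.el)) :
    P e x := by
  rcases x with _ | ⟨n, s⟩
  · exact h0 e
  · by_cases h : ∃ k, e.Hits n k
    · obtain ⟨k, hk⟩ := h
      exact h1 e n s k hk
    · exact h2 e n s h

/-- The action of `L` on morphisms. -/
def liftMap {X Y : VSet} (f : X ⟶ Y) : X.liftObj ⟶ Y.liftObj :=
  homMk (fun x : Option (ℕ × X.el) => (x.map fun p => (p.1, fn f p.2) : Option (ℕ × Y.el)))
    (lift_cases (fun _ => rfl)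
      (fun e n s k hk => by
        change Option.map _ (X.liftAct e (some (n, s))) = Y.liftAct e (some (n, fn f s))
        rw [liftAct_hits X hk, liftAct_hits Y hk, ← fn_act]
        rfl)
      (fun e n s h => by
        change Option.map _ (X.liftAct e (some (n, s))) = Y.liftAct e (some (n, fn f s))
        rw [liftAct_not X h, liftAct_not Y h]
        rfl))

/-- The unit `s ↦ s ∈ X(V)₀`. -/
def liftEta (X : VSet) : X ⟶ X.liftObj :=
  homMk (fun s => (some (0, s) : Option (ℕ × X.el))) (fun e s => by
    change _ = X.liftAct e (some (0, s))
    rw [liftAct_hits X e.hits_zero, VEnd.shift_zero])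

/-- The multiplication on elements. -/
def liftMuFn (X : VSet) : Option (ℕ × Option (ℕ × X.el)) → Option (ℕ × X.el)
  | none => none
  | some (_, none) => none
  | some (n, some (m, s)) => some (n + m, s)

/-- The multiplication, which sends `s ∈ X(V)ₘ` in the `n`-th copy of `L X` to `s ∈ X(V)ₙ₊ₘ`. -/
def liftMu (X : VSet) : X.liftObj.liftObj ⟶ X.liftObj :=
  homMk (X.liftMuFn)
    (lift_cases (fun _ => rfl)
      (fun e n s k hk => by
        change X.liftMuFn (X.liftObj.liftAct e (some (n, s))) = X.liftAct e (X.liftMuFn (some (n, s)))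
        rw [liftAct_hits X.liftObj hk]
        rcases s with _ | ⟨m, s⟩
        · rfl
        · change X.liftMuFn (some (k, X.liftAct (e.shift n k) (some (m, s)))) =
            X.liftAct e (some (n + m, s))
          by_cases h : ∃ j, (e.shift n k).Hits m j
          · obtain ⟨j, hj⟩ := h
            rw [liftAct_hits X hj, liftAct_hits X (hk.add hj), VEnd.shift_shift]
            rfl
          · rw [liftAct_not X h, liftAct_not X]
            · rfl
            · rintro ⟨l, hl⟩
              have hkl : (k : ℕ∞) ≤ l :=
                hk.le_of_le (le_trans (Nat.cast_le.mpr (Nat.le_add_right n m)) hl.1)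
              obtain ⟨j, rfl⟩ := Nat.exists_eq_add_of_le (Nat.cast_le.mp hkl)
              refine h (VEnd.exists_hits (i := j) ?_)
              rw [VEnd.shift_apply]
              refine (ENat.addLECancellable_natCast n).le_tsub_of_add_le_left ?_
              exact_mod_cast hl.1)
      (fun e n s h => by
        change X.liftMuFn (X.liftObj.liftAct e (some (n, s))) = X.liftAct e (X.liftMuFn (some (n, s)))
        rw [liftAct_not X.liftObj h]
        rcases s with _ | ⟨m, s⟩
        · rfl
        · refine (liftAct_not X ?_ s).symm
          rintro ⟨l, hl⟩
          exact h (VEnd.exists_hits (le_trans (Nat.cast_le.mpr (Nat.le_add_right n m)) hl.1))))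

/-- The strength on elements. -/
def liftStrFn (A B : VSet) : A.el × Option (ℕ × B.el) → Option (ℕ × (A.el × B.el))
  | (_, none) => none
  | (a, some (n, s)) => some (n, (A.act (VEnd.add n) a, s))

/-- The strength, which drops the first `n` entries of the chain `a` if `s ∈ B(V)ₙ`. -/
def liftStr (A B : VSet) : A ⊗ B.liftObj ⟶ (A ⊗ B).liftObj :=
  homMk (Y := (A ⊗ B).liftObj) (liftStrFn A B) (by
    rintro e ⟨a, x⟩
    change liftStrFn A B (A.act e a, B.liftAct e x) = (A ⊗ B).liftAct e (liftStrFn A B (a, x))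
    revert e x
    refine lift_cases (fun _ => rfl) (fun e n s k hk => ?_) (fun e n s h => ?_)
    · rw [liftAct_hits B hk]
      refine Eq.trans ?_ (liftAct_hits (A ⊗ B) hk (A.act (VEnd.add n) a, s)).symm
      change some (k, (A.act (VEnd.add k) (A.act e a), _)) =
        some (k, (A.act (e.shift n k) (A.act (VEnd.add n) a), _))
      rw [← act_mul, ← act_mul, hk.add_mul_shift]
      rfl
    · rw [liftAct_not B h]
      exact (liftAct_not (A ⊗ B) h (A.act (VEnd.add n) a, s)).symm)

/-- The lifting monad `L`. -/
def liftL : Monad VSet where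
  obj := liftObj
  map := liftMap
  map_id X := hom_ext (by rintro (_ | ⟨n, s⟩) <;> rfl)
  map_comp f g := hom_ext (by rintro (_ | ⟨n, s⟩) <;> rfl)
  η := { app := liftEta, naturality := fun _ _ _ => hom_ext fun _ => rfl }
  μ := { app := liftMu
         naturality := fun _ _ _ => hom_ext (by rintro (_ | ⟨n, _ | ⟨m, s⟩⟩) <;> rfl) }
  assoc X := hom_ext (by
    rintro (_ | ⟨n, _ | ⟨m, _ | ⟨l, s⟩⟩⟩)
    · rfl
    · rfl
    · rfl
    · exact congrArg (fun k => (some (k, s) : Option (ℕ × X.el))) (Nat.add_assoc n m l).symm)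
  left_unit X := hom_ext (by
    rintro (_ | ⟨n, s⟩)
    · rfl
    · exact congrArg (fun k => (some (k, s) : Option (ℕ × X.el))) (Nat.zero_add n))
  right_unit X := hom_ext (by rintro (_ | ⟨n, s⟩) <;> rfl)

/-- The lifting monad with its strength and its point. -/
def lifting : PointedStrongMonad VSet where
  L := liftL
  str := liftStr
  str_natural f g := hom_ext (by
    rintro ⟨a, _ | ⟨n, s⟩⟩
    · rfl
    · exact congrArg (fun b => some (n, (b, fn g s))) (fn_act f (VEnd.add n) a).symm)
  str_unit B := hom_ext (by rintro ⟨a, _ | ⟨n, s⟩⟩ <;> rfl)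
  str_assoc A B D := hom_ext (by rintro ⟨⟨a, b⟩, _ | ⟨n, s⟩⟩ <;> rfl)
  str_eta A B := hom_ext (by
    rintro ⟨a, s⟩
    refine congrArg (fun b => some (0, (b, s))) ((congrArg (fun e => A.act e a) ?_).trans
      (A.act_one a))
    exact VEnd.add_zero_eq)
  str_mu A B := hom_ext (by
    rintro ⟨a, _ | ⟨n, _ | ⟨m, s⟩⟩⟩
    · rfl
    · rfl
    · refine congrArg (fun b => some (n + m, (b, s))) ?_
      exact (congrArg (fun e => A.act e a) (VEnd.add_mul_add n m).symm).trans (A.act_mul _ _ a))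
  bot A := homMk (fun _ => (none : Option (ℕ × A.el))) (fun _ _ => rfl)
  bot_natural f := hom_ext fun _ => rfl
  str_bot A B := hom_ext fun _ => rfl
  mu_bot A := hom_ext fun _ => rfl

end VSet

/-! ## The language -/

namespace PCFv

inductive Ty : Type
  | empty : Ty
  | unit : Ty
  | nat : Ty
  | sum : Ty → Ty → Ty
  | prod : Ty → Ty → Ty
  | arrow : Ty → Ty → Ty

/-- Ground types are the types in which `arrow` does not occur. -/
def Ty.IsGround : Ty → Prop
  | .empty => True
  | .unit => True
  | .nat => True
  | .sum σ τ => σ.IsGround ∧ τ.IsGround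
  | .prod σ τ => σ.IsGround ∧ τ.IsGround
  | .arrow _ _ => False

/-- Contexts; the most recently bound variable comes first. -/
abbrev Ctx : Type := List Ty

/-- `Var Γ τ` is the type of variables of type `τ` in the context `Γ`. -/
inductive Var : Ctx → Ty → Type
  | here {Γ : Ctx} {τ : Ty} : Var (τ :: Γ) τ
  | there {Γ : Ctx} {σ τ : Ty} : Var Γ τ → Var (σ :: Γ) τ

mutual

/-- Values `Γ ⊢ v : τ`, as typing derivations. -/
inductive Val : Ctx → Ty → Type
  | var {Γ : Ctx} {τ : Ty} : Var Γ τ → Val Γ τ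
  | star {Γ : Ctx} : Val Γ .unit
  | inl {Γ : Ctx} {σ τ : Ty} : Val Γ σ → Val Γ (.sum σ τ)
  | inr {Γ : Ctx} {σ τ : Ty} : Val Γ τ → Val Γ (.sum σ τ)
  | pair {Γ : Ctx} {σ τ : Ty} : Val Γ σ → Val Γ τ → Val Γ (.prod σ τ)
  | zero {Γ : Ctx} : Val Γ .nat
  | succ {Γ : Ctx} : Val Γ .nat → Val Γ .nat
  | lam {Γ : Ctx} {σ τ : Ty} : Comp (σ :: Γ) τ → Val Γ (.arrow σ τ)
  /-- `rec f x. t`, where `x` is the most recently bound variable of `t`, followed by `f`. -/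
  | recFun {Γ : Ctx} {σ τ : Ty} : Comp (σ :: .arrow σ τ :: Γ) τ → Val Γ (.arrow σ τ)

/-- Computations `Γ ⊢ t : τ`, as typing derivations. -/
inductive Comp : Ctx → Ty → Type
  | caseEmpty {Γ : Ctx} {τ : Ty} : Val Γ .empty → Comp Γ τ
  | ret {Γ : Ctx} {τ : Ty} : Val Γ τ → Comp Γ τ
  | caseSum {Γ : Ctx} {σ τ ρ : Ty} :
      Val Γ (.sum σ τ) → Comp (σ :: Γ) ρ → Comp (τ :: Γ) ρ → Comp Γ ρ
  | fst {Γ : Ctx} {σ τ : Ty} : Val Γ (.prod σ τ) → Comp Γ σ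
  | snd {Γ : Ctx} {σ τ : Ty} : Val Γ (.prod σ τ) → Comp Γ τ
  | app {Γ : Ctx} {σ τ : Ty} : Val Γ (.arrow σ τ) → Val Γ σ → Comp Γ τ
  | caseNat {Γ : Ctx} {τ : Ty} : Val Γ .nat → Comp Γ τ → Comp (.nat :: Γ) τ → Comp Γ τ
  | letIn {Γ : Ctx} {σ τ : Ty} : Comp Γ σ → Comp (σ :: Γ) τ → Comp Γ τ

end

/-! ### Substitution -/

/-- Renamings of variables. -/
abbrev Ren (Γ Δ : Ctx) : Type := ∀ τ, Var Γ τ → Var Δ τ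

/-- The renaming under a binder. -/
def Ren.lift {Γ Δ : Ctx} {σ : Ty} (r : Ren Γ Δ) : Ren (σ :: Γ) (σ :: Δ)
  | _, .here => .here
  | _, .there x => .there (r _ x)

mutual

def Val.rename : {Γ Δ : Ctx} → {τ : Ty} → Ren Γ Δ → Val Γ τ → Val Δ τ
  | _, _, _, r, .var x => .var (r _ x)
  | _, _, _, _, .star => .star
  | _, _, _, r, .inl v => .inl (v.rename r)
  | _, _, _, r, .inr v => .inr (v.rename r)
  | _, _, _, r, .pair v w => .pair (v.rename r) (w.rename r)
  | _, _, _, _, .zero => .zero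
  | _, _, _, r, .succ v => .succ (v.rename r)
  | _, _, _, r, .lam t => .lam (t.rename r.lift)
  | _, _, _, r, .recFun t => .recFun (t.rename r.lift.lift)

def Comp.rename : {Γ Δ : Ctx} → {τ : Ty} → Ren Γ Δ → Comp Γ τ → Comp Δ τ
  | _, _, _, r, .caseEmpty v => .caseEmpty (v.rename r)
  | _, _, _, r, .ret v => .ret (v.rename r)
  | _, _, _, r, .caseSum v t u => .caseSum (v.rename r) (t.rename r.lift) (u.rename r.lift)
  | _, _, _, r, .fst v => .fst (v.rename r)
  | _, _, _, r, .snd v => .snd (v.rename r)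
  | _, _, _, r, .app v w => .app (v.rename r) (w.rename r)
  | _, _, _, r, .caseNat v t u => .caseNat (v.rename r) (t.rename r) (u.rename r.lift)
  | _, _, _, r, .letIn t u => .letIn (t.rename r) (u.rename r.lift)

end

/-- Simultaneous substitutions of values for variables. -/
abbrev Sub (Γ Δ : Ctx) : Type := ∀ τ, Var Γ τ → Val Δ τ

/-- The identity substitution. -/
def Sub.ids (Γ : Ctx) : Sub Γ Γ := fun _ x => .var x

/-- The extension of a substitution by a value for one more variable. -/
def Sub.cons {Γ Δ : Ctx} {σ : Ty} (v : Val Δ σ) (s : Sub Γ Δ) : Sub (σ :: Γ) Δ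
  | _, .here => v
  | _, .there x => s _ x

/-- The substitution under a binder. -/
def Sub.lift {Γ Δ : Ctx} {σ : Ty} (s : Sub Γ Δ) : Sub (σ :: Γ) (σ :: Δ)
  | _, .here => .var .here
  | _, .there x => (s _ x).rename fun _ => .there

mutual

def Val.subst : {Γ Δ : Ctx} → {τ : Ty} → Sub Γ Δ → Val Γ τ → Val Δ τ
  | _, _, _, s, .var x => s _ x
  | _, _, _, _, .star => .star
  | _, _, _, s, .inl v => .inl (v.subst s)
  | _, _, _, s, .inr v => .inr (v.subst s)
  | _, _, _, s, .pair v w => .pair (v.subst s) (w.subst s)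
  | _, _, _, _, .zero => .zero
  | _, _, _, s, .succ v => .succ (v.subst s)
  | _, _, _, s, .lam t => .lam (t.subst s.lift)
  | _, _, _, s, .recFun t => .recFun (t.subst s.lift.lift)

def Comp.subst : {Γ Δ : Ctx} → {τ : Ty} → Sub Γ Δ → Comp Γ τ → Comp Δ τ
  | _, _, _, s, .caseEmpty v => .caseEmpty (v.subst s)
  | _, _, _, s, .ret v => .ret (v.subst s)
  | _, _, _, s, .caseSum v t u => .caseSum (v.subst s) (t.subst s.lift) (u.subst s.lift)
  | _, _, _, s, .fst v => .fst (v.subst s)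
  | _, _, _, s, .snd v => .snd (v.subst s)
  | _, _, _, s, .app v w => .app (v.subst s) (w.subst s)
  | _, _, _, s, .caseNat v t u => .caseNat (v.subst s) (t.subst s) (u.subst s.lift)
  | _, _, _, s, .letIn t u => .letIn (t.subst s) (u.subst s.lift)

end

/-- `t[v/x]`, for the most recently bound variable `x`. -/
def Comp.inst {Γ : Ctx} {σ τ : Ty} (t : Comp (σ :: Γ) τ) (v : Val Γ σ) : Comp Γ τ :=
  t.subst (.cons v (.ids Γ))

/-- `t[w/f, v/x]`, for the two most recently bound variables, `x` and then `f`. -/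
def Comp.inst2 {Γ : Ctx} {σ σ' τ : Ty} (t : Comp (σ :: σ' :: Γ) τ) (v : Val Γ σ)
    (w : Val Γ σ') : Comp Γ τ :=
  t.subst (.cons v (.cons w (.ids Γ)))

/-! ### Big-step operational semantics -/

/-- The relation `t ⇓_τ v` between closed computations and closed values. -/
inductive BigStep : {τ : Ty} → Comp [] τ → Val [] τ → Prop
  | ret {τ : Ty} (v : Val [] τ) : BigStep (.ret v) v
  | fst {σ τ : Ty} (v : Val [] σ) (w : Val [] τ) : BigStep (.fst (.pair v w)) v
  | snd {σ τ : Ty} (v : Val [] σ) (w : Val [] τ) : BigStep (.snd (.pair v w)) w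
  | caseInl {σ τ ρ : Ty} {v : Val [] σ} {t : Comp [σ] ρ} {u : Comp [τ] ρ} {w : Val [] ρ} :
      BigStep (t.inst v) w → BigStep (.caseSum (.inl v) t u) w
  | caseInr {σ τ ρ : Ty} {v : Val [] τ} {t : Comp [σ] ρ} {u : Comp [τ] ρ} {w : Val [] ρ} :
      BigStep (u.inst v) w → BigStep (.caseSum (.inr v) t u) w
  | appRec {σ τ : Ty} {t : Comp [σ, .arrow σ τ] τ} {v : Val [] σ} {w : Val [] τ} :
      BigStep (t.inst2 v (.recFun t)) w → BigStep (.app (.recFun t) v) w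
  | appLam {σ τ : Ty} {t : Comp [σ] τ} {v : Val [] σ} {w : Val [] τ} :
      BigStep (t.inst v) w → BigStep (.app (.lam t) v) w
  | letIn {σ τ : Ty} {t : Comp [] σ} {u : Comp [σ] τ} {v : Val [] σ} {w : Val [] τ} :
      BigStep t v → BigStep (u.inst v) w → BigStep (.letIn t u) w
  | caseZero {τ : Ty} {t : Comp [] τ} {u : Comp [.nat] τ} {w : Val [] τ} :
      BigStep t w → BigStep (.caseNat .zero t u) w
  | caseSucc {τ : Ty} {v : Val [] .nat} {t : Comp [] τ} {u : Comp [.nat] τ} {w : Val [] τ} :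
      BigStep (u.inst v) w → BigStep (.caseNat (.succ v) t u) w

/-! ### Denotational semantics -/

open VSet

/-- The initial presheaf. -/
def emptyObj : VSet := (Functor.const _).obj Empty

/-- The coproduct `∑₀^∞ 1`, which is computed pointwise. -/
def natObj : VSet := (Functor.const _).obj ℕ

def emptyElim (X : VSet) : emptyObj ⟶ X :=
  homMk (fun x : Empty => x.elim) (fun _ x => Empty.elim x)

def natZero : 𝟙_ VSet ⟶ natObj := homMk (fun _ => (0 : ℕ)) (fun _ _ => rfl)

def natSucc : natObj ⟶ natObj := homMk (fun n : ℕ => (n + 1 : ℕ)) (fun _ _ => rfl)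

/-- The inverse `N ⟶ 1 + N` of the isomorphism with components `natZero` and `natSucc`. -/
def natCases : natObj ⟶ FunctorToTypes.coprod (𝟙_ VSet) natObj :=
  homMk (Y := FunctorToTypes.coprod (𝟙_ VSet) natObj)
    (fun n : ℕ => (Nat.casesOn n (Sum.inl PUnit.unit) Sum.inr : PUnit ⊕ ℕ)) (by
      rintro e (_ | n) <;> rfl)

/-- Case distinction on a binary coproduct, with parameters. -/
def caseMap {Γ A B X : VSet} (v : Γ ⟶ FunctorToTypes.coprod A B) (t : A ⊗ Γ ⟶ X)
    (u : B ⊗ Γ ⟶ X) : Γ ⟶ X :=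
  lift (𝟙 Γ) v ≫ MonoidalClosed.uncurry (FunctorToTypes.coprod.desc
    (MonoidalClosed.curry (lift (snd Γ A) (fst Γ A) ≫ t))
    (MonoidalClosed.curry (lift (snd Γ B) (fst Γ B) ≫ u)))

def Ty.den : Ty → VSet
  | .empty => emptyObj
  | .unit => 𝟙_ VSet
  | .nat => natObj
  | .sum σ τ => FunctorToTypes.coprod σ.den τ.den
  | .prod σ τ => σ.den ⊗ τ.den
  | .arrow σ τ => lifting.arr σ.den τ.den

def Ctx.den : Ctx → VSet
  | [] => 𝟙_ VSet
  | τ :: Γ => τ.den ⊗ Ctx.den Γ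

def Var.den : {Γ : Ctx} → {τ : Ty} → Var Γ τ → (Ctx.den Γ ⟶ τ.den)
  | _, _, .here => CartesianMonoidalCategory.fst _ _
  | _, _, .there x => CartesianMonoidalCategory.snd _ _ ≫ x.den

/-- Completeness of the objects in which recursive definitions are interpreted. -/
abbrev TypesComplete : Prop := ∀ τ : Ty, lifting.IsComplete (lifting.L.obj τ.den)

mutual

def Val.den (h : TypesComplete) : {Γ : Ctx} → {τ : Ty} → Val Γ τ → (Ctx.den Γ ⟶ τ.den)
  | _, _, .var x => x.den
  | Γ, _, .star => toUnit (Ctx.den Γ)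
  | _, _, .inl v => v.den h ≫ FunctorToTypes.coprod.inl
  | _, _, .inr v => v.den h ≫ FunctorToTypes.coprod.inr
  | _, _, .pair v w => lift (v.den h) (w.den h)
  | Γ, _, .zero => toUnit (Ctx.den Γ) ≫ natZero
  | _, _, .succ v => v.den h ≫ natSucc
  | _, _, .lam t => MonoidalClosed.curry (t.den h)
  | _, _, .recFun (σ := σ) (τ := τ) t => lifting.recMap (h (.arrow σ τ)) (t.den h)

def Comp.den (h : TypesComplete) :
    {Γ : Ctx} → {τ : Ty} → Comp Γ τ → (Ctx.den Γ ⟶ lifting.L.obj τ.den)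
  | _, τ, .caseEmpty v => v.den h ≫ emptyElim (lifting.L.obj τ.den)
  | _, τ, .ret v => v.den h ≫ lifting.L.η.app τ.den
  | _, _, .caseSum v t u => caseMap (v.den h) (t.den h) (u.den h)
  | _, _, .fst (σ := σ) (τ := τ) v =>
      v.den h ≫ CartesianMonoidalCategory.fst σ.den τ.den ≫ lifting.L.η.app σ.den
  | _, _, .snd (σ := σ) (τ := τ) v =>
      v.den h ≫ CartesianMonoidalCategory.snd σ.den τ.den ≫ lifting.L.η.app τ.den
  | _, _, .app (σ := σ) (τ := τ) v w =>
      lift (w.den h) (v.den h) ≫ (ihom.ev σ.den).app (lifting.L.obj τ.den)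
  | Γ, _, .caseNat v t u =>
      caseMap (v.den h ≫ natCases)
        (CartesianMonoidalCategory.snd (𝟙_ VSet) (Ctx.den Γ) ≫ t.den h) (u.den h)
  | _, _, .letIn t u => lifting.bind (t.den h) (u.den h)

end

end PCFv

end

/-!
Everything is computed on elements. A presheaf `X` on the one-object category is a set `X.el` of
chains with a right action of the monoid `VEnd`, and its global points are the elements fixed by the
action.

**The model.** A map `φ : A ⟶ Δ` is determined by the elements that it sends to `⊤`, and these form
an arbitrary *open* set: for each `a`, the set of all `c` with `a · c` in it is empty or equal to
`{c | n ≤ c 0}` for some natural number `n` (`isSemidecidable_iff`). Likewise, a map `A ⟶ L X`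
amounts to a partial map from `A` to `X` with open domain, namely its part in the summand `0`
(`exists_lift_of_graph`, `lift_hom_ext`). The statements on generic semidecidable subobjects and on
the lifting monad follow by inspection of elements.

**Completeness.** The object `ω̄` is the representable presheaf (`barIso`), and `ω` is its subobject
of maps that are bounded by a natural number (`finIso`): the elements of `Lⁿ 1` are the maps bounded
by `n`, because `L V ≅ V` via the map that prolongs a chain by `⊥` at its start and adds `1` to its
other entries. Complete objects contain the objects with trivial action, such as `0`, `1` and
`∑₀^∞ 1`, and they are closed under products, sums and exponentials. They are also closed under `L`
(`Complete.lift`): the extension `F` of `f : A × ω ⟶ L X` is defined at `(a, e)` as soon as `f` is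
defined at some truncation of `(a, e)` at a number `M`. In that case the values of `f` along
`(d, j) ↦ (a · d, min (e d) (M + j))` form a map `V × ω ⟶ X`, and `F (a, e)` is the value at
`(1, ∞)` of its extension.

**Soundness.** A recursive function is the value at `∞` of a map `C` on `Γ × ω̄` that is
characterized by its recursion equation (`exists_isRecChain`, `IsApChain.unique`). This characterization
yields the fixed point equation (`fn_recMap`) and the naturality in the context (`comp_recMap`).
Together with the substitution lemma (`Comp.den_subst`) they give soundness by induction on
evaluations.

**Adequacy.** The logical relation `Rel` compares elements of the interpretation of a type with closed
values, and tests functions at global points only. It is admissible (`isAdmissible_rel`): if the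
entries of a chain at all natural numbers are related to a value, then so is its entry at `∞`. This
uses that evaluation is deterministic, and that a chain in `L X` which is defined at `∞` is defined from
some natural number on. So recursive functions are related to their interpretations, because all
finite approximations are (`rel_recFun`). At ground types the relation is equality of values
(`eq_of_rel`).
-/

noncomputable section

/-! ### Presheaves in terms of elements -/

namespace VEnd

/-- Bounds on the values at the natural numbers extend to `∞`, by continuity. -/
theorem top_le {e : VEnd} {b : ℕ∞} (h : ∀ n : ℕ, e n ≤ b) : e ⊤ ≤ b := by
  induction b with
  | top => exact le_top
  | coe b =>
    by_contra hcon
    have h1 : ((b + 1 : ℕ) : ℕ∞) ≤ e ⊤ := by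
      push_cast
      exact Order.add_one_le_of_lt (not_le.mp hcon)
    obtain ⟨k, hk⟩ := exists_le_of_le_top e _ h1
    have h2 := hk.trans (h k)
    norm_cast at h2
    omega

theorem eq_iff_forall {d e : VEnd} : d = e ↔ ∀ i, d i = e i :=
  ⟨fun h _ => h ▸ rfl, fun h => by ext i; exact h i⟩

@[simp] theorem mul_const (e : VEnd) (i : ℕ∞) : e * const i = const (e i) := rfl

/-- The pointwise minimum. -/
def inf (d e : VEnd) : VEnd :=
  ofMonotone (fun i => min (d i) (e i)) (fun _ _ h => min_le_min (d.monotone h) (e.monotone h))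
    (fun b h => by
      by_contra hcon
      rw [min_le_iff, not_or, not_le, not_le] at hcon
      have hd : ∃ n : ℕ, b < d n := by
        by_contra hd
        push Not at hd
        exact absurd (top_le hd) (not_le.mpr hcon.1)
      have he : ∃ n : ℕ, b < e n := by
        by_contra he
        push Not at he
        exact absurd (top_le he) (not_le.mpr hcon.2)
      obtain ⟨m, hm⟩ := hd
      obtain ⟨n, hn⟩ := he
      refine absurd (h (max m n)) (not_le.mpr (lt_min ?_ ?_))
      · exact hm.trans_le (d.monotone (Nat.cast_le.mpr (le_max_left m n)))
      · exact hn.trans_le (e.monotone (Nat.cast_le.mpr (le_max_right m n))))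

@[simp] theorem inf_apply (d e : VEnd) (i : ℕ∞) : inf d e i = min (d i) (e i) := rfl

end VEnd

namespace VSet

@[simp] theorem fn_comp {X Y Z : VSet} (f : X ⟶ Y) (g : Y ⟶ Z) (x : X.el) :
    fn (f ≫ g) x = fn g (fn f x) := rfl

/-- The element of a product with given components. -/
def pair {X Y : VSet} (x : X.el) (y : Y.el) : (X ⊗ Y).el := ((x, y) : X.el × Y.el)

theorem exists_eq_pair {X Y : VSet} (p : (X ⊗ Y).el) : ∃ x y, p = pair x y := ⟨_, _, rfl⟩

theorem pair_inj {X Y : VSet} {x x' : X.el} {y y' : Y.el} :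
    pair x y = pair x' y' ↔ x = x' ∧ y = y' := Prod.mk_inj

@[simp] theorem fn_fst {X Y : VSet} (x : X.el) (y : Y.el) : fn (fst X Y) (pair x y) = x := rfl

@[simp] theorem fn_snd {X Y : VSet} (x : X.el) (y : Y.el) : fn (snd X Y) (pair x y) = y := rfl

@[simp] theorem fn_whiskerLeft (X : VSet) {Y Z : VSet} (f : Y ⟶ Z) (x : X.el) (y : Y.el) :
    fn (X ◁ f) (pair x y) = pair x (fn f y) := rfl

@[simp] theorem act_pair {X Y : VSet} (e : VEnd) (x : X.el) (y : Y.el) :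
    (X ⊗ Y).act e (pair x y) = pair (X.act e x) (Y.act e y) := rfl

/-- Morphisms out of a product agree if they agree on pairs. -/
theorem tensor_hom_ext {X Y Z : VSet} {f g : X ⊗ Y ⟶ Z}
    (h : ∀ x y, fn f (pair x y) = fn g (pair x y)) : f = g :=
  hom_ext fun p => h p.1 p.2

/-- The element of the terminal presheaf. -/
def pt : (𝟙_ VSet).el := PUnit.unit

/-- The presheaf represented by the object of the one-object category. -/
def VBar : VSet := ofAct VEnd (fun e d => d * e) (fun _ => rfl) (fun _ _ _ => rfl)

/-- An element of the monoid, as an element of the representable presheaf. -/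
def bar (e : VEnd) : VBar.el := e

/-- The underlying element of the monoid. -/
def unbar (e : VBar.el) : VEnd := e

@[simp] theorem unbar_bar (e : VEnd) : unbar (bar e) = e := rfl

@[simp] theorem act_bar (c e : VEnd) : VBar.act c (bar e) = bar (e * c) := rfl

/-- The presheaf of bounded elements of the representable presheaf. -/
def VFin : VSet := ofAct {e : VEnd // e ⊤ ≠ ⊤}
  (fun c e => ⟨e.1 * c, ((e.1.monotone (le_top (a := c ⊤))).trans_lt (lt_top_iff_ne_top.mpr e.2)).ne⟩)
    (fun _ => rfl) (fun _ _ _ => rfl)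

/-- A bounded element of the monoid, as an element of `VFin`. -/
def fin (e : VEnd) (h : e ⊤ ≠ ⊤) : VFin.el := (⟨e, h⟩ : {e : VEnd // e ⊤ ≠ ⊤})

theorem exists_eq_fin (x : VFin.el) : ∃ e h, x = fin e h := ⟨x.1, x.2, rfl⟩

theorem fin_congr {d e : VEnd} (h : d = e) (hd : d ⊤ ≠ ⊤) : fin d hd = fin e (h ▸ hd) := by
  subst h; rfl

theorem mul_top_ne {e : VEnd} (h : e ⊤ ≠ ⊤) (c : VEnd) : (e * c) ⊤ ≠ ⊤ :=
  ((e.monotone (le_top (a := c ⊤))).trans_lt (lt_top_iff_ne_top.mpr h)).ne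

@[simp] theorem act_fin (c : VEnd) {e : VEnd} (h : e ⊤ ≠ ⊤) :
    VFin.act c (fin e h) = fin (e * c) (mul_top_ne h c) := rfl

/-- The inclusion of the bounded elements. -/
def finIncl : VFin ⟶ VBar :=
  homMk (X := VFin) (Y := VBar) (fun e : {e : VEnd // e ⊤ ≠ ⊤} => bar e.1) fun _ _ => rfl

/-- The map out of the representable presheaf that corresponds to an element. -/
def yo {X : VSet} (x : X.el) : VBar ⟶ X :=
  homMk (X := VBar) (fun e => X.act (unbar e) x) fun d e => X.act_mul e d x

@[simp] theorem fn_yo {X : VSet} (x : X.el) (e : VEnd) : fn (yo x) (bar e) = X.act e x := rfl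

theorem yo_comp {X Y : VSet} (x : X.el) (f : X ⟶ Y) : yo x ≫ f = yo (fn f x) :=
  hom_ext fun e => fn_act f e x

/-- Pullback squares of presheaves are recognized on elements. -/
theorem isPullback_iff {P A B C : VSet} {m : P ⟶ A} {f : P ⟶ C} {g : A ⟶ B} {h : C ⟶ B} :
    IsPullback m f g h ↔ (∀ p, fn g (fn m p) = fn h (fn f p)) ∧
      ∀ a c, fn g a = fn h c → ∃! p, fn m p = a ∧ fn f p = c := by
  constructor
  · intro hp
    refine ⟨fun p => congrArg (fun k => fn k p) hp.w, fun a c hac => ?_⟩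
    have hw : yo a ≫ g = yo c ≫ h := by rw [yo_comp, yo_comp, hac]
    refine ⟨fn (hp.lift _ _ hw) (bar 1), ⟨?_, ?_⟩, ?_⟩
    · rw [← fn_comp, hp.lift_fst, fn_yo, act_one]
    · rw [← fn_comp, hp.lift_snd, fn_yo, act_one]
    · rintro q ⟨rfl, rfl⟩
      have : yo q = hp.lift _ _ hw := hp.hom_ext (by simp [yo_comp]) (by simp [yo_comp])
      rw [← this, fn_yo, act_one]
  · rintro ⟨hw, hu⟩
    have hw' : m ≫ g = f ≫ h := hom_ext hw
    choose q hq hq' using hu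
    have hs : ∀ (s : PullbackCone g h) (x : s.pt.el), fn g (fn s.fst x) = fn h (fn s.snd x) :=
      fun s x => congrArg (fun k => fn k x) s.condition
    refine ⟨⟨hw'⟩, ⟨PullbackCone.IsLimit.mk hw' (fun s => homMk (fun x => q (fn s.fst x) (fn s.snd x)
        (hs s x)) ?_) (fun s => hom_ext fun x => (hq _ _ _).1)
        (fun s => hom_ext fun x => (hq _ _ _).2) ?_⟩⟩
    · intro e x
      refine (hq' _ _ _ _ ⟨?_, ?_⟩).symm
      · rw [fn_act, (hq _ _ _).1, fn_act]
      · rw [fn_act, (hq _ _ _).2, fn_act]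
    · intro s k hk1 hk2
      exact hom_ext fun x => hq' _ _ _ _ ⟨congrArg (fun k => fn k x) hk1, congrArg (fun k => fn k x) hk2⟩

/-- A bijective morphism is an isomorphism. -/
theorem isIso_of_bijective {X Y : VSet} (f : X ⟶ Y) (h : Function.Bijective (fn f)) : IsIso f := by
  have h1 : ∀ y, ∃ x, fn f x = y := h.2
  choose g hg using h1
  refine ⟨homMk g fun e y => h.1 ?_, hom_ext fun x => h.1 ?_, hom_ext fun y => ?_⟩
  · rw [hg, fn_act, hg]
  · exact hg _
  · exact hg _

/-! ### Exponentials -/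

/-- Application of an element of `A ⇒ Y`. -/
def ev {A Y : VSet} (a : A.el) (k : ((ihom A).obj Y).el) : Y.el :=
  fn ((ihom.ev A).app Y) (pair a k)

theorem ev_curry {A B Y : VSet} (f : A ⊗ B ⟶ Y) (a : A.el) (b : B.el) :
    ev a (fn (MonoidalClosed.curry f) b) = fn f (pair a b) :=
  congrArg (fun k => fn k (pair a b)) (MonoidalClosed.whiskerLeft_curry_ihom_ev_app A Y f)

theorem ev_uncurry {A B Y : VSet} (f : B ⟶ (ihom A).obj Y) (a : A.el) (b : B.el) :
    fn (MonoidalClosed.uncurry f) (pair a b) = ev a (fn f b) := by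
  rw [MonoidalClosed.uncurry_eq]; rfl

theorem ev_act {A Y : VSet} (e : VEnd) (a : A.el) (k : ((ihom A).obj Y).el) :
    Y.act e (ev a k) = ev (A.act e a) (((ihom A).obj Y).act e k) :=
  (fn_act ((ihom.ev A).app Y) e (pair a k)).symm

/-! ### Elements of `L X` -/

/-- The object `L X`. -/
abbrev Lift (X : VSet) : VSet := lifting.L.obj X

/-- The unit of the lifting monad. -/
def eta (X : VSet) : X ⟶ Lift X := lifting.L.η.app X

/-- The multiplication of the lifting monad. -/
def mu (X : VSet) : Lift (Lift X) ⟶ Lift X := lifting.L.μ.app X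

/-- The strength of the lifting monad. -/
def str (A X : VSet) : A ⊗ Lift X ⟶ Lift (A ⊗ X) := lifting.str A X

/-- The chain `s` preceded by `n` copies of `⊥`. -/
def cons {X : VSet} (n : ℕ) (s : X.el) : (Lift X).el := (some (n, s) : Option (ℕ × X.el))

/-- The chain `⊥`. -/
def bot (X : VSet) : (Lift X).el := (none : Option (ℕ × X.el))

theorem liftObj_cases {X : VSet} (l : (Lift X).el) : l = bot X ∨ ∃ n s, l = cons n s := by
  rcases l with _ | ⟨n, s⟩
  · exact Or.inl rfl
  · exact Or.inr ⟨n, s, rfl⟩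

theorem cons_inj {X : VSet} {n m : ℕ} {s t : X.el} : cons n s = cons m t ↔ n = m ∧ s = t := by
  unfold cons
  constructor
  · intro h
    have := Option.some.inj h
    exact ⟨congrArg Prod.fst this, congrArg Prod.snd this⟩
  · rintro ⟨rfl, rfl⟩; rfl

theorem cons_ne_bot {X : VSet} {n : ℕ} {s : X.el} : cons n s ≠ bot X := Option.some_ne_none _

theorem act_bot {X : VSet} (e : VEnd) : (Lift X).act e (bot X) = bot X := rfl

theorem act_cons {X : VSet} {e : VEnd} {n k : ℕ} (hk : e.Hits n k) (s : X.el) :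
    (Lift X).act e (cons n s) = cons k (X.act (e.shift n k) s) := liftAct_hits X hk s

theorem act_cons_not {X : VSet} {e : VEnd} {n : ℕ} (h : ¬ ∃ k, e.Hits n k) (s : X.el) :
    (Lift X).act e (cons n s) = bot X := liftAct_not X h s

theorem act_cons_zero {X : VSet} (e : VEnd) (s : X.el) :
    (Lift X).act e (cons 0 s) = cons 0 (X.act e s) := by
  rw [act_cons e.hits_zero, VEnd.shift_zero]

theorem hits_zero_iff {e : VEnd} {n : ℕ} : e.Hits n 0 ↔ (n : ℕ∞) ≤ e 0 :=
  ⟨fun h => h.1, fun h => ⟨h, fun _ hj => absurd hj (by simp)⟩⟩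

/-- Dropping the first `n` entries of a chain removes the `n` copies of `⊥` at its start. -/
theorem act_add_cons {X : VSet} (n : ℕ) (s : X.el) :
    (Lift X).act (VEnd.add n) (cons n s) = cons 0 s := by
  have h : (VEnd.add n).Hits n 0 := hits_zero_iff.mpr (by simp)
  rw [act_cons h]
  have : (VEnd.add n).shift n 0 = 1 := by
    rw [VEnd.shift]
    simp only [VEnd.add_zero_eq, mul_one, VEnd.sub_mul_add]
  rw [this, act_one]

/-- The elements of `L X` that start with an element of `X`. -/
def IsDef {X : VSet} (l : (Lift X).el) : Prop := ∃ s, l = cons 0 s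

theorem isDef_cons {X : VSet} {n : ℕ} {s : X.el} : IsDef (cons n s) ↔ n = 0 := by
  constructor
  · rintro ⟨t, ht⟩; exact (cons_inj.mp ht).1
  · rintro rfl; exact ⟨s, rfl⟩

theorem not_isDef_bot {X : VSet} : ¬ IsDef (bot X) := fun ⟨_, h⟩ => cons_ne_bot h.symm

theorem isDef_act_cons {X : VSet} {n : ℕ} {s : X.el} {c : VEnd} :
    IsDef ((Lift X).act c (cons n s)) ↔ (n : ℕ∞) ≤ c 0 := by
  by_cases h : ∃ k, c.Hits n k
  · obtain ⟨k, hk⟩ := h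
    rw [act_cons hk, isDef_cons]
    constructor
    · rintro rfl; exact hits_zero_iff.mp hk
    · intro h; exact hk.unique (hits_zero_iff.mpr h)
  · rw [act_cons_not h]
    exact ⟨fun h => absurd h not_isDef_bot, fun h' => absurd ⟨0, hits_zero_iff.mpr h'⟩ h⟩

/-- The chain `l · c` starts in `X` if and only if `l` has left `⊥` at the index `c 0`. -/
theorem isDef_act_iff {X : VSet} {l : (Lift X).el} {c : VEnd} :
    IsDef ((Lift X).act c l) ↔ ∃ n s, l = cons n s ∧ (n : ℕ∞) ≤ c 0 := by
  rcases liftObj_cases l with rfl | ⟨n, s, rfl⟩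
  · rw [act_bot]
    exact ⟨fun h => absurd h not_isDef_bot, fun ⟨n, s, h, _⟩ => absurd h.symm cons_ne_bot⟩
  · rw [isDef_act_cons]
    refine ⟨fun h => ⟨n, s, rfl, h⟩, ?_⟩
    rintro ⟨m, t, h, h'⟩
    rwa [(cons_inj.mp h).1]

theorem IsDef.act {X : VSet} {l : (Lift X).el} (h : IsDef l) (c : VEnd) :
    IsDef ((Lift X).act c l) := by
  obtain ⟨s, rfl⟩ := h
  exact ⟨_, act_cons_zero c s⟩

/-- Whether `l` starts with an element of `X` can be tested at the first entry of the chain. -/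
theorem isDef_act_const_zero {X : VSet} {l : (Lift X).el} :
    IsDef ((Lift X).act (VEnd.const 0) l) ↔ IsDef l := by
  refine ⟨fun h => ?_, fun h => h.act _⟩
  obtain ⟨n, s, rfl, hn⟩ := isDef_act_iff.mp h
  exact isDef_cons.mpr (by simpa using hn)

/-- A map into `L X` is determined by its values in the summand `0`. -/
theorem lift_hom_ext {B X : VSet} {g g' : B ⟶ Lift X}
    (h : ∀ b s, fn g b = cons 0 s → fn g' b = cons 0 s)
    (h' : ∀ b, IsDef (fn g' b) → IsDef (fn g b)) : g = g' := by
  refine hom_ext fun b => ?_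
  rcases liftObj_cases (fn g b) with hb | ⟨n, s, hb⟩
  · rcases liftObj_cases (fn g' b) with hb' | ⟨n, s, hb'⟩
    · rw [hb, hb']
    · have h1 := h' (B.act (VEnd.add n) b) (by rw [fn_act, hb', act_add_cons]; exact ⟨s, rfl⟩)
      rw [fn_act, hb] at h1
      exact absurd h1 not_isDef_bot
  · have h1 := h (B.act (VEnd.add n) b) s (by rw [fn_act, hb, act_add_cons])
    have h2 : IsDef ((Lift X).act (VEnd.add n) (fn g' b)) := by rw [← fn_act, h1]; exact ⟨s, rfl⟩
    obtain ⟨m, t, ht, hm⟩ := isDef_act_iff.mp h2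
    have h3 := h' (B.act (VEnd.add m) b) (by rw [fn_act, ht, act_add_cons]; exact ⟨t, rfl⟩)
    rw [fn_act, hb, isDef_act_cons] at h3
    simp only [VEnd.add_apply, add_zero, Nat.cast_le] at h3 hm
    obtain rfl : n = m := le_antisymm h3 hm
    rw [fn_act, ht, act_add_cons] at h1
    rw [hb, ht, (cons_inj.mp h1).2]

@[simp] theorem fn_eta {X : VSet} (s : X.el) : fn (eta X) s = cons 0 s := rfl

@[simp] theorem fn_mu_cons {X : VSet} (n m : ℕ) (s : X.el) :
    fn (mu X) (cons n (cons m s : (Lift X).el)) = cons (n + m) s := rfl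

theorem fn_mu_cons_zero {X : VSet} (l : (Lift X).el) :
    fn (mu X) (cons 0 l) = l := by
  rcases liftObj_cases l with rfl | ⟨n, s, rfl⟩
  · rfl
  · rw [fn_mu_cons, zero_add]

end VSet

/-! ### Semidecidable subobjects and partial maps -/

namespace VSet

/-- A set of elements `b` such that the set of all `c` with `b · c` in it is empty or of the form
`{c | n ≤ c 0}` for some natural number `n`. These are the semidecidable subobjects. -/
def IsOpenSet {B : VSet} (U : B.el → Prop) : Prop :=
  ∀ b, (∀ c, ¬ U (B.act c b)) ∨ ∃ n : ℕ, ∀ c : VEnd, U (B.act c b) ↔ (n : ℕ∞) ≤ c 0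

/-- An element of `Δ`. -/
def delta (d : VEnd) (h : VEnd.r1 * d = d) : Delta.el := (⟨d, h⟩ : {d : VEnd // VEnd.r1 * d = d})

theorem exists_eq_delta (x : Delta.el) : ∃ d h, x = delta d h := ⟨x.1, x.2, rfl⟩

theorem delta_inj {d d' : VEnd} {h h'} : delta d h = delta d' h' ↔ d = d' := Subtype.mk_eq_mk

theorem r1_mul_const_one : VEnd.r1 * VEnd.const 1 = VEnd.const 1 := by
  ext i; simp

theorem fn_truth (x : (𝟙_ VSet).el) : fn truth x = delta (VEnd.const 1) r1_mul_const_one := rfl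

theorem le_one_of_r1_mul {d : VEnd} (h : VEnd.r1 * d = d) (i : ℕ∞) : d i ≤ 1 := by
  rw [← h]; exact min_le_right _ _

theorem act_delta {d : VEnd} (h : VEnd.r1 * d = d) (c : VEnd) :
    Delta.act c (delta d h) = delta (d * c) (by rw [← mul_assoc, h]) := rfl

theorem act_delta_eq_truth {d : VEnd} (h : VEnd.r1 * d = d) (c : VEnd) (x : (𝟙_ VSet).el) :
    Delta.act c (delta d h) = fn truth x ↔ 1 ≤ d (c 0) := by
  rw [fn_truth, act_delta, delta_inj, VEnd.eq_iff_forall]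
  constructor
  · intro h'; exact (h' 0).ge
  · intro h' i
    exact le_antisymm (le_one_of_r1_mul h _) (h'.trans (d.monotone (c.monotone (zero_le))))

/-- An element of `Δ` is determined by the maps that restrict it to `⊤`; constant maps suffice. -/
theorem delta_ext {x y : Delta.el}
    (hxy : ∀ c, Delta.act c x = fn truth pt ↔ Delta.act c y = fn truth pt) : x = y := by
  obtain ⟨d, h, rfl⟩ := exists_eq_delta x
  obtain ⟨d', h', rfl⟩ := exists_eq_delta y
  rw [delta_inj, VEnd.eq_iff_forall]
  intro i
  have hi := hxy (VEnd.const i)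
  rw [act_delta_eq_truth, act_delta_eq_truth, VEnd.const_apply] at hi
  have h1 := le_one_of_r1_mul h i
  have h2 := le_one_of_r1_mul h' i
  by_cases hd : 1 ≤ d i
  · exact (le_antisymm h1 hd).trans (le_antisymm h2 (hi.mp hd)).symm
  · have hd' := mt hi.mpr hd
    rw [not_le, Order.lt_one_iff] at hd hd'
    rw [hd, hd']

theorem one_le_one_add_sub (n : ℕ) (x : ℕ∞) : 1 ≤ 1 + x - n ↔ (n : ℕ∞) ≤ x := by
  induction x with
  | top => simp
  | coe x => norm_cast; omega

/-- Open sets are classified by maps to `Δ`. -/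
theorem IsOpenSet.exists_classifier {B : VSet} {U : B.el → Prop} (hU : IsOpenSet U) :
    ∃ φ : B ⟶ Delta, ∀ b, fn φ b = fn truth pt ↔ U b := by
  have key : ∀ b, ∃ x : Delta.el, ∀ c, Delta.act c x = fn truth pt ↔ U (B.act c b) := by
    intro b
    rcases hU b with h | ⟨n, h⟩
    · refine ⟨delta (VEnd.const 0) (by ext i; simp), fun c => ?_⟩
      rw [act_delta_eq_truth]
      exact ⟨fun h => by simp at h, fun h' => absurd h' (h c)⟩
    · refine ⟨delta (VEnd.r1 * (VEnd.sub n * VEnd.add 1)) ?_, fun c => ?_⟩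
      · ext i; simp [VEnd.mul_apply]
      · rw [act_delta_eq_truth, h]
        simp only [VEnd.mul_apply, VEnd.r1_apply, VEnd.sub_apply, VEnd.add_apply, le_min_iff, le_refl,
          and_true, Nat.cast_one, one_le_one_add_sub]
  choose φ hφ using key
  refine ⟨homMk φ fun e b => delta_ext fun c => ?_, fun b => ?_⟩
  · rw [hφ, ← act_mul, ← act_mul, hφ]
  · have := hφ b 1
    rwa [act_one, act_one] at this

theorem isPullback_truth_iff {A' A : VSet} {m : A' ⟶ A} {φ : A ⟶ Delta} :
    IsPullback m (toUnit A') φ truth ↔ Function.Injective (fn m) ∧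
      ∀ a, fn φ a = fn truth pt ↔ ∃ p, fn m p = a := by
  rw [isPullback_iff]
  constructor
  · rintro ⟨h1, h2⟩
    refine ⟨fun p q hpq => ?_, fun a => ⟨fun ha => ?_, ?_⟩⟩
    · exact (h2 (fn m q) pt (h1 q)).unique ⟨hpq, rfl⟩ ⟨rfl, rfl⟩
    · obtain ⟨p, hp, _⟩ := h2 a pt ha
      exact ⟨p, hp.1⟩
    · rintro ⟨p, rfl⟩; exact h1 p
  · rintro ⟨h1, h2⟩
    refine ⟨fun p => (h2 _).mpr ⟨p, rfl⟩, fun a c hac => ?_⟩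
    obtain ⟨p, rfl⟩ := (h2 a).mp hac
    exact ⟨p, ⟨rfl, rfl⟩, fun q hq => h1 hq.1⟩

/-- The semidecidable subobjects are the inclusions of open sets. -/
theorem isSemidecidable_iff {A' A : VSet} {m : A' ⟶ A} :
    IsSemidecidable truth m ↔ Function.Injective (fn m) ∧ IsOpenSet fun a => ∃ p, fn m p = a := by
  constructor
  · rintro ⟨φ, hφ⟩
    rw [isPullback_truth_iff] at hφ
    refine ⟨hφ.1, fun a => ?_⟩
    obtain ⟨d, hd, hda⟩ := exists_eq_delta (fn φ a)
    have key : ∀ c : VEnd, (∃ p, fn m p = A.act c a) ↔ 1 ≤ d (c 0) := by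
      intro c
      rw [← hφ.2, fn_act, hda, act_delta_eq_truth]
    by_cases h : ∃ i, ((1 : ℕ) : ℕ∞) ≤ d i
    · obtain ⟨i, hi⟩ := h
      obtain ⟨n, hn⟩ := VEnd.exists_hits hi
      refine Or.inr ⟨n, fun c => (key c).trans ⟨fun h => ?_, fun h => ?_⟩⟩
      · exact hn.le_of_le (by simpa using h)
      · simpa using hn.le h
    · refine Or.inl fun c hc => h ⟨c 0, ?_⟩
      simpa using (key c).mp hc
  · rintro ⟨h1, h2⟩
    obtain ⟨φ, hφ⟩ := h2.exists_classifier
    exact ⟨φ, isPullback_truth_iff.mpr ⟨h1, hφ⟩⟩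

theorem act_sub_mul_act_add {B : VSet} (b : B.el) {n : ℕ} {c : VEnd} (h : (n : ℕ∞) ≤ c 0) :
    B.act (VEnd.sub n * c) (B.act (VEnd.add n) b) = B.act c b := by
  rw [← act_mul, VEnd.add_mul_sub_mul n c fun i => h.trans (c.monotone (zero_le))]

/-- Two elements of a presheaf `L X` agree if they take the same values in `X` along all maps. -/
theorem lift_ext {X : VSet} {l l' : (Lift X).el}
    (h : ∀ c s, (Lift X).act c l = cons 0 s ↔ (Lift X).act c l' = cons 0 s) : l = l' := by
  have : yo l = yo l' := lift_hom_ext (fun b s => (h (unbar b) s).mp)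
    (fun b ⟨s, hs⟩ => ⟨s, (h (unbar b) s).mpr hs⟩)
  have h1 := congrArg (fun k => fn k (bar 1)) this
  simpa only [fn_yo, act_one] using h1

/-- A partial map with open domain, given by its graph, is classified by a map to `L X`. -/
theorem exists_lift_of_graph {B X : VSet} (G : B.el → X.el → Prop)
    (hfun : ∀ b s s', G b s → G b s' → s = s')
    (hact : ∀ b s c, G b s → G (B.act c b) (X.act c s)) (hopen : IsOpenSet fun b => ∃ s, G b s) :
    ∃ g : B ⟶ Lift X, ∀ b s, fn g b = cons 0 s ↔ G b s := by
  have key : ∀ b, ∃ l : (Lift X).el, ∀ c s, (Lift X).act c l = cons 0 s ↔ G (B.act c b) s := by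
    intro b
    rcases hopen b with h | ⟨n, h⟩
    · refine ⟨bot X, fun c s => ⟨fun h => absurd h.symm cons_ne_bot, fun h' => absurd ⟨s, h'⟩ (h c)⟩⟩
    · obtain ⟨t, ht⟩ := (h (VEnd.add n)).mpr (by simp)
      have hc : ∀ c : VEnd, (n : ℕ∞) ≤ c 0 → G (B.act c b) (X.act (VEnd.sub n * c) t) := by
        intro c hc
        rw [← act_sub_mul_act_add b hc]
        exact hact _ _ _ ht
      have hs : ∀ c : VEnd, c.shift n 0 = VEnd.sub n * c := by
        intro c
        simp only [VEnd.shift, VEnd.add_zero_eq, mul_one]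
      refine ⟨cons n t, fun c s => ⟨fun h' => ?_, fun h' => ?_⟩⟩
      · have hn : (n : ℕ∞) ≤ c 0 := isDef_act_cons.mp ⟨s, h'⟩
        rw [act_cons (hits_zero_iff.mpr hn), cons_inj, hs] at h'
        rw [← h'.2]
        exact hc c hn
      · have hn := (h c).mp ⟨s, h'⟩
        rw [act_cons (hits_zero_iff.mpr hn), hs, hfun _ _ _ h' (hc c hn)]
  choose g hg using key
  refine ⟨homMk g fun e b => lift_ext fun c s => ?_, fun b s => ?_⟩
  · rw [hg, ← act_mul, ← act_mul, hg]
  · have := hg b 1 s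
    rwa [act_one, act_one] at this

/-- A pullback of the unit `η` is a partial map that is classified by `g`: its graph is the
part of `g` in the summand `0`. -/
theorem isPullback_eta_iff {A' A B : VSet} {m : A' ⟶ A} {f : A' ⟶ B} {g : A ⟶ Lift B} :
    IsPullback m f g (eta B) ↔
      (∀ a s, fn g a = cons 0 s ↔ ∃ p, fn m p = a ∧ fn f p = s) ∧
        ∀ p q, fn m p = fn m q → fn f p = fn f q → p = q := by
  rw [isPullback_iff]
  constructor
  · rintro ⟨h1, h2⟩
    refine ⟨fun a s => ⟨fun h => (h2 a s h).exists, ?_⟩, fun p q hm hf => ?_⟩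
    · rintro ⟨p, rfl, rfl⟩; exact h1 p
    · exact (h2 _ _ (h1 q)).unique ⟨hm, hf⟩ ⟨rfl, rfl⟩
  · rintro ⟨h1, h2⟩
    refine ⟨fun p => (h1 _ _).mpr ⟨p, rfl, rfl⟩, fun a s h => ?_⟩
    obtain ⟨p, rfl, rfl⟩ := (h1 a s).mp h
    exact ⟨p, ⟨rfl, rfl⟩, fun q hq => h2 _ _ hq.1 hq.2⟩

theorem isEmpty_of_isInitial {Z : VSet} (hZ : IsInitial Z) : IsEmpty Z.el :=
  ⟨fun z => (fn (hZ.to PCFv.emptyObj) z : Empty).elim⟩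

theorem isGenericSemidecidable_truth : IsGenericSemidecidable truth where
  unique m hm := by
    obtain ⟨φ, hφ⟩ := hm
    refine ⟨φ, hφ, fun ψ hψ => hom_ext fun a => delta_ext fun c => ?_⟩
    rw [← fn_act, ← fn_act, (isPullback_truth_iff.mp hφ).2, (isPullback_truth_iff.mp hψ).2]
  initial hZ m := by
    have := isEmpty_of_isInitial hZ.some
    exact isSemidecidable_iff.mpr ⟨fun p => isEmptyElim p, fun a => Or.inl fun c ⟨p, _⟩ => isEmptyElim p⟩
  comp {A'' A' A} m n hm hn := by
    rw [isSemidecidable_iff] at hm hn ⊢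
    refine ⟨hn.1.comp hm.1, fun a => ?_⟩
    rcases hn.2 a with h | ⟨k, hk⟩
    · exact Or.inl fun c ⟨p, hp⟩ => h c ⟨fn m p, hp⟩
    obtain ⟨a', ha'⟩ := (hk (VEnd.add k)).mpr (by simp)
    -- beyond the index `k`, where `a` enters `A'`, membership in `A''` can be tested on the chain
    -- `a'` of entries of `a` from `k` on
    have key : ∀ c : VEnd, (k : ℕ∞) ≤ c 0 →
        ((∃ p, fn (m ≫ n) p = A.act c a) ↔ ∃ p, fn m p = A'.act (VEnd.sub k * c) a') := by
      intro c hc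
      refine exists_congr fun p => ?_
      rw [← act_sub_mul_act_add a hc, ← ha', ← fn_act]
      exact hn.1.eq_iff
    have hkc : ∀ c : VEnd, (∃ p, fn (m ≫ n) p = A.act c a) → (k : ℕ∞) ≤ c 0 :=
      fun c ⟨p, hp⟩ => (hk c).mp ⟨fn m p, hp⟩
    rcases hm.2 a' with h | ⟨j, hj⟩
    · exact Or.inl fun c hc => h _ ((key c (hkc c hc)).mp hc)
    · refine Or.inr ⟨k + j, fun c => ⟨fun hc => ?_, fun hc => ?_⟩⟩
      · have h1 := (hj _).mp ((key c (hkc c hc)).mp hc)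
        simp only [VEnd.mul_apply, VEnd.sub_apply] at h1
        rw [Nat.cast_add, ← add_tsub_cancel_of_le (hkc c hc)]
        exact add_le_add_right h1 _
      · rw [Nat.cast_add] at hc
        refine (key c (le_self_add.trans hc)).mpr ((hj _).mpr ?_)
        simp only [VEnd.mul_apply, VEnd.sub_apply]
        exact (ENat.addLECancellable_natCast k).le_tsub_of_add_le_left hc

theorem isLiftingMonad_lifting : IsLiftingMonad truth lifting where
  unit B := by
    refine isSemidecidable_iff.mpr ⟨fun s t h => (cons_inj.mp h).2, fun l => ?_⟩
    have h : ∀ l' : (Lift B).el, (∃ p, fn (eta B) p = l') ↔ IsDef l' :=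
      fun l' => exists_congr fun p => eq_comm
    rcases liftObj_cases l with rfl | ⟨n, s, rfl⟩
    · exact Or.inl fun c hc => not_isDef_bot ((h _).mp hc)
    · exact Or.inr ⟨n, fun c => (h _).trans isDef_act_cons⟩
  classify {A' A B} m hm f := by
    rw [isSemidecidable_iff] at hm
    obtain ⟨g, hg⟩ := exists_lift_of_graph (fun a s => ∃ p, fn m p = a ∧ fn f p = s)
      (by rintro a s s' ⟨p, rfl, rfl⟩ ⟨q, hq, rfl⟩; rw [hm.1 hq])
      (by rintro a s c ⟨p, rfl, rfl⟩; exact ⟨A'.act c p, fn_act _ _ _, fn_act _ _ _⟩)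
      (by
        have h : ∀ a, (∃ s p, fn m p = a ∧ fn f p = s) ↔ ∃ p, fn m p = a :=
          fun a => ⟨fun ⟨s, p, h, _⟩ => ⟨p, h⟩, fun ⟨p, h⟩ => ⟨_, p, h, rfl⟩⟩
        simpa only [h] using hm.2)
    refine ⟨g, isPullback_eta_iff.mpr ⟨hg, fun p q h _ => hm.1 h⟩, fun g' hg' => ?_⟩
    have h := (isPullback_eta_iff.mp hg').1
    exact lift_hom_ext (fun a s hs => (hg a s).mpr ((h a s).mp hs))
      (fun a ⟨s, hs⟩ => ⟨s, (h a s).mpr ((hg a s).mp hs)⟩)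
  map {A B} f := by
    refine isPullback_eta_iff.mpr ⟨fun l s => ⟨fun h => ?_, ?_⟩, fun p q h _ => (cons_inj.mp h).2⟩
    · rcases liftObj_cases l with rfl | ⟨n, t, rfl⟩
      · exact absurd h.symm cons_ne_bot
      · obtain ⟨rfl, ht⟩ := cons_inj.mp h
        exact ⟨t, rfl, ht⟩
    · rintro ⟨p, rfl, rfl⟩; rfl
  mul B := by
    refine isPullback_eta_iff.mpr ⟨fun l s => ⟨fun h => ?_, ?_⟩, fun p q _ h => h⟩
    · rcases liftObj_cases l with rfl | ⟨n, l, rfl⟩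
      · exact absurd h.symm cons_ne_bot
      · rcases liftObj_cases l with rfl | ⟨m, t, rfl⟩
        · exact absurd h.symm cons_ne_bot
        · obtain ⟨hnm, rfl⟩ := cons_inj.mp h
          obtain ⟨rfl, rfl⟩ := Nat.add_eq_zero_iff.mp hnm
          exact ⟨t, rfl, rfl⟩
    · rintro ⟨p, rfl, rfl⟩; rfl
  str A B := by
    refine isPullback_eta_iff.mpr ⟨fun l s => ⟨fun h => ?_, ?_⟩, fun p q _ h => h⟩
    · obtain ⟨a, l, rfl⟩ := exists_eq_pair l
      rcases liftObj_cases l with rfl | ⟨n, t, rfl⟩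
      · exact absurd h.symm cons_ne_bot
      · obtain ⟨rfl, rfl⟩ := cons_inj.mp (show cons (X := A ⊗ B) n (pair (A.act (VEnd.add n) a) t) = cons 0 s from h)
        refine ⟨pair a t, rfl, ?_⟩
        rw [VEnd.add_zero_eq, act_one]; rfl
    · rintro ⟨p, rfl, rfl⟩
      obtain ⟨a, t, rfl⟩ := exists_eq_pair p
      change cons (X := A ⊗ B) 0 (pair (A.act (VEnd.add 0) a) t) = cons 0 (pair a t)
      rw [VEnd.add_zero_eq, act_one]
  bot hZ B := by
    have := isEmpty_of_isInitial hZ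
    exact isPullback_eta_iff.mpr ⟨fun a s => ⟨fun h => absurd h.symm cons_ne_bot,
      fun ⟨p, _⟩ => isEmptyElim p⟩, fun p => isEmptyElim p⟩

end VSet

/-! ### The vertical natural numbers as presheaves -/

namespace VEnd

/-- The map that is `0` below `k` and `i ↦ 1 + d (i - k)` from `k` on. -/
def delay (k : ℕ) (d : VEnd) : VEnd :=
  ofMonotone (fun i => if (k : ℕ∞) ≤ i then 1 + d (i - k) else 0)
    (fun i j h => by
      dsimp only
      split_ifs with hi hj
      · exact add_le_add_right (d.monotone (tsub_le_tsub_right h _)) _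
      · exact absurd (hi.trans h) hj
      · exact zero_le
      · exact zero_le)
    (fun b h => by
      have h1 : (1 + d ⊤ : ℕ∞) = (add 1 * d) ⊤ := by simp [mul_apply]
      rw [if_pos le_top, ENat.top_sub_natCast, h1]
      refine top_le fun n => ?_
      have h2 := h (k + n)
      rw [Nat.cast_add, if_pos le_self_add,
        (ENat.addLECancellable_natCast k).add_tsub_cancel_left] at h2
      simpa [mul_apply] using h2)

theorem delay_apply_of_le {k : ℕ} {i : ℕ∞} (d : VEnd) (h : (k : ℕ∞) ≤ i) :
    delay k d i = 1 + d (i - k) := if_pos h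

theorem delay_apply_of_lt {k : ℕ} {i : ℕ∞} (d : VEnd) (h : i < k) : delay k d i = 0 :=
  if_neg (not_le.mpr h)

theorem delay_add (k : ℕ) (d : VEnd) (i : ℕ∞) : delay k d (k + i) = 1 + d i := by
  rw [delay_apply_of_le d le_self_add, (ENat.addLECancellable_natCast k).add_tsub_cancel_left]

theorem delay_top (k : ℕ) (d : VEnd) : delay k d ⊤ = 1 + d ⊤ := by
  rw [delay_apply_of_le d le_top, ENat.top_sub_natCast]

theorem delay_mul_of_hits {k j : ℕ} {e : VEnd} (d : VEnd) (h : e.Hits k j) :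
    delay k d * e = delay j (d * e.shift k j) := by
  ext i
  rw [mul_apply]
  by_cases hi : (j : ℕ∞) ≤ i
  · rw [delay_apply_of_le _ (h.le hi), delay_apply_of_le _ hi, mul_apply, shift_apply,
      add_tsub_cancel_of_le hi]
  · rw [delay_apply_of_lt _ (not_le.mp hi),
      delay_apply_of_lt _ (not_le.mp fun h' => hi (h.le_of_le h'))]

theorem delay_mul_of_not {k : ℕ} {e : VEnd} (d : VEnd) (h : ¬ ∃ j, e.Hits k j) :
    delay k d * e = const 0 := by
  ext i
  exact delay_apply_of_lt _ (not_le.mp fun h' => h (exists_hits h'))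

/-- The map `delay k d` leaves `0` at the index `k`. -/
theorem delay_hits (k : ℕ) (d : VEnd) : (delay k d).Hits 1 k := by
  refine ⟨?_, fun j hj => ?_⟩
  · rw [delay_apply_of_le _ le_rfl]; exact_mod_cast le_self_add
  · rw [delay_apply_of_lt _ (by exact_mod_cast hj)]; simp

theorem delay_inj {k j : ℕ} {d d' : VEnd} : delay k d = delay j d' ↔ k = j ∧ d = d' := by
  refine ⟨fun h => ?_, by rintro ⟨rfl, rfl⟩; rfl⟩
  obtain rfl : k = j := (delay_hits k d).unique (h ▸ delay_hits j d')
  refine ⟨rfl, eq_iff_forall.mpr fun i => ?_⟩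
  have h1 := delay_add k d i
  rw [h, delay_add] at h1
  exact (ENat.addLECancellable_natCast 1).inj.mp h1.symm

theorem delay_ne_const {k : ℕ} {d : VEnd} : delay k d ≠ const 0 := by
  intro h
  have := (delay_hits k d).1
  rw [h] at this
  simp at this

/-- Together with the injectivity of `delay`, this says that the monoid `V` is isomorphic to
`{⊥} + ∑ n, V`. -/
theorem eq_const_or_delay (e : VEnd) : e = const 0 ∨ ∃ k d, e = delay k d := by
  by_cases h : ∃ i, ((1 : ℕ) : ℕ∞) ≤ e i
  · obtain ⟨i, hi⟩ := h
    obtain ⟨k, hk⟩ := exists_hits hi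
    refine Or.inr ⟨k, e.shift 1 k, eq_iff_forall.mpr fun i => ?_⟩
    by_cases hi : (k : ℕ∞) ≤ i
    · rw [delay_apply_of_le _ hi, shift_apply, add_tsub_cancel_of_le hi]
      exact (add_tsub_cancel_of_le (hk.le hi)).symm
    · rw [delay_apply_of_lt _ (not_le.mp hi)]
      have := not_le.mp fun h => hi (hk.le_of_le h)
      simpa using this
  · refine Or.inl (eq_iff_forall.mpr fun i => ?_)
    have := not_le.mp fun h' => h ⟨i, h'⟩
    simpa using this

theorem delay_zero_const (n : ℕ∞) : delay 0 (const n) = const (1 + n) := by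
  ext i
  rw [delay_apply_of_le _ (by simp)]; rfl

/-- The truncation `i ↦ min n (e i)`. -/
def trunc (n : ℕ) (e : VEnd) : VEnd := inf (const n) e

@[simp] theorem trunc_apply (n : ℕ) (e : VEnd) (i : ℕ∞) : trunc n e i = min (n : ℕ∞) (e i) := rfl

theorem trunc_delay (n k : ℕ) (d : VEnd) : trunc (n + 1) (delay k d) = delay k (trunc n d) := by
  ext i
  rw [trunc_apply]
  by_cases hi : (k : ℕ∞) ≤ i
  · rw [delay_apply_of_le _ hi, delay_apply_of_le _ hi, trunc_apply, Nat.cast_succ, add_comm _ 1,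
      min_add_add_left]
  · rw [delay_apply_of_lt _ (not_le.mp hi), delay_apply_of_lt _ (not_le.mp hi), min_eq_right]
    exact zero_le

theorem trunc_zero (d : VEnd) : trunc 0 d = const 0 := by
  ext i; simp

theorem trunc_const_zero (n : ℕ) : trunc n (const 0) = const 0 := by
  ext i; simp

theorem trunc_of_le {n : ℕ} {d : VEnd} (h : d ⊤ ≤ n) : trunc n d = d := by
  ext i
  exact min_eq_right ((d.monotone le_top).trans h)

theorem trunc_top_le (n : ℕ) (d : VEnd) : trunc n d ⊤ ≤ n := min_le_left _ _

theorem trunc_top_ne (n : ℕ) (d : VEnd) : trunc n d ⊤ ≠ ⊤ :=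
  ((trunc_top_le n d).trans_lt (ENat.natCast_lt_top n)).ne

end VEnd

namespace VSet

/-- The structure map `L V ⟶ V` on the representable presheaf. -/
def delayMap : Lift VBar ⟶ VBar :=
  homMk (X := Lift VBar) (Y := VBar) (fun l : Option (ℕ × VBar.el) =>
      match l with
      | none => bar (VEnd.const 0)
      | some (k, d) => bar (VEnd.delay k (unbar d)))
    (lift_cases (X := VBar) (fun _ => rfl)
      (fun e n s k hk => by
        rw [show (Lift VBar).act e (some (n, s)) = cons k (VBar.act (e.shift n k) s) from
          act_cons hk s]
        exact (VEnd.delay_mul_of_hits (unbar s) hk).symm)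
      (fun e n s h => by
        rw [show (Lift VBar).act e (some (n, s)) = bot VBar from act_cons_not h s]
        exact (VEnd.delay_mul_of_not (unbar s) h).symm))

@[simp] theorem fn_delayMap_bot : fn delayMap (bot VBar) = bar (VEnd.const 0) := rfl

@[simp] theorem fn_delayMap_cons (k : ℕ) (d : VEnd) :
    fn delayMap (cons k (bar d)) = bar (VEnd.delay k d) := rfl

/-- The elements of `Lⁿ 1`, seen as chains of natural numbers that are at most `n`. -/
def val : ∀ n, lifting.pow n ⟶ VBar
  | 0 => homMk (X := 𝟙_ VSet) (Y := VBar) (fun _ => bar (VEnd.const 0)) (fun _ _ => rfl)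
  | n + 1 => lifting.L.map (val n) ≫ delayMap

/-- The element `⊥` of `Lⁿ⁺¹ 1`. -/
def powBot (n : ℕ) : (lifting.pow (n + 1)).el := bot (lifting.pow n)

/-- The chain `s` of `Lⁿ 1` preceded by `k` copies of `⊥`. -/
def powCons {n : ℕ} (k : ℕ) (s : (lifting.pow n).el) : (lifting.pow (n + 1)).el := cons k s

theorem pow_cases {n : ℕ} (x : (lifting.pow (n + 1)).el) :
    x = powBot n ∨ ∃ k s, x = powCons k s := liftObj_cases (X := lifting.pow n) x

/-- The map underlying an element of `Lⁿ 1`. -/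
def rank {n : ℕ} (x : (lifting.pow n).el) : VEnd := unbar (fn (val n) x)

theorem rank_zero (x : (lifting.pow 0).el) : rank x = VEnd.const 0 := rfl

theorem rank_powBot (n : ℕ) : rank (powBot n) = VEnd.const 0 := rfl

theorem rank_powCons {n : ℕ} (k : ℕ) (s : (lifting.pow n).el) :
    rank (powCons k s) = VEnd.delay k (rank s) := rfl

theorem rank_act {n : ℕ} (c : VEnd) (x : (lifting.pow n).el) :
    rank ((lifting.pow n).act c x) = rank x * c := fn_act (val n) c x

theorem rank_top_le {n : ℕ} (x : (lifting.pow n).el) : rank x ⊤ ≤ n := by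
  induction n with
  | zero => rw [rank_zero]; simp
  | succ n ih =>
    rcases pow_cases x with rfl | ⟨k, s, rfl⟩
    · rw [rank_powBot]; simp
    · rw [rank_powCons, VEnd.delay_top, Nat.cast_succ, add_comm (n : ℕ∞)]
      exact add_le_add_right (ih s) _

theorem rank_injective {n : ℕ} {x y : (lifting.pow n).el} (h : rank x = rank y) : x = y := by
  induction n with
  | zero => rfl
  | succ n ih =>
    rcases pow_cases x with rfl | ⟨k, s, rfl⟩ <;> rcases pow_cases y with rfl | ⟨j, t, rfl⟩
    · rfl
    · exact absurd h.symm VEnd.delay_ne_const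
    · exact absurd h VEnd.delay_ne_const
    · obtain ⟨rfl, h'⟩ := VEnd.delay_inj.mp h
      exact congrArg (powCons k) (ih h')

theorem exists_rank_eq {n : ℕ} {e : VEnd} (h : e ⊤ ≤ n) : ∃ x : (lifting.pow n).el, rank x = e := by
  induction n generalizing e with
  | zero =>
    refine ⟨(pt : (lifting.pow 0).el), VEnd.eq_iff_forall.mpr fun i => ?_⟩
    have := (e.monotone (le_top (a := i))).trans h
    simp at this
    exact this.symm
  | succ n ih =>
    rcases e.eq_const_or_delay with rfl | ⟨k, d, rfl⟩
    · exact ⟨powBot n, rfl⟩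
    · rw [VEnd.delay_top, Nat.cast_succ, add_comm (n : ℕ∞)] at h
      obtain ⟨s, hs⟩ := ih ((ENat.addLECancellable_natCast 1).add_le_add_iff_left.mp h)
      exact ⟨powCons k s, by rw [rank_powCons, hs]⟩

/-- The comparison maps between the objects `Lⁿ 1` are truncations of maps. -/
theorem rank_trans (m n : ℕ) (x : (lifting.pow m).el) :
    rank (fn (lifting.trans m n) x) = VEnd.trunc n (rank x) := by
  induction m generalizing n with
  | zero =>
    rw [rank_zero, VEnd.trunc_const_zero]
    cases n <;> rfl
  | succ m ih =>
    cases n with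
    | zero => exact (VEnd.trunc_zero _).symm
    | succ n =>
      rcases pow_cases x with rfl | ⟨k, s, rfl⟩
      · rw [rank_powBot, VEnd.trunc_const_zero]; rfl
      · rw [rank_powCons, VEnd.trunc_delay, ← ih n s]; rfl

theorem rank_up (n : ℕ) (x : (lifting.pow n).el) : rank (fn (lifting.up n) x) = rank x := by
  have h := lifting.trans_succ (le_refl n)
  rw [lifting.trans_self, Category.id_comp] at h
  rw [← h, rank_trans, VEnd.trunc_of_le]
  exact (rank_top_le x).trans (by simp)

theorem rank_down (n : ℕ) (x : (lifting.pow (n + 1)).el) :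
    rank (fn (lifting.down n) x) = VEnd.trunc n (rank x) := by
  have h := lifting.down_trans (le_refl n)
  rw [lifting.trans_self, Category.comp_id] at h
  rw [← h, rank_trans]

theorem rank_inftyApp (n : ℕ) (x : (𝟙_ VSet).el) :
    rank (fn (lifting.inftyApp n) x) = VEnd.const n := by
  induction n with
  | zero => rfl
  | succ n ih =>
    change VEnd.delay 0 (rank (fn (lifting.inftyApp n) x)) = _
    rw [ih, VEnd.delay_zero_const, Nat.cast_succ, add_comm]

/-! ### The limit and the colimit -/

/-- The truncation at `n` of the chains of natural numbers. -/
def approx (n : ℕ) : VBar ⟶ lifting.pow n :=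
  homMk (X := VBar) (fun e => (exists_rank_eq (VEnd.trunc_top_le n (unbar e))).choose)
    fun c e => rank_injective (by
      rw [rank_act, Exists.choose_spec (exists_rank_eq (VEnd.trunc_top_le n _)),
        Exists.choose_spec (exists_rank_eq (VEnd.trunc_top_le n _))]
      rfl)

theorem rank_approx (n : ℕ) (e : VEnd) :
    rank (fn (approx n) (bar e)) = VEnd.trunc n e :=
  Exists.choose_spec (exists_rank_eq (VEnd.trunc_top_le n e))

theorem trunc_trunc_succ (n : ℕ) (e : VEnd) :
    VEnd.trunc n (VEnd.trunc (n + 1) e) = VEnd.trunc n e := by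
  ext i
  simp only [VEnd.trunc_apply, ← min_assoc]
  rw [min_eq_left (Nat.cast_le.mpr (Nat.le_succ n))]

/-- A map is determined by its truncations. -/
theorem trunc_ext {d e : VEnd}
    (h : ∀ n : ℕ, VEnd.trunc n d = VEnd.trunc n e) : d = e := by
  have key : ∀ {d e : VEnd}, (∀ n : ℕ, VEnd.trunc n d = VEnd.trunc n e) →
      ∀ i, d i ≤ e i := by
    intro d e h i
    refine ENat.forall_natCast_le_iff_le.mp fun n hn => ?_
    have h1 := VEnd.eq_iff_forall.mp (h n) i
    simp only [VEnd.trunc_apply, min_eq_left hn] at h1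
    exact h1.le.trans (min_le_right _ _)
  exact VEnd.eq_iff_forall.mpr fun i => le_antisymm (key h i) (key (fun n => (h n).symm) i)

/-- A compatible family of truncations comes from a map, its pointwise supremum. -/
theorem exists_trunc_eq (v : ℕ → VEnd) (hv : ∀ n, VEnd.trunc n (v (n + 1)) = v n) :
    ∃ e, ∀ n : ℕ, VEnd.trunc n e = v n := by
  have hle : ∀ (n m : ℕ) (i : ℕ∞), v n i ≤ v (n + m) i := by
    intro n m i
    induction m with
    | zero => exact le_rfl
    | succ m ih =>
      refine ih.trans ?_
      rw [← hv (n + m)]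
      exact min_le_right _ _
  have hmin : ∀ (n m : ℕ) (i : ℕ∞), min (n : ℕ∞) (v (n + m) i) ≤ v n i := by
    intro n m i
    induction m with
    | zero => exact min_le_right _ _
    | succ m ih =>
      refine le_trans (le_min (min_le_left _ _) ?_) ih
      rw [← hv (n + m)]
      exact le_min ((min_le_left _ _).trans (Nat.cast_le.mpr (Nat.le_add_right n m)))
        (min_le_right _ _)
  refine ⟨VEnd.ofMonotone (fun i => ⨆ n, v n i)
    (fun i j h => iSup_mono fun n => (v n).monotone h)
    (fun b h => iSup_le fun n => VEnd.top_le fun k => (le_iSup (fun n => v n k) n).trans (h k)),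
    fun n => VEnd.eq_iff_forall.mpr fun i => le_antisymm ?_ ?_⟩
  · change min (n : ℕ∞) (⨆ m, v m i) ≤ v n i
    rw [min_comm, ← not_lt]
    intro hlt
    rw [lt_min_iff, lt_iSup_iff] at hlt
    obtain ⟨⟨m, hm⟩, hn⟩ := hlt
    rcases le_total n m with hnm | hnm
    · obtain ⟨k, rfl⟩ := Nat.exists_eq_add_of_le hnm
      exact absurd (hmin n k i) (not_le.mpr (lt_min hn hm))
    · obtain ⟨k, rfl⟩ := Nat.exists_eq_add_of_le hnm
      exact absurd (hle m k i) (not_le.mpr hm)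
  · refine le_min ?_ (le_iSup (fun n => v n i) n)
    rw [← hv n]
    exact min_le_left _ _

/-- The representable presheaf as a cone over the diagram `1 ⟵ L 1 ⟵ L L 1 ⟵ ⋯`. -/
def barCone : Cone lifting.downSeq where
  pt := VBar
  π := NatTrans.ofOpSequence (F := (Functor.const ℕᵒᵖ).obj VBar) approx fun n => by
    rw [Functor.ofOpSequence_map_homOfLE_succ]
    refine (Category.id_comp _).trans (hom_ext fun e => rank_injective ?_)
    exact (rank_approx n (unbar e)).trans (((rank_down n _).trans
      ((congrArg _ (rank_approx (n + 1) (unbar e))).trans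
        (trunc_trunc_succ n (unbar e)))).symm)

/-- The components of a cone over the diagram `1 ⟵ L 1 ⟵ L L 1 ⟵ ⋯`. -/
def coneProj (s : Cone lifting.downSeq) (n : ℕ) : s.pt ⟶ lifting.pow n := s.π.app (op n)

theorem coneProj_down (s : Cone lifting.downSeq) (n : ℕ) :
    coneProj s (n + 1) ≫ lifting.down n = coneProj s n := by
  have h := s.w (homOfLE (Nat.le_succ n)).op
  rwa [Functor.ofOpSequence_map_homOfLE_succ] at h

theorem exists_cone_lift (s : Cone lifting.downSeq) (x : s.pt.el) :
    ∃ e : VEnd, ∀ n : ℕ, VEnd.trunc n e = rank (fn (coneProj s n) x) := by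
  refine exists_trunc_eq _ fun n => ?_
  rw [← coneProj_down s n]
  exact (rank_down n _).symm

/-- The representable presheaf is the limit of `1 ⟵ L 1 ⟵ L L 1 ⟵ ⋯`. -/
def barIsLimit : IsLimit barCone where
  lift s := homMk (Y := VBar) (fun x => bar (exists_cone_lift s x).choose) fun c x =>
    trunc_ext fun n => by
      refine ((exists_cone_lift s (s.pt.act c x)).choose_spec n).trans ?_
      rw [fn_act, rank_act, ← (exists_cone_lift s x).choose_spec n]
      rfl
  fac s n := hom_ext fun x => rank_injective
    ((rank_approx n.unop _).trans ((exists_cone_lift s x).choose_spec n.unop))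
  uniq s m hm := hom_ext fun x => trunc_ext fun n => by
    refine Eq.trans ?_ ((exists_cone_lift s x).choose_spec n).symm
    rw [show coneProj s n = m ≫ approx n from (hm (op n)).symm]
    exact (rank_approx n _).symm

theorem rank_top_ne {n : ℕ} (x : (lifting.pow n).el) : rank x ⊤ ≠ ⊤ :=
  ((rank_top_le x).trans_lt (ENat.natCast_lt_top n)).ne

/-- The inclusion of `Lⁿ 1` into the bounded chains of natural numbers. -/
def valFin (n : ℕ) : lifting.pow n ⟶ VFin :=
  homMk (Y := VFin) (fun x => fin (rank x) (rank_top_ne x)) fun c x => fin_congr (rank_act c x) _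

/-- The bounded chains of natural numbers as a cocone under `1 ⟶ L 1 ⟶ L L 1 ⟶ ⋯`. -/
def finCocone : Cocone lifting.upSeq where
  pt := VFin
  ι := NatTrans.ofSequence (G := (Functor.const ℕ).obj VFin) valFin fun n => by
    rw [Functor.ofSequence_map_homOfLE_succ]
    have h : lifting.up n ≫ valFin (n + 1) = valFin n :=
      hom_ext fun x => fin_congr (rank_up n x) (rank_top_ne _)
    exact h.trans (Category.comp_id _).symm

theorem up_cocone_ι (s : Cocone lifting.upSeq) (n : ℕ) :
    lifting.up n ≫ s.ι.app (n + 1) = s.ι.app n := by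
  have h := s.w (homOfLE (Nat.le_succ n))
  rwa [Functor.ofSequence_map_homOfLE_succ] at h

/-- The value of a cocone at an element of `Lⁿ 1` depends only on its underlying map. -/
theorem cocone_ι_eq_of_rank_eq (s : Cocone lifting.upSeq) {n m : ℕ} (x : (lifting.pow n).el)
    (y : (lifting.pow m).el) (h : rank x = rank y) :
    (fn (s.ι.app n) x : s.pt.el) = fn (s.ι.app m) y := by
  wlog hnm : n ≤ m
  · exact (this s y x h.symm (le_of_not_ge hnm)).symm
  obtain ⟨k, rfl⟩ := Nat.exists_eq_add_of_le hnm
  have key : ∀ k, ∃ z : (lifting.pow (n + k)).el, rank z = rank x ∧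
      (fn (s.ι.app n) x : s.pt.el) = fn (s.ι.app (n + k)) z := by
    intro k
    induction k with
    | zero => exact ⟨x, rfl, rfl⟩
    | succ k ih =>
      obtain ⟨z, hz, hz'⟩ := ih
      refine ⟨fn (lifting.up _) z, (rank_up _ z).trans hz, hz'.trans ?_⟩
      exact congrArg (fun f => fn f z) (up_cocone_ι s (n + k)).symm
  obtain ⟨z, hz, hz'⟩ := key k
  rw [hz', rank_injective (hz.trans h)]

theorem exists_rank_eq_of_ne_top {e : VEnd} (h : e ⊤ ≠ ⊤) :
    ∃ n, ∃ x : (lifting.pow n).el, rank x = e :=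
  ⟨_, exists_rank_eq (ENat.natCast_toNat h).ge⟩

theorem exists_eq_valFin (y : VFin.el) : ∃ n, ∃ x, y = fn (valFin n) x := by
  obtain ⟨e, he, rfl⟩ := exists_eq_fin y
  obtain ⟨n, x, rfl⟩ := exists_rank_eq_of_ne_top he
  exact ⟨n, x, rfl⟩

theorem fn_valFin_eq_iff {n m : ℕ} {x : (lifting.pow n).el} {y : (lifting.pow m).el} :
    fn (valFin n) x = fn (valFin m) y ↔ rank x = rank y := Subtype.mk_eq_mk

theorem exists_cocone_desc (s : Cocone lifting.upSeq) (y : VFin.el) :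
    ∃ z : s.pt.el, ∀ n (x : (lifting.pow n).el), fn (valFin n) x = y → fn (s.ι.app n) x = z := by
  obtain ⟨n, x, rfl⟩ := exists_eq_valFin y
  exact ⟨fn (s.ι.app n) x, fun m x' h => cocone_ι_eq_of_rank_eq s _ _ (fn_valFin_eq_iff.mp h)⟩

/-- The bounded chains of natural numbers are the colimit of `1 ⟶ L 1 ⟶ L L 1 ⟶ ⋯`. -/
def finIsColimit : IsColimit finCocone where
  desc s := homMk (X := VFin) (fun y => (exists_cocone_desc s y).choose) fun c y => by
    obtain ⟨n, x, rfl⟩ := exists_eq_valFin y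
    rw [← (exists_cocone_desc s (fn (valFin n) x)).choose_spec n x rfl,
      ← (exists_cocone_desc s (VFin.act c (fn (valFin n) x))).choose_spec n
        ((lifting.pow n).act c x) (fn_act _ _ _)]
    exact fn_act (s.ι.app n) c x
  fac s n := hom_ext fun x =>
    ((exists_cocone_desc s (fn (valFin n) x)).choose_spec n x rfl).symm
  uniq s m hm := hom_ext fun y => by
    obtain ⟨n, x, rfl⟩ := exists_eq_valFin y
    refine Eq.trans ?_ ((exists_cocone_desc s (fn (valFin n) x)).choose_spec n x rfl)
    exact congrArg (fun f => fn f x) (hm n)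

/-- The identification of `ω̄` with the representable presheaf. -/
def barIso : VBar ≅ lifting.omegaBar := barIsLimit.conePointUniqueUpToIso (limit.isLimit _)

/-- The identification of `ω` with the bounded elements of the representable presheaf. -/
def finIso : VFin ≅ lifting.omega := finIsColimit.coconePointUniqueUpToIso (colimit.isColimit _)

theorem valFin_finIso (n : ℕ) : valFin n ≫ finIso.hom = colimit.ι lifting.upSeq n :=
  finIsColimit.comp_coconePointUniqueUpToIso_hom (colimit.isColimit _) n

theorem barIso_π (n : ℕ) : barIso.hom ≫ limit.π lifting.downSeq (op n) = approx n :=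
  barIsLimit.conePointUniqueUpToIso_hom_comp (limit.isLimit _) (op n)

/-- The map `i : ω ⟶ ω̄` is the inclusion of the bounded maps. -/
theorem finIso_incl : finIso.hom ≫ lifting.incl = finIncl ≫ barIso.hom := by
  refine finIsColimit.hom_ext fun n => limit.hom_ext fun k => ?_
  have h1 : valFin n ≫ finIso.hom ≫ lifting.incl = lifting.toOmegaBar n := by
    rw [← Category.assoc, valFin_finIso]
    exact colimit.ι_desc lifting.inclCocone n
  have h2 : valFin n ≫ finIncl ≫ approx k.unop = lifting.trans n k.unop :=
    hom_ext fun x => rank_injective ((rank_approx k.unop (rank x)).trans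
      (rank_trans n k.unop x).symm)
  rw [← barIso_π] at h2
  exact ((congrArg (· ≫ limit.π lifting.downSeq k) h1).trans (lifting.toOmegaBar_π n k)).trans
    h2.symm

/-- The point `∞` is the constant map with value `∞`. -/
theorem infty_eq (x : (𝟙_ VSet).el) : fn lifting.infty x = fn barIso.hom (bar (VEnd.const ⊤)) := by
  have h : lifting.infty = homMk (X := 𝟙_ VSet) (Y := VBar) (fun _ => bar (VEnd.const ⊤))
      (fun _ _ => rfl) ≫ barIso.hom := by
    refine limit.hom_ext fun k => (limit.lift_π lifting.inftyCone k).trans ?_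
    have h2 : lifting.inftyApp k.unop = homMk (X := 𝟙_ VSet) (Y := VBar)
        (fun _ => bar (VEnd.const ⊤)) (fun _ _ => rfl) ≫ approx k.unop := by
      refine hom_ext fun x => rank_injective ((rank_inftyApp k.unop x).trans ?_)
      refine Eq.trans ?_ (rank_approx k.unop (VEnd.const ⊤)).symm
      ext i; simp
    rw [← barIso_π] at h2
    exact h2
  rw [h]; rfl

end VSet

/-! ### Complete presheaves -/

namespace VSet

/-- Completeness, stated with the representable presheaf and its bounded elements in place of
`ω̄` and `ω`. -/
def Complete (X : VSet) : Prop :=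
  ∀ (A : VSet) (f : A ⊗ VFin ⟶ X), ∃! g : A ⊗ VBar ⟶ X, A ◁ finIncl ≫ g = f

theorem existsUnique_factor_of_iso {P Q P' Q' X : VSet} {i : P ⟶ Q} {i' : P' ⟶ Q'} (p : P ≅ P')
    (q : Q ≅ Q') (hpq : p.hom ≫ i' = i ≫ q.hom) (h : ∀ f : P ⟶ X, ∃! g, i ≫ g = f)
    (f : P' ⟶ X) : ∃! g, i' ≫ g = f := by
  obtain ⟨g, hg, hu⟩ := h (p.hom ≫ f)
  refine ⟨q.inv ≫ g, ?_, fun g' hg' => ?_⟩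
  · have h1 : i' = p.inv ≫ i ≫ q.hom := by rw [← hpq, Iso.inv_hom_id_assoc]
    dsimp only at hg ⊢
    rw [h1, Category.assoc, Category.assoc, Iso.hom_inv_id_assoc, hg, Iso.inv_hom_id_assoc]
  · rw [← hu (q.hom ≫ g') (by
      dsimp only at hg' ⊢
      rw [← Category.assoc, ← hpq, Category.assoc, hg']),
      Iso.inv_hom_id_assoc]

/-- Completeness is transported along the isomorphisms `barIso` and `finIso`. -/
theorem isComplete_iff {X : VSet} : lifting.IsComplete X ↔ Complete X := by
  have h : ∀ A : VSet, A ◁ finIso.hom ≫ A ◁ lifting.incl = A ◁ finIncl ≫ A ◁ barIso.hom := by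
    intro A
    rw [← MonoidalCategory.whiskerLeft_comp, finIso_incl, MonoidalCategory.whiskerLeft_comp]
  constructor
  · intro hX A f
    refine existsUnique_factor_of_iso (whiskerLeftIso A finIso).symm (whiskerLeftIso A barIso).symm
      ?_ (hX A) f
    rw [Iso.symm_hom, Iso.inv_comp_eq, ← Category.assoc, Iso.symm_hom, Iso.eq_comp_inv]
    exact (h A).symm
  · intro hX A f
    exact existsUnique_factor_of_iso (whiskerLeftIso A finIso) (whiskerLeftIso A barIso)
      (h A) (hX A) f

theorem whiskerLeft_finIncl_comp_eq_iff {A X : VSet} {g : A ⊗ VBar ⟶ X} {f : A ⊗ VFin ⟶ X} :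
    A ◁ finIncl ≫ g = f ↔
      ∀ a e (h : e ⊤ ≠ ⊤), fn g (pair a (bar e)) = fn f (pair a (fin e h)) :=
  ⟨fun hg a e h => congrArg (fun k => fn k (pair a (fin e h))) hg,
    fun hg => tensor_hom_ext fun a y => hg a y.1 y.2⟩

theorem Complete.hom_ext {A X : VSet} (hX : Complete X) {g g' : A ⊗ VBar ⟶ X}
    (h : ∀ a e, e ⊤ ≠ ⊤ → fn g (pair a (bar e)) = fn g' (pair a (bar e))) : g = g' :=
  (hX A (A ◁ finIncl ≫ g')).unique
    (whiskerLeft_finIncl_comp_eq_iff.mpr fun a e he => h a e he) rfl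

theorem Complete.exists_extension {A X : VSet} (hX : Complete X) (f : A ⊗ VFin ⟶ X) :
    ∃ g : A ⊗ VBar ⟶ X, ∀ a e (h : e ⊤ ≠ ⊤), fn g (pair a (bar e)) = fn f (pair a (fin e h)) := by
  obtain ⟨g, hg, -⟩ := hX A f
  exact ⟨g, whiskerLeft_finIncl_comp_eq_iff.mp hg⟩

/-- Completeness need only be tested with representable parameters. -/
theorem complete_of_yo {X : VSet}
    (h : ∀ f : VBar ⊗ VFin ⟶ X, ∃! g : VBar ⊗ VBar ⟶ X, VBar ◁ finIncl ≫ g = f) :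
    Complete X := by
  intro A f
  have hu : ∀ g g' : VBar ⊗ VBar ⟶ X, VBar ◁ finIncl ≫ g = VBar ◁ finIncl ≫ g' → g = g' :=
    fun g g' hg => (h (VBar ◁ finIncl ≫ g')).unique hg rfl
  choose g hg _ using fun a : A.el => h (yo a ▷ VFin ≫ f)
  replace hg : ∀ a d e (h : e ⊤ ≠ ⊤),
      fn (g a) (pair (bar d) (bar e)) = fn f (pair (A.act d a) (fin e h)) :=
    fun a d e h => whiskerLeft_finIncl_comp_eq_iff.mp (hg a) (bar d) e h
  have hact : ∀ c a, yo (bar c) ▷ VBar ≫ g a = g (A.act c a) := by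
    intro c a
    refine hu _ _ (whiskerLeft_finIncl_comp_eq_iff.mpr fun d e he => ?_)
    refine (hg a (c * unbar d) e he).trans (Eq.trans ?_ (hg (A.act c a) (unbar d) e he).symm)
    rw [act_mul]
  refine ⟨homMk (fun p => fn (g p.1) (pair (bar 1) p.2)) ?_, ?_, ?_⟩
  · intro c p
    obtain ⟨a, e, rfl⟩ := exists_eq_pair p
    rw [← fn_act]
    exact congrArg (fun k => fn k (pair (bar 1) (VBar.act c e))) (hact c a).symm
  · refine whiskerLeft_finIncl_comp_eq_iff.mpr fun a e he => ?_
    refine (hg a 1 e he).trans ?_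
    rw [act_one]
  · intro g' hg'
    rw [whiskerLeft_finIncl_comp_eq_iff] at hg'
    refine tensor_hom_ext fun a e => ?_
    have : g a = yo a ▷ VBar ≫ g' := hu _ _ (whiskerLeft_finIncl_comp_eq_iff.mpr fun d e he =>
      (hg a (unbar d) e he).trans (hg' _ e he).symm)
    change _ = fn (g a) (pair (bar 1) e)
    rw [this]
    change _ = fn g' (pair (A.act 1 a) e)
    rw [act_one]

/-- A map with values in a subobject factors through it. -/
theorem exists_factor {B X Z : VSet} (i : X ⟶ Z) (hi : Function.Injective (fn i)) (h : B ⟶ Z)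
    (hh : ∀ b, ∃ x, fn h b = fn i x) : ∃ k : B ⟶ X, ∀ b, fn h b = fn i (fn k b) := by
  choose k hk using hh
  refine ⟨homMk k fun e b => hi ?_, hk⟩
  rw [← hk, fn_act, fn_act, hk]

/-- Unique extension of maps that take values in a complete subobject. -/
theorem Complete.existsUnique_of_factor {A X Z : VSet} (hX : Complete X) (i : X ⟶ Z)
    (hi : Function.Injective (fn i)) (f : A ⊗ VFin ⟶ Z) (hf : ∀ b, ∃ x, fn f b = fn i x)
    (hg : ∀ g : A ⊗ VBar ⟶ Z, A ◁ finIncl ≫ g = f → ∀ b, ∃ x, fn g b = fn i x) :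
    ∃! g : A ⊗ VBar ⟶ Z, A ◁ finIncl ≫ g = f := by
  obtain ⟨f', hf'⟩ := exists_factor i hi f hf
  obtain ⟨g', hg'⟩ := hX.exists_extension f'
  refine ⟨g' ≫ i, ?_, fun g hgf => ?_⟩
  · refine whiskerLeft_finIncl_comp_eq_iff.mpr fun a e he => ?_
    rw [fn_comp, hg' a e he, ← hf']
  · obtain ⟨g'', hg''⟩ := exists_factor i hi g (hg g hgf)
    replace hgf := whiskerLeft_finIncl_comp_eq_iff.mp hgf
    have : g'' = g' := hX.hom_ext fun a e he => hi (by rw [← hg'', hgf a e he, hf', hg' a e he])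
    exact VSet.hom_ext fun b => by rw [hg'', this, fn_comp]

/-! ### Objects with trivial action -/

theorem const_zero_top_ne : VEnd.const 0 ⊤ ≠ ⊤ := by simp

/-- A map from `A × ω` to an object with trivial action is constant in the second argument: the
chain which runs from `0` to `e 0` connects the values there. -/
theorem fn_fin_eq_of_trivial {A X : VSet} (hX : ∀ e x, X.act e x = x) (f : A ⊗ VFin ⟶ X) (a : A.el)
    (e : VEnd) (h : e ⊤ ≠ ⊤) :
    fn f (pair a (fin e h)) = fn f (pair a (fin (VEnd.const 0) const_zero_top_ne)) := by
  have h0 : ∀ c p, fn f ((A ⊗ VFin).act c p) = fn f p := fun c p => by rw [fn_act, hX]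
  have hc : (VEnd.inf (VEnd.const (e 0)) 1) ⊤ ≠ ⊤ :=
    ((min_le_left _ _).trans_lt ((e.monotone le_top).trans_lt (lt_top_iff_ne_top.mpr h))).ne
  rw [← h0 (VEnd.const 0), ← h0 (VEnd.const 0) (pair a (fin (VEnd.const 0) _))]
  have h1 := (h0 (VEnd.const ⊤) (pair (A.act (VEnd.const 0) a) (fin _ hc))).trans
    (h0 (VEnd.const 0) (pair (A.act (VEnd.const 0) a) (fin _ hc))).symm
  simp only [act_pair, act_fin, ← act_mul] at h1 ⊢
  have e1 : VEnd.inf (VEnd.const (e 0)) 1 * VEnd.const ⊤ = e * VEnd.const 0 := by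
    ext i; simp [VEnd.one_apply]
  have e2 : VEnd.inf (VEnd.const (e 0)) 1 * VEnd.const 0 = VEnd.const 0 * VEnd.const 0 := by
    ext i; simp [VEnd.one_apply]
  rw [fin_congr e1, fin_congr e2] at h1
  exact h1

/-- A map from `A × ω̄` to an object with trivial action is constant in the second argument. -/
theorem fn_bar_eq_of_trivial {A X : VSet} (hX : ∀ e x, X.act e x = x) (f : A ⊗ VBar ⟶ X) (a : A.el)
    (e : VEnd) :
    fn f (pair a (bar e)) = fn f (pair a (bar (VEnd.const 0))) := by
  have h0 : ∀ c p, fn f ((A ⊗ VBar).act c p) = fn f p := fun c p => by rw [fn_act, hX]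
  rw [← h0 (VEnd.const 0), ← h0 (VEnd.const 0) (pair a (bar (VEnd.const 0)))]
  have h1 := (h0 (VEnd.const ⊤)
    (pair (A.act (VEnd.const 0) a) (bar (VEnd.inf (VEnd.const (e 0)) 1)))).trans
      (h0 (VEnd.const 0) _).symm
  simp only [act_pair, act_bar, ← act_mul] at h1 ⊢
  have e1 : VEnd.inf (VEnd.const (e 0)) 1 * VEnd.const ⊤ = e * VEnd.const 0 := by
    ext i; simp [VEnd.one_apply]
  have e2 : VEnd.inf (VEnd.const (e 0)) 1 * VEnd.const 0 = VEnd.const 0 * VEnd.const 0 := by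
    ext i; simp [VEnd.one_apply]
  rw [e1, e2] at h1
  exact h1

theorem complete_of_trivial {X : VSet} (hX : ∀ e x, X.act e x = x) : Complete X := by
  intro A f
  refine ⟨homMk (fun p => fn f (pair p.1 (fin (VEnd.const 0) const_zero_top_ne))) ?_, ?_, ?_⟩
  · intro c p
    rw [← fn_act]
    rfl
  · exact whiskerLeft_finIncl_comp_eq_iff.mpr fun a e he => (fn_fin_eq_of_trivial hX f a e he).symm
  · intro g hg
    refine tensor_hom_ext fun a e => ?_
    rw [whiskerLeft_finIncl_comp_eq_iff] at hg
    exact (fn_bar_eq_of_trivial hX g a (unbar e)).trans (hg a _ const_zero_top_ne)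

/-! ### Products, sums and exponentials -/

theorem Complete.prod {X Y : VSet} (hX : Complete X) (hY : Complete Y) : Complete (X ⊗ Y) := by
  intro A f
  obtain ⟨g, hg, hgu⟩ := hX A (f ≫ fst X Y)
  obtain ⟨k, hk, hku⟩ := hY A (f ≫ snd X Y)
  refine ⟨lift g k, ?_, fun g' hg' => ?_⟩
  · dsimp only
    rw [comp_lift, hg, hk, ← comp_lift, lift_fst_snd, Category.comp_id]
  · refine CartesianMonoidalCategory.hom_ext _ _ ?_ ?_
    · rw [lift_fst]
      exact hgu _ (by dsimp only; rw [← Category.assoc, hg'])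
    · rw [lift_snd]
      exact hku _ (by dsimp only; rw [← Category.assoc, hg'])

/-- The coproduct of presheaves. -/
abbrev Coprod (X Y : VSet) : VSet := FunctorToTypes.coprod X Y

/-- The element `inl x` of a coproduct. -/
def inl {X Y : VSet} (x : X.el) : (Coprod X Y).el := (Sum.inl x : X.el ⊕ Y.el)

/-- The element `inr y` of a coproduct. -/
def inr {X Y : VSet} (y : Y.el) : (Coprod X Y).el := (Sum.inr y : X.el ⊕ Y.el)

theorem inl_injective {X Y : VSet} : Function.Injective (inl : X.el → (Coprod X Y).el) :=
  Sum.inl_injective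

theorem inr_injective {X Y : VSet} : Function.Injective (inr : Y.el → (Coprod X Y).el) :=
  Sum.inr_injective

theorem inl_ne_inr {X Y : VSet} {x : X.el} {y : Y.el} :
    (inl x : (Coprod X Y).el) ≠ inr y := Sum.inl_ne_inr

theorem coprod_cases {X Y : VSet} (z : (Coprod X Y).el) :
    (∃ x, z = inl x) ∨ ∃ y, z = inr y := by
  rcases z with x | y
  · exact Or.inl ⟨x, rfl⟩
  · exact Or.inr ⟨y, rfl⟩

/-- A natural number as an element of the presheaf of natural numbers. -/
def num (n : ℕ) : PCFv.natObj.el := n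

theorem num_injective : Function.Injective num := fun _ _ h => h

theorem natObj_act (e : VEnd) (x : PCFv.natObj.el) : PCFv.natObj.act e x = x := rfl

/-- The map that tells the summands of a coproduct apart. -/
def tag (X Y : VSet) : Coprod X Y ⟶ PCFv.natObj :=
  homMk (X := Coprod X Y) (Y := PCFv.natObj)
    (fun z : X.el ⊕ Y.el => Sum.elim (fun _ => num 0) (fun _ => num 1) z) (by rintro e (x | y) <;> rfl)

theorem fn_tag_eq_zero {X Y : VSet} {z : (Coprod X Y).el} :
    fn (tag X Y) z = num 0 ↔ ∃ x, z = inl x := by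
  rcases coprod_cases z with ⟨x, rfl⟩ | ⟨y, rfl⟩
  · exact ⟨fun _ => ⟨x, rfl⟩, fun _ => rfl⟩
  · exact ⟨fun h => absurd (num_injective h) one_ne_zero, fun ⟨x, h⟩ => absurd h.symm inl_ne_inr⟩

theorem fn_tag_eq_one {X Y : VSet} {z : (Coprod X Y).el} :
    fn (tag X Y) z = num 1 ↔ ∃ y, z = inr y := by
  rcases coprod_cases z with ⟨x, rfl⟩ | ⟨y, rfl⟩
  · exact ⟨fun h => absurd (num_injective h) zero_ne_one, fun ⟨x, h⟩ => absurd h inl_ne_inr⟩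
  · exact ⟨fun _ => ⟨y, rfl⟩, fun _ => rfl⟩

/-- With representable parameters, a map to a presheaf with trivial action is constant. -/
theorem fn_fin_yo_eq_of_trivial {X : VSet} (hX : ∀ e x, X.act e x = x) (f : VBar ⊗ VFin ⟶ X) (p) :
    fn f p = fn f (pair (bar 1) (fin (VEnd.const 0) const_zero_top_ne)) := by
  obtain ⟨d, y, rfl⟩ := exists_eq_pair p
  obtain ⟨e, he, rfl⟩ := exists_eq_fin y
  rw [fn_fin_eq_of_trivial hX, ← hX (unbar d) (fn f (pair (bar 1) _)), ← fn_act]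
  rfl

/-- With representable parameters, a map to a sum of presheaves takes values in one summand only. -/
theorem Complete.coprod {X Y : VSet} (hX : Complete X) (hY : Complete Y) :
    Complete (Coprod X Y) := by
  refine complete_of_yo fun f => ?_
  have hf := fn_fin_yo_eq_of_trivial natObj_act (f ≫ tag X Y)
  have hg : ∀ g : VBar ⊗ VBar ⟶ Coprod X Y, VBar ◁ finIncl ≫ g = f → ∀ p,
      fn (tag X Y) (fn g p) =
        fn (f ≫ tag X Y) (pair (bar 1) (fin (VEnd.const 0) const_zero_top_ne)) := by
    intro g hg p
    obtain ⟨d, e, rfl⟩ := exists_eq_pair p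
    rw [whiskerLeft_finIncl_comp_eq_iff] at hg
    refine (fn_bar_eq_of_trivial natObj_act (g ≫ tag X Y) d (unbar e)).trans ?_
    rw [← hf (pair d (fin (VEnd.const 0) const_zero_top_ne)), fn_comp, fn_comp, hg d _ const_zero_top_ne]
  rcases coprod_cases (fn f (pair (bar 1) (fin (VEnd.const 0) const_zero_top_ne))) with h | h
  · rw [← fn_tag_eq_zero] at h
    exact hX.existsUnique_of_factor FunctorToTypes.coprod.inl inl_injective f
      (fun b => fn_tag_eq_zero.mp ((hf b).trans h))
      (fun g hgf b => fn_tag_eq_zero.mp ((hg g hgf b).trans h))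
  · rw [← fn_tag_eq_one] at h
    exact hY.existsUnique_of_factor FunctorToTypes.coprod.inr inr_injective f
      (fun b => fn_tag_eq_one.mp ((hf b).trans h))
      (fun g hgf b => fn_tag_eq_one.mp ((hg g hgf b).trans h))

/-- Maps to `B ⇒ X` with parameters in `A` are maps to `X` with parameters in `B × A`. -/
theorem Complete.exp {X : VSet} (hX : Complete X) (B : VSet) : Complete ((ihom B).obj X) := by
  intro A f
  obtain ⟨g, hg, hgu⟩ := hX (B ⊗ A) ((α_ B A VFin).hom ≫ MonoidalClosed.uncurry f)
  have key : ∀ k : A ⊗ VBar ⟶ (ihom B).obj X,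
      (B ⊗ A) ◁ finIncl ≫ (α_ B A VBar).hom ≫ MonoidalClosed.uncurry k =
        (α_ B A VFin).hom ≫ MonoidalClosed.uncurry (A ◁ finIncl ≫ k) := by
    intro k
    rw [MonoidalClosed.uncurry_natural_left]
    rfl
  refine ⟨MonoidalClosed.curry ((α_ B A VBar).inv ≫ g), ?_, fun k hk => ?_⟩
  · have h1 := key (MonoidalClosed.curry ((α_ B A VBar).inv ≫ g))
    rw [MonoidalClosed.uncurry_curry, Iso.hom_inv_id_assoc] at h1
    dsimp only at hg ⊢
    rw [hg, Iso.cancel_iso_hom_left] at h1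
    exact (MonoidalClosed.uncurry_injective h1).symm
  · rw [← hgu ((α_ B A VBar).hom ≫ MonoidalClosed.uncurry k) (by dsimp only; rw [key, hk]),
      Iso.inv_hom_id_assoc, MonoidalClosed.curry_uncurry]

end VSet

/-! ### Completeness of `L X` -/

namespace VSet

variable {A X : VSet}

/-- Whether a map `A × ω ⟶ L X` is defined is monotone in the second argument. -/
theorem isDef_fn_fin_mono (f : A ⊗ VFin ⟶ Lift X) {a : A.el} {e e' : VEnd} {h : e ⊤ ≠ ⊤}
    {h' : e' ⊤ ≠ ⊤} (hee : e 0 ≤ e' 0) (hd : IsDef (fn f (pair a (fin e h)))) :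
    IsDef (fn f (pair a (fin e' h'))) := by
  have hn : e 0 ≠ ⊤ := ((e.monotone le_top).trans_lt (lt_top_iff_ne_top.mpr h)).ne
  obtain ⟨n, hn⟩ := ENat.ne_top_iff_exists.mp hn
  have hc : (VEnd.inf (VEnd.const (e' 0)) (VEnd.add n)) ⊤ ≠ ⊤ :=
    ((min_le_left _ _).trans_lt ((e'.monotone le_top).trans_lt (lt_top_iff_ne_top.mpr h'))).ne
  -- the chain which runs from `e 0` to `e' 0`
  set l := fn f (pair (A.act (VEnd.const 0) a) (fin _ hc)) with hl
  have e1 : VEnd.inf (VEnd.const (e' 0)) (VEnd.add n) * VEnd.const 0 = e * VEnd.const 0 := by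
    ext i; simp [hn, hee]
  have e2 : VEnd.inf (VEnd.const (e' 0)) (VEnd.add n) * VEnd.const ⊤ = e' * VEnd.const 0 := by
    ext i; simp
  have h1 : (Lift X).act (VEnd.const 0) l = (Lift X).act (VEnd.const 0) (fn f (pair a (fin e h))) := by
    rw [hl, ← fn_act, ← fn_act]
    simp only [act_pair, act_fin, ← act_mul]
    rw [fin_congr e1]; rfl
  have h2 : (Lift X).act (VEnd.const ⊤) l = (Lift X).act (VEnd.const 0) (fn f (pair a (fin e' h'))) := by
    rw [hl, ← fn_act, ← fn_act]
    simp only [act_pair, act_fin, ← act_mul]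
    rw [fin_congr e2]; rfl
  rw [← isDef_act_const_zero, ← h2]
  rw [← isDef_act_const_zero, ← h1, isDef_act_const_zero] at hd
  exact hd.act _

/-- A map `A × ω̄ ⟶ L X` is defined as soon as it is defined at a finite stage. -/
theorem isDef_fn_bar_iff (F : A ⊗ VBar ⟶ Lift X) (a : A.el) (e : VEnd) :
    IsDef (fn F (pair a (bar e))) ↔ ∃ m, IsDef (fn F (pair a (bar (VEnd.trunc m e)))) := by
  set l := fn F (pair (A.act (VEnd.const 0) a) (bar (VEnd.inf (VEnd.const (e 0)) 1))) with hl
  have e1 : VEnd.inf (VEnd.const (e 0)) 1 * VEnd.const ⊤ = e * VEnd.const 0 := by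
    ext i; simp [VEnd.one_apply]
  have e2 : ∀ m : ℕ, VEnd.inf (VEnd.const (e 0)) 1 * VEnd.const m = VEnd.trunc m e * VEnd.const 0 := by
    intro m; ext i; simp [VEnd.one_apply, min_comm]
  have h1 : (Lift X).act (VEnd.const ⊤) l = (Lift X).act (VEnd.const 0) (fn F (pair a (bar e))) := by
    rw [hl, ← fn_act, ← fn_act]
    simp only [act_pair, act_bar, ← act_mul]
    rw [e1]; rfl
  have h2 : ∀ m : ℕ, (Lift X).act (VEnd.const m) l =
      (Lift X).act (VEnd.const 0) (fn F (pair a (bar (VEnd.trunc m e)))) := by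
    intro m
    rw [hl, ← fn_act, ← fn_act]
    simp only [act_pair, act_bar, ← act_mul]
    rw [e2]; rfl
  rw [← isDef_act_const_zero, ← h1, isDef_act_iff]
  constructor
  · rintro ⟨n, s, hs, -⟩
    refine ⟨n, ?_⟩
    rw [← isDef_act_const_zero, ← h2, isDef_act_iff]
    exact ⟨n, s, hs, le_rfl⟩
  · rintro ⟨m, hm⟩
    rw [← isDef_act_const_zero, ← h2, isDef_act_iff] at hm
    obtain ⟨n, s, hs, -⟩ := hm
    exact ⟨n, s, hs, le_top⟩

/-- The chain `j ↦ min (e d) (M + j)`, which starts at `e d` truncated at `M` and ends at `e d`. -/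
def ramp (e d : VEnd) (M : ℕ) (j : VEnd) : VEnd := VEnd.inf (e * d) (VEnd.add M * j)

theorem ramp_top_ne (e d : VEnd) (M : ℕ) {j : VEnd} (hj : j ⊤ ≠ ⊤) : ramp e d M j ⊤ ≠ ⊤ := by
  refine ((min_le_right _ _).trans_lt (?_ : (VEnd.add M * j) ⊤ < ⊤)).ne
  rw [VEnd.mul_apply, VEnd.add_apply]
  exact WithTop.add_lt_top.mpr ⟨ENat.natCast_lt_top M, lt_top_iff_ne_top.mpr hj⟩

theorem ramp_const_top (e d : VEnd) (M : ℕ) : ramp e d M (VEnd.const ⊤) = e * d := by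
  ext i; simp [ramp]

theorem ramp_const_zero (e : VEnd) (M : ℕ) : ramp e 1 M (VEnd.const 0) = VEnd.trunc M e := by
  ext i; simp [ramp, min_comm]

theorem ramp_of_le {e : VEnd} {M : ℕ} (h : e ⊤ ≤ M) (d j : VEnd) : ramp e d M j = e * d := by
  ext i
  exact min_eq_left (((e.monotone le_top).trans h).trans le_self_add)

theorem trunc_mul_le_ramp (e d : VEnd) (M : ℕ) (j : VEnd) (i : ℕ∞) :
    (VEnd.trunc M e * d) i ≤ ramp e d M j i :=
  le_min (min_le_right _ _) ((min_le_left _ _).trans le_self_add)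

/-- `K` collects the values of `f` along the chains `ramp e d M j`. -/
def IsRampVal (f : A ⊗ VFin ⟶ Lift X) (a : A.el) (e : VEnd) (M : ℕ) (K : VBar ⊗ VBar ⟶ X) : Prop :=
  ∀ d j (h : ramp e d M j ⊤ ≠ ⊤), j ⊤ ≠ ⊤ →
    fn f (pair (A.act d a) (fin (ramp e d M j) h)) = cons 0 (fn K (pair (bar d) (bar j)))

theorem IsRampVal.unique (hX : Complete X) {f : A ⊗ VFin ⟶ Lift X} {a : A.el} {e : VEnd} {M : ℕ}
    {K K' : VBar ⊗ VBar ⟶ X} (hK : IsRampVal f a e M K) (hK' : IsRampVal f a e M K') : K = K' :=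
  hX.hom_ext fun d j hj => (cons_inj.mp ((hK (unbar d) j (ramp_top_ne _ _ _ hj) hj).symm.trans
    (hK' (unbar d) j (ramp_top_ne _ _ _ hj) hj))).2

theorem IsRampVal.act {f : A ⊗ VFin ⟶ Lift X} {a : A.el} {e : VEnd} {M : ℕ}
    {K : VBar ⊗ VBar ⟶ X} (hK : IsRampVal f a e M K) (c : VEnd) :
    IsRampVal f (A.act c a) (e * c) M (yo (bar c) ▷ VBar ≫ K) := by
  intro d j h hj
  rw [← act_mul]
  exact hK (c * d) j h hj

/-- The translation by `k` on `ω̄`. -/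
def addMap (k : ℕ) : VBar ⟶ VBar :=
  homMk (X := VBar) (Y := VBar) (fun j => bar (VEnd.add k * unbar j)) fun _ _ => rfl

theorem IsRampVal.shift {f : A ⊗ VFin ⟶ Lift X} {a : A.el} {e : VEnd} {M : ℕ}
    {K : VBar ⊗ VBar ⟶ X} (hK : IsRampVal f a e M K) (k : ℕ) :
    IsRampVal f a e (M + k) (VBar ◁ addMap k ≫ K) := by
  intro d j h hj
  have h1 : ramp e d (M + k) j = ramp e d M (VEnd.add k * j) := by
    rw [ramp, ← VEnd.add_mul_add]; rfl
  rw [fin_congr h1]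
  refine hK d _ _ ?_
  rw [VEnd.mul_apply, VEnd.add_apply]
  exact (WithTop.add_lt_top.mpr ⟨ENat.natCast_lt_top k, lt_top_iff_ne_top.mpr hj⟩).ne

/-- The graph of the partial map on `A × ω̄` that extends the values of `f` in `X`. -/
def limGraph (f : A ⊗ VFin ⟶ Lift X) (p : (A ⊗ VBar).el) (x : X.el) : Prop :=
  ∃ M K, IsRampVal f (fn (fst A VBar) p) (unbar (fn (snd A VBar) p)) M K ∧
    fn K (pair (bar 1) (bar (VEnd.const ⊤))) = x

/-- The value does not depend on the index `M` at which the chain `ramp` starts: two choices `M` and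
`M'` are compared at `M + M'`. -/
theorem limGraph_unique (hX : Complete X) {f : A ⊗ VFin ⟶ Lift X} {p : (A ⊗ VBar).el} {x x' : X.el}
    (h : limGraph f p x) (h' : limGraph f p x') : x = x' := by
  obtain ⟨M, K, hK, rfl⟩ := h
  obtain ⟨M', K', hK', rfl⟩ := h'
  have h1 := hK.shift M'
  rw [add_comm] at h1
  have h2 := congrArg (fun k => fn k (pair (bar 1) (bar (VEnd.const ⊤)))) (h1.unique hX (hK'.shift M))
  have h3 : ∀ k, VEnd.add k * VEnd.const ⊤ = VEnd.const ⊤ := by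
    intro k; ext i; simp
  change fn K (pair (bar 1) (bar (VEnd.add M' * VEnd.const ⊤))) =
    fn K' (pair (bar 1) (bar (VEnd.add M * VEnd.const ⊤))) at h2
  rwa [h3, h3] at h2

theorem limGraph_act {f : A ⊗ VFin ⟶ Lift X} {p : (A ⊗ VBar).el} {x : X.el} (c : VEnd)
    (h : limGraph f p x) : limGraph f ((A ⊗ VBar).act c p) (X.act c x) := by
  obtain ⟨M, K, hK, rfl⟩ := h
  refine ⟨M, _, hK.act c, ?_⟩
  rw [← fn_act]; rfl

/-- The partial map is defined where some truncation is. -/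
theorem exists_limGraph_iff (hX : Complete X) {f : A ⊗ VFin ⟶ Lift X} {a : A.el} {e : VEnd} :
    (∃ x, limGraph f (pair a (bar e)) x) ↔
      ∃ M, IsDef (fn f (pair a (fin (VEnd.trunc M e) (VEnd.trunc_top_ne M e)))) := by
  constructor
  · rintro ⟨x, M, K, hK, -⟩
    refine ⟨M, fn K (pair (bar 1) (bar (VEnd.const 0))), ?_⟩
    have h := hK 1 (VEnd.const 0) (ramp_top_ne _ _ _ const_zero_top_ne) const_zero_top_ne
    simp only [fn_fst, fn_snd, unbar_bar] at h
    rw [fin_congr (ramp_const_zero e M), act_one] at h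
    exact h
  · rintro ⟨M, hM⟩
    let w : VBar ⊗ VFin ⟶ VFin := homMk (X := VBar ⊗ VFin) (Y := VFin)
      (fun p : VEnd × {e : VEnd // e ⊤ ≠ ⊤} => fin (ramp e p.1 M p.2.1) (ramp_top_ne _ _ _ p.2.2))
      (fun _ _ => rfl)
    obtain ⟨k, hk⟩ := exists_factor (eta X) (fun s t h => (cons_inj.mp h).2)
      (lift (fst _ _ ≫ yo a) w ≫ f) (by
        intro p
        obtain ⟨d, y, rfl⟩ := exists_eq_pair p
        obtain ⟨j, hj, rfl⟩ := exists_eq_fin y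
        have h := hM.act (unbar d)
        rw [← fn_act] at h
        exact isDef_fn_fin_mono f (h' := ramp_top_ne e (unbar d) M hj)
          (trunc_mul_le_ramp e (unbar d) M j 0) h)
    obtain ⟨K, hK⟩ := hX.exists_extension k
    refine ⟨_, M, K, fun d j h hj => ?_, rfl⟩
    rw [hK (bar d) j hj]
    exact hk (pair (bar d) (fin j hj))

/-- At bounded elements the partial map extends `f`, because the chain `ramp` is eventually
constant. -/
theorem limGraph_of_bounded {f : A ⊗ VFin ⟶ Lift X} {a : A.el} {e : VEnd} (h : e ⊤ ≠ ⊤) {s : X.el}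
    (hs : fn f (pair a (fin e h)) = cons 0 s) : limGraph f (pair a (bar e)) s := by
  obtain ⟨M, hM⟩ := ENat.ne_top_iff_exists.mp h
  refine ⟨M, fst _ _ ≫ yo s, fun d j hr hj => ?_, act_one X s⟩
  simp only [fn_fst, fn_snd, unbar_bar, fn_comp, fn_yo] at hr ⊢
  rw [fin_congr (ramp_of_le hM.ge d j), ← act_cons_zero, ← hs, ← fn_act]
  rfl

/-- Every extension of `f` to `A × ω̄` takes the values prescribed by the graph. -/
theorem limGraph_of_extension {f : A ⊗ VFin ⟶ Lift X} {F : A ⊗ VBar ⟶ Lift X}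
    (hF : A ◁ finIncl ≫ F = f) {a : A.el} {e : VEnd} {s : X.el}
    (hs : fn F (pair a (bar e)) = cons 0 s) : limGraph f (pair a (bar e)) s := by
  rw [whiskerLeft_finIncl_comp_eq_iff] at hF
  obtain ⟨M, hM⟩ := (isDef_fn_bar_iff F a e).mp ⟨s, hs⟩
  rw [hF _ _ (VEnd.trunc_top_ne M e)] at hM
  let w : VBar ⊗ VBar ⟶ VBar := homMk (X := VBar ⊗ VBar) (Y := VBar)
    (fun p : VEnd × VEnd => bar (ramp e p.1 M p.2)) (fun _ _ => rfl)
  obtain ⟨K, hK⟩ := exists_factor (eta X) (fun s t h => (cons_inj.mp h).2)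
    (lift (fst _ _ ≫ yo a) w ≫ F) (by
      intro p
      obtain ⟨d, j, rfl⟩ := exists_eq_pair p
      refine (isDef_fn_bar_iff F (A.act (unbar d) a) (ramp e (unbar d) M (unbar j))).mpr ⟨M, ?_⟩
      rw [hF _ _ (VEnd.trunc_top_ne M _)]
      have h := hM.act (unbar d)
      rw [← fn_act] at h
      refine isDef_fn_fin_mono f ?_ h
      exact le_min (min_le_left _ _) (trunc_mul_le_ramp e (unbar d) M (unbar j) 0))
  refine ⟨M, K, fun d j hr hj => ?_, ?_⟩
  · exact (hF (A.act d a) (ramp e d M j) hr).symm.trans (hK (pair (bar d) (bar j)))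
  · have h := hK (pair (bar 1) (bar (VEnd.const ⊤)))
    have h' : fn F (pair (A.act 1 a) (bar (ramp e 1 M (VEnd.const ⊤)))) = cons 0 _ := h
    rw [act_one, ramp_const_top, mul_one, hs] at h'
    exact (cons_inj.mp h').2.symm

/-- The lifting of a complete presheaf is complete. -/
theorem Complete.lift (hX : Complete X) : Complete (Lift X) := by
  intro A f
  obtain ⟨F, hF⟩ := exists_lift_of_graph (limGraph f) (fun p x x' => limGraph_unique hX)
    (fun p x c => limGraph_act c) (by
      intro p
      obtain ⟨a, e, rfl⟩ := exists_eq_pair p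
      have key : ∀ c : VEnd, (∃ x, limGraph f ((A ⊗ VBar).act c (pair a e)) x) ↔
          ∃ M n s, fn f (pair a (fin (VEnd.trunc M (unbar e)) (VEnd.trunc_top_ne M _))) = cons n s ∧
            (n : ℕ∞) ≤ c 0 := by
        intro c
        refine (exists_limGraph_iff (e := unbar e * c) hX).trans (exists_congr fun M => ?_)
        rw [← isDef_act_iff, ← fn_act]
        rfl
      -- the threshold at `(a, e)` is the least index at which some truncation has left `⊥`
      by_cases h : ∃ n M s,
          fn f (pair a (fin (VEnd.trunc M (unbar e)) (VEnd.trunc_top_ne M _))) = cons n s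
      · classical
        refine Or.inr ⟨Nat.find h, fun c => (key c).trans ⟨?_, fun hc => ?_⟩⟩
        · rintro ⟨M, n, s, hs, hn⟩
          exact (Nat.cast_le.mpr (Nat.find_min' h ⟨M, s, hs⟩)).trans hn
        · obtain ⟨M, s, hs⟩ := Nat.find_spec h
          exact ⟨M, _, s, hs, hc⟩
      · exact Or.inl fun c hc => by
          obtain ⟨M, n, s, hs, -⟩ := (key c).mp hc
          exact h ⟨n, M, s, hs⟩)
  refine ⟨F, ?_, fun F' hF' => ?_⟩
  · refine (lift_hom_ext ?_ ?_).symm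
    · intro b s hs
      obtain ⟨a, y, rfl⟩ := exists_eq_pair b
      obtain ⟨e, he, rfl⟩ := exists_eq_fin y
      exact (hF (pair a (bar e)) s).mpr (limGraph_of_bounded he hs)
    · rintro b ⟨s, hs⟩
      obtain ⟨a, y, rfl⟩ := exists_eq_pair b
      obtain ⟨e, he, rfl⟩ := exists_eq_fin y
      obtain ⟨M, hM⟩ := (exists_limGraph_iff hX).mp ⟨s, (hF (pair a (bar e)) s).mp hs⟩
      exact isDef_fn_fin_mono f (min_le_right _ _) hM
  · refine lift_hom_ext (fun b s hs => ?_) ?_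
    · obtain ⟨a, e, rfl⟩ := exists_eq_pair b
      exact (hF _ s).mpr (limGraph_of_extension (e := unbar e) hF' hs)
    · rintro b ⟨s, hs⟩
      obtain ⟨a, e, rfl⟩ := exists_eq_pair b
      obtain ⟨M, hM⟩ := (exists_limGraph_iff (e := unbar e) hX).mp ⟨s, (hF _ s).mp hs⟩
      refine (isDef_fn_bar_iff F' a (unbar e)).mpr ⟨M, ?_⟩
      rwa [whiskerLeft_finIncl_comp_eq_iff.mp hF' _ _ (VEnd.trunc_top_ne M _)]

/-- A countable copower of the terminal presheaf has trivial action. -/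
theorem sigma_unit_act (e : VEnd) (x : (∐ fun _ : ℕ => 𝟙_ VSet).el) :
    (∐ fun _ : ℕ => 𝟙_ VSet).act e x = x := by
  let p : ℕ → (∐ fun _ : ℕ => 𝟙_ VSet).el := fun n => fn (Sigma.ι (fun _ : ℕ => 𝟙_ VSet) n) pt
  have hp : ∀ e n, (∐ fun _ : ℕ => 𝟙_ VSet).act e (p n) = p n := fun e n => (fn_act _ e pt).symm
  let j : PCFv.natObj ⟶ ∐ fun _ : ℕ => 𝟙_ VSet :=
    homMk (X := PCFv.natObj) p (fun e n => (hp e n).symm)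
  let q : (∐ fun _ : ℕ => 𝟙_ VSet) ⟶ PCFv.natObj :=
    Sigma.desc fun n => homMk (X := 𝟙_ VSet) (Y := PCFv.natObj) (fun _ => num n) (fun _ _ => rfl)
  have h : q ≫ j = 𝟙 _ := by
    refine Sigma.hom_ext _ _ fun n => ?_
    rw [← Category.assoc, Sigma.ι_desc, Category.comp_id]
    rfl
  have hx : ∀ x, ∃ n, x = p n := fun x => ⟨fn q x, (congrArg (fun k => fn k x) h).symm⟩
  obtain ⟨n, rfl⟩ := hx x
  exact hp e n

theorem isNormalModel : IsNormalModel truth lifting where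
  generic := isGenericSemidecidable_truth
  lifting := isLiftingMonad_lifting
  complete := isComplete_iff.mpr (complete_of_trivial sigma_unit_act).lift

end VSet

namespace PCFv

open VSet

theorem Ty.complete_den (τ : Ty) : Complete τ.den := by
  induction τ with
  | empty => exact complete_of_trivial fun _ _ => rfl
  | unit => exact complete_of_trivial fun _ _ => rfl
  | nat => exact complete_of_trivial fun _ _ => rfl
  | sum σ τ hσ hτ => exact hσ.coprod hτ
  | prod σ τ hσ hτ => exact hσ.prod hτ
  | arrow σ τ _ hτ => exact hτ.lift.exp σ.den

theorem typesComplete : TypesComplete := fun τ => isComplete_iff.mpr τ.complete_den.lift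

end PCFv

/-! ### The chain of approximations of a recursive definition -/

namespace VSet

/-- The object `A ⇒ L B` of partial maps. -/
abbrev Arr (A B : VSet) : VSet := lifting.arr A B

/-- An element of an exponential is determined by its values at all stages. -/
theorem ev_ext {A Y : VSet} {k k' : ((ihom A).obj Y).el}
    (h : ∀ c a, ev a (((ihom A).obj Y).act c k) = ev a (((ihom A).obj Y).act c k')) : k = k' := by
  have h1 : MonoidalClosed.uncurry (yo k) = MonoidalClosed.uncurry (yo k') :=
    tensor_hom_ext fun a c => (ev_uncurry (yo k) a c).trans ((h (unbar c) a).trans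
      (ev_uncurry (yo k') a c).symm)
  have h2 := congrArg (fun g => fn g (bar 1)) (MonoidalClosed.uncurry_injective h1)
  simpa only [fn_yo, act_one] using h2

/-- The algebra structure on `A ⇒ L B`. -/
def arrAlg (A B : VSet) : Lift (Arr A B) ⟶ Arr A B := lifting.arrAlg A B

theorem ev_arrAlg {A B : VSet} (a : A.el) (l : (Lift (Arr A B)).el) :
    ev a (fn (arrAlg A B) l) =
      fn (mu B) (fn (lifting.L.map ((ihom.ev A).app (Lift B))) (fn (str A (Arr A B)) (pair a l))) :=
  ev_curry _ a l

theorem ev_arrAlg_cons {A B : VSet} (a : A.el) (n : ℕ) (k : (Arr A B).el) :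
    ev a (fn (arrAlg A B) (cons n k)) = fn (mu B) (cons n (ev (A.act (VEnd.add n) a) k)) :=
  ev_arrAlg a (cons n k)

theorem ev_arrAlg_bot {A B : VSet} (a : A.el) :
    ev a (fn (arrAlg A B) (bot (Arr A B))) = bot B := ev_arrAlg a (bot (Arr A B))

theorem arrAlg_cons_zero {A B : VSet} (k : (Arr A B).el) : fn (arrAlg A B) (cons 0 k) = k := by
  refine ev_ext fun c a => ?_
  rw [← fn_act, act_cons_zero, ev_arrAlg_cons, fn_mu_cons_zero, VEnd.add_zero_eq, act_one]

theorem delayMap_bijective : Function.Bijective (fn delayMap) := by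
  constructor
  · intro x y h
    rcases liftObj_cases x with rfl | ⟨n, d, rfl⟩ <;> rcases liftObj_cases y with rfl | ⟨m, e, rfl⟩
    · rfl
    · exact absurd h.symm VEnd.delay_ne_const
    · exact absurd h VEnd.delay_ne_const
    · exact cons_inj.mpr (VEnd.delay_inj.mp h)
  · intro e
    rcases (unbar e).eq_const_or_delay with h | ⟨k, d, h⟩
    · exact ⟨bot VBar, h.symm⟩
    · exact ⟨cons k (bar d), h.symm⟩

variable {Γ X : VSet}

/-- A map `Γ × ω̄ ⟶ L X` that unfolds `f` along `ω̄`. -/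
structure IsApChain (f : Γ ⊗ Lift X ⟶ Lift X) (C : Γ ⊗ VBar ⟶ Lift X) : Prop where
  bot (γ : Γ.el) : fn C (pair γ (bar (VEnd.const 0))) = bot X
  cons (γ : Γ.el) (k : ℕ) (d : VEnd) : fn C (pair γ (bar (VEnd.delay k d))) =
    fn (mu X) (cons k (fn f (pair (Γ.act (VEnd.add k) γ)
      (fn C (pair (Γ.act (VEnd.add k) γ) (bar d))))))

theorem one_add_le_succ {x : ℕ∞} {n : ℕ} (h : 1 + x ≤ (n + 1 : ℕ)) : x ≤ n := by
  rw [Nat.cast_succ, add_comm (n : ℕ∞)] at h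
  exact (ENat.addLECancellable_natCast 1).add_le_add_iff_left.mp h

/-- A chain is determined by its recursion equation: at bounded elements by induction on the bound,
and elsewhere by completeness. -/
theorem IsApChain.unique (hX : Complete (Lift X)) {f : Γ ⊗ Lift X ⟶ Lift X}
    {C C' : Γ ⊗ VBar ⟶ Lift X} (hC : IsApChain f C) (hC' : IsApChain f C') : C = C' := by
  have key : ∀ (n : ℕ) (e : VEnd) (γ : Γ.el), e ⊤ ≤ n →
      fn C (pair γ (bar e)) = fn C' (pair γ (bar e)) := by
    intro n
    induction n with
    | zero =>
      intro e γ he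
      rcases e.eq_const_or_delay with rfl | ⟨k, d, rfl⟩
      · rw [hC.bot, hC'.bot]
      · rw [VEnd.delay_top] at he
        simp at he
    | succ n ih =>
      intro e γ he
      rcases e.eq_const_or_delay with rfl | ⟨k, d, rfl⟩
      · rw [hC.bot, hC'.bot]
      · rw [VEnd.delay_top] at he
        rw [hC.cons, hC'.cons, ih d _ (one_add_le_succ he)]
  exact hX.hom_ext fun γ e he => key _ e γ (ENat.natCast_toNat he).ge

theorem fn_ap_powCons (f : Γ ⊗ Lift X ⟶ Lift X) (n : ℕ) (γ : Γ.el) (k : ℕ)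
    (s : (lifting.pow n).el) :
    fn (lifting.ap f (n + 1)) (pair γ (powCons k s)) =
      fn (mu X) (cons k (fn f (pair (Γ.act (VEnd.add k) γ)
        (fn (lifting.ap f n) (pair (Γ.act (VEnd.add k) γ) s))))) := rfl

/-- The map on `Γ × ω` restricts to the approximations on `Γ × Lⁿ 1`. -/
theorem fn_apOmega (f : Γ ⊗ Lift X ⟶ Lift X) (n : ℕ) (γ : Γ.el) (s : (lifting.pow n).el) :
    fn (Γ ◁ finIso.hom ≫ lifting.apOmega f) (pair γ (fn (valFin n) s)) =
      fn (lifting.ap f n) (pair γ s) := by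
  have h : Γ ◁ colimit.ι lifting.upSeq n ≫ lifting.apOmega f = lifting.ap f n := 
    (MonoidalClosed.uncurry_natural_left _ _).symm.trans <| (congrArg MonoidalClosed.uncurry (colimit.ι_desc (lifting.apCocone f) n)).trans
      (MonoidalClosed.uncurry_curry _)
  rw [← valFin_finIso] at h
  exact congrArg (fun k => fn k (pair γ s)) h

/-- The fixed point `ξ_f` is the value at `∞` of the chain of approximations. -/
theorem exists_isApChain (hX : lifting.IsComplete (Lift X)) (f : Γ ⊗ Lift X ⟶ Lift X) :
    ∃ C, IsApChain f C ∧ ∀ γ, fn (lifting.xi hX f) γ = fn C (pair γ (bar (VEnd.const ⊤))) := by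
  have hX' := isComplete_iff.mp hX
  let C : Γ ⊗ VBar ⟶ Lift X := Γ ◁ barIso.hom ≫ lifting.apBar hX f
  have h0 : Γ ◁ finIncl ≫ C = Γ ◁ finIso.hom ≫ lifting.apOmega f := by
    have h1 : Γ ◁ lifting.incl ≫ lifting.apBar hX f = lifting.apOmega f :=
      (hX Γ (lifting.apOmega f)).choose_spec.1
    rw [← h1, ← Category.assoc, ← Category.assoc, ← MonoidalCategory.whiskerLeft_comp,
      ← MonoidalCategory.whiskerLeft_comp, finIso_incl]
  have h1 : ∀ n (s : (lifting.pow n).el) (γ : Γ.el),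
      fn C (pair γ (bar (rank s))) = fn (lifting.ap f n) (pair γ s) := fun n s γ =>
    (congrArg (fun k => fn k (pair γ (fn (valFin n) s))) h0).trans (fn_apOmega f n γ s)
  have hbot : ∀ γ, fn C (pair γ (bar (VEnd.const 0))) = bot X := fun γ => h1 0 pt γ
  -- both sides of the recursion equation, as maps from `Γ × L ω̄`
  let Q : Γ ⊗ Lift VBar ⟶ Lift X :=
    str Γ VBar ≫ lifting.L.map (lift (fst _ _) C) ≫ lifting.L.map f ≫ mu X
  have hQ : Γ ◁ delayMap ≫ C = Q := by
    have := isIso_of_bijective delayMap delayMap_bijective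
    have hinv : ∀ l, fn (inv delayMap) (fn delayMap l) = l := fun l =>
      congrArg (fun k => fn k l) (IsIso.hom_inv_id delayMap)
    -- by completeness, it suffices to compare them at bounded elements
    have h2 : C = Γ ◁ inv delayMap ≫ Q := by
      refine hX'.hom_ext fun γ e he => ?_
      rcases e.eq_const_or_delay with rfl | ⟨k, d, rfl⟩
      · rw [hbot]
        exact congrArg (fun l => fn Q (pair γ l)) (hinv (bot VBar)).symm
      · refine Eq.trans ?_ (congrArg (fun l => fn Q (pair γ l)) (hinv (cons k (bar d))).symm)
        rw [VEnd.delay_top] at he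
        have hd : d ⊤ ≠ ⊤ := fun h => he (by rw [h]; rfl)
        obtain ⟨n, s, rfl⟩ := exists_rank_eq_of_ne_top hd
        refine ((h1 (n + 1) (powCons k s) γ).trans (fn_ap_powCons f n γ k s)).trans ?_
        rw [← h1]
        rfl
    exact tensor_hom_ext fun γ l => (congrArg (fun q => fn q (pair γ (fn delayMap l))) h2).trans
      (congrArg (fun l => fn Q (pair γ l)) (hinv l))
  refine ⟨C, ⟨hbot, fun γ k d => ?_⟩, fun γ => ?_⟩
  · exact congrArg (fun q => fn q (pair γ (cons k (bar d)))) hQ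
  · change fn (lifting.apBar hX f) (pair γ (fn lifting.infty pt)) = _
    rw [infty_eq]
    rfl

variable {A B : VSet}

/-- The chain of approximations of the recursive definition of an element `x` of `A ⇒ L B` by the
equation `x a = F (a, x)`. -/
structure IsRecChain (F : A ⊗ (Arr A B ⊗ Γ) ⟶ Lift B) (C : Γ ⊗ VBar ⟶ Lift (Arr A B)) : Prop where
  bot (γ : Γ.el) : fn C (pair γ (bar (VEnd.const 0))) = bot (Arr A B)
  cons (γ : Γ.el) (k : ℕ) (d : VEnd) : fn C (pair γ (bar (VEnd.delay k d))) =
    cons k (fn (MonoidalClosed.curry F) (pair (fn (arrAlg A B) (fn C (pair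
      (Γ.act (VEnd.add k) γ) (bar d)))) (Γ.act (VEnd.add k) γ)))

/-- The map whose fixed point is the recursive definition by `F`. -/
def recStep (F : A ⊗ (Arr A B ⊗ Γ) ⟶ Lift B) : Γ ⊗ Lift (Arr A B) ⟶ Lift (Arr A B) :=
  Γ ◁ arrAlg A B ≫ (lift (snd _ _) (fst _ _) ≫ MonoidalClosed.curry F) ≫ eta (Arr A B)

theorem isRecChain_iff {F : A ⊗ (Arr A B ⊗ Γ) ⟶ Lift B} {C : Γ ⊗ VBar ⟶ Lift (Arr A B)} :
    IsRecChain F C ↔ IsApChain (recStep F) C :=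
  ⟨fun h => ⟨h.bot, h.cons⟩, fun h => ⟨h.bot, h.cons⟩⟩

theorem exists_isRecChain (h : lifting.IsComplete (Lift (Arr A B)))
    (F : A ⊗ (Arr A B ⊗ Γ) ⟶ Lift B) :
    ∃ C, IsRecChain F C ∧ ∀ γ, fn (lifting.recMap h F) γ =
      fn (arrAlg A B) (fn C (pair γ (bar (VEnd.const ⊤)))) := by
  obtain ⟨C, hC, hC'⟩ := exists_isApChain h (recStep F)
  exact ⟨C, isRecChain_iff.mpr hC, fun γ => congrArg (fn (arrAlg A B)) (hC' γ)⟩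

/-- The fixed point equation for recursive definitions. -/
theorem fn_recMap (h : lifting.IsComplete (Lift (Arr A B))) (F : A ⊗ (Arr A B ⊗ Γ) ⟶ Lift B)
    (γ : Γ.el) :
    fn (lifting.recMap h F) γ =
      fn (MonoidalClosed.curry F) (pair (fn (lifting.recMap h F) γ : (Arr A B).el) γ) := by
  obtain ⟨C, hC, hC'⟩ := exists_isRecChain h F
  -- the constant map `∞` is its own successor
  have h1 := hC.cons γ 0 (VEnd.const ⊤)
  rw [VEnd.delay_zero_const, VEnd.add_zero_eq, act_one, ← hC' γ] at h1
  have h2 : fn C (pair γ (bar (VEnd.const ⊤))) =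
    cons 0 (fn (MonoidalClosed.curry F) (pair (fn (lifting.recMap h F) γ : (Arr A B).el) γ)) := h1
  conv_lhs => rw [hC' γ, h2]
  exact arrAlg_cons_zero _

/-- Recursive definitions are natural in the parameters. -/
theorem comp_recMap (h : lifting.IsComplete (Lift (Arr A B))) (F : A ⊗ (Arr A B ⊗ Γ) ⟶ Lift B)
    {Γ' : VSet} (ρ : Γ' ⟶ Γ) :
    lifting.recMap h (A ◁ Arr A B ◁ ρ ≫ F) = ρ ≫ lifting.recMap h F := by
  obtain ⟨C, hC, hC'⟩ := exists_isRecChain h F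
  obtain ⟨D, hD, hD'⟩ := exists_isRecChain h (A ◁ Arr A B ◁ ρ ≫ F)
  have hρ : IsRecChain (A ◁ Arr A B ◁ ρ ≫ F) (ρ ▷ VBar ≫ C) := by
    refine ⟨fun γ => hC.bot (fn ρ γ), fun γ k d => ?_⟩
    rw [MonoidalClosed.curry_natural_left]
    refine (hC.cons (fn ρ γ) k d).trans ?_
    rw [← fn_act]
    rfl
  have hCD : D = ρ ▷ VBar ≫ C :=
    (isRecChain_iff.mp hD).unique (isComplete_iff.mp h) (isRecChain_iff.mp hρ)
  refine VSet.hom_ext fun γ => ?_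
  rw [hD' γ, hCD, fn_comp ρ]
  exact (hC' (fn ρ γ)).symm

/-! ### Case distinction and sequencing on elements -/

theorem fn_caseMap_inl {A B X : VSet} (w : Γ ⟶ Coprod A B) (t : A ⊗ Γ ⟶ X) (u : B ⊗ Γ ⟶ X)
    (γ : Γ.el) (a : A.el) (h : fn w γ = inl a) : fn (PCFv.caseMap w t u) γ = fn t (pair a γ) := by
  change fn (MonoidalClosed.uncurry _) (pair γ (fn w γ)) = _
  rw [h, ev_uncurry]
  exact ev_curry (lift (snd Γ A) (fst Γ A) ≫ t) γ a

theorem fn_caseMap_inr {A B X : VSet} (w : Γ ⟶ Coprod A B) (t : A ⊗ Γ ⟶ X) (u : B ⊗ Γ ⟶ X)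
    (γ : Γ.el) (b : B.el) (h : fn w γ = inr b) : fn (PCFv.caseMap w t u) γ = fn u (pair b γ) := by
  change fn (MonoidalClosed.uncurry _) (pair γ (fn w γ)) = _
  rw [h, ev_uncurry]
  exact ev_curry (lift (snd Γ B) (fst Γ B) ≫ u) γ b

theorem comp_caseMap {Γ' A B X : VSet} (ρ : Γ' ⟶ Γ) (w : Γ ⟶ Coprod A B) (t : A ⊗ Γ ⟶ X)
    (u : B ⊗ Γ ⟶ X) :
    ρ ≫ PCFv.caseMap w t u = PCFv.caseMap (ρ ≫ w) (A ◁ ρ ≫ t) (B ◁ ρ ≫ u) := by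
  refine VSet.hom_ext fun γ => ?_
  rcases coprod_cases (fn w (fn ρ γ)) with ⟨a, ha⟩ | ⟨b, hb⟩
  · rw [fn_comp, fn_caseMap_inl w t u _ a ha, fn_caseMap_inl (ρ ≫ w) _ _ γ a ha]; rfl
  · rw [fn_comp, fn_caseMap_inr w t u _ b hb, fn_caseMap_inr (ρ ≫ w) _ _ γ b hb]; rfl

theorem fn_bind_cons (f : Γ ⟶ Lift A) (g : A ⊗ Γ ⟶ Lift B) (γ : Γ.el) (n : ℕ) (a : A.el)
    (h : fn f γ = cons n a) :
    fn (lifting.bind f g) γ = fn (mu B) (cons n (fn g (pair a (Γ.act (VEnd.add n) γ)))) := by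
  change fn (str Γ A ≫ lifting.L.map (lift (snd _ _) (fst _ _) ≫ g) ≫ mu B) (pair γ (fn f γ)) = _
  rw [h]; rfl

theorem fn_bind_bot (f : Γ ⟶ Lift A) (g : A ⊗ Γ ⟶ Lift B) (γ : Γ.el) (h : fn f γ = bot A) :
    fn (lifting.bind f g) γ = bot B := by
  change fn (str Γ A ≫ lifting.L.map (lift (snd _ _) (fst _ _) ≫ g) ≫ mu B) (pair γ (fn f γ)) = _
  rw [h]; rfl

theorem comp_bind {Γ' : VSet} (ρ : Γ' ⟶ Γ) (f : Γ ⟶ Lift A) (g : A ⊗ Γ ⟶ Lift B) :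
    ρ ≫ lifting.bind f g = lifting.bind (ρ ≫ f) (A ◁ ρ ≫ g) := by
  refine VSet.hom_ext fun γ => ?_
  rcases liftObj_cases (fn f (fn ρ γ)) with h | ⟨n, a, h⟩
  · rw [fn_comp, fn_bind_bot f g _ h, fn_bind_bot (ρ ≫ f) _ γ h]
  · rw [fn_comp, fn_bind_cons f g _ n a h, fn_bind_cons (ρ ≫ f) _ γ n a h, ← fn_act]; rfl

end VSet

/-! ### Renaming and substitution in the syntax -/

namespace PCFv

open VSet

theorem Ren.lift_lift {Γ Δ Θ : Ctx} {σ : Ty} (r : Ren Γ Δ) (r' : Ren Δ Θ) :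
    (fun τ x => (r'.lift (σ := σ)) τ (r.lift τ x)) = Ren.lift fun τ x => r' τ (r τ x) := by
  funext τ x; cases x <;> rfl

mutual

theorem Val.rename_rename : {Γ Δ Θ : Ctx} → {τ : Ty} → (v : Val Γ τ) → (r : Ren Γ Δ) →
    (r' : Ren Δ Θ) → (v.rename r).rename r' = v.rename fun τ x => r' τ (r τ x)
  | _, _, _, _, .var _, _, _ => rfl
  | _, _, _, _, .star, _, _ => rfl
  | _, _, _, _, .inl v, r, r' => by simp only [Val.rename, v.rename_rename r r']
  | _, _, _, _, .inr v, r, r' => by simp only [Val.rename, v.rename_rename r r']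
  | _, _, _, _, .pair v w, r, r' => by
      simp only [Val.rename, v.rename_rename r r', w.rename_rename r r']
  | _, _, _, _, .zero, _, _ => rfl
  | _, _, _, _, .succ v, r, r' => by simp only [Val.rename, v.rename_rename r r']
  | _, _, _, _, .lam t, r, r' => by
      simp only [Val.rename, t.rename_rename r.lift r'.lift, Ren.lift_lift]
  | _, _, _, _, .recFun t, r, r' => by
      simp only [Val.rename, t.rename_rename r.lift.lift r'.lift.lift, Ren.lift_lift]

theorem Comp.rename_rename : {Γ Δ Θ : Ctx} → {τ : Ty} → (t : Comp Γ τ) → (r : Ren Γ Δ) →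
    (r' : Ren Δ Θ) → (t.rename r).rename r' = t.rename fun τ x => r' τ (r τ x)
  | _, _, _, _, .caseEmpty v, r, r' => by simp only [Comp.rename, v.rename_rename r r']
  | _, _, _, _, .ret v, r, r' => by simp only [Comp.rename, v.rename_rename r r']
  | _, _, _, _, .caseSum v t u, r, r' => by
      simp only [Comp.rename, v.rename_rename r r', t.rename_rename r.lift r'.lift,
        u.rename_rename r.lift r'.lift, Ren.lift_lift]
  | _, _, _, _, .fst v, r, r' => by simp only [Comp.rename, v.rename_rename r r']
  | _, _, _, _, .snd v, r, r' => by simp only [Comp.rename, v.rename_rename r r']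
  | _, _, _, _, .app v w, r, r' => by
      simp only [Comp.rename, v.rename_rename r r', w.rename_rename r r']
  | _, _, _, _, .caseNat v t u, r, r' => by
      simp only [Comp.rename, v.rename_rename r r', t.rename_rename r r',
        u.rename_rename r.lift r'.lift, Ren.lift_lift]
  | _, _, _, _, .letIn t u, r, r' => by
      simp only [Comp.rename, t.rename_rename r r', u.rename_rename r.lift r'.lift, Ren.lift_lift]

end

theorem Sub.lift_comp_ren {Γ Δ Θ : Ctx} {σ : Ty} (r : Ren Γ Δ) (s : Sub Δ Θ) :
    (fun τ x => (s.lift (σ := σ)) τ (r.lift τ x)) = Sub.lift fun τ x => s τ (r τ x) := by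
  funext τ x; cases x <;> rfl

mutual

theorem Val.subst_rename : {Γ Δ Θ : Ctx} → {τ : Ty} → (v : Val Γ τ) → (r : Ren Γ Δ) →
    (s : Sub Δ Θ) → (v.rename r).subst s = v.subst fun τ x => s τ (r τ x)
  | _, _, _, _, .var _, _, _ => rfl
  | _, _, _, _, .star, _, _ => rfl
  | _, _, _, _, .inl v, r, s => by simp only [Val.rename, Val.subst, v.subst_rename r s]
  | _, _, _, _, .inr v, r, s => by simp only [Val.rename, Val.subst, v.subst_rename r s]
  | _, _, _, _, .pair v w, r, s => by
      simp only [Val.rename, Val.subst, v.subst_rename r s, w.subst_rename r s]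
  | _, _, _, _, .zero, _, _ => rfl
  | _, _, _, _, .succ v, r, s => by simp only [Val.rename, Val.subst, v.subst_rename r s]
  | _, _, _, _, .lam t, r, s => by
      simp only [Val.rename, Val.subst, t.subst_rename r.lift s.lift, Sub.lift_comp_ren]
  | _, _, _, _, .recFun t, r, s => by
      simp only [Val.rename, Val.subst, t.subst_rename r.lift.lift s.lift.lift, Sub.lift_comp_ren]

theorem Comp.subst_rename : {Γ Δ Θ : Ctx} → {τ : Ty} → (t : Comp Γ τ) → (r : Ren Γ Δ) →
    (s : Sub Δ Θ) → (t.rename r).subst s = t.subst fun τ x => s τ (r τ x)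
  | _, _, _, _, .caseEmpty v, r, s => by simp only [Comp.rename, Comp.subst, v.subst_rename r s]
  | _, _, _, _, .ret v, r, s => by simp only [Comp.rename, Comp.subst, v.subst_rename r s]
  | _, _, _, _, .caseSum v t u, r, s => by
      simp only [Comp.rename, Comp.subst, v.subst_rename r s, t.subst_rename r.lift s.lift,
        u.subst_rename r.lift s.lift, Sub.lift_comp_ren]
  | _, _, _, _, .fst v, r, s => by simp only [Comp.rename, Comp.subst, v.subst_rename r s]
  | _, _, _, _, .snd v, r, s => by simp only [Comp.rename, Comp.subst, v.subst_rename r s]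
  | _, _, _, _, .app v w, r, s => by
      simp only [Comp.rename, Comp.subst, v.subst_rename r s, w.subst_rename r s]
  | _, _, _, _, .caseNat v t u, r, s => by
      simp only [Comp.rename, Comp.subst, v.subst_rename r s, t.subst_rename r s,
        u.subst_rename r.lift s.lift, Sub.lift_comp_ren]
  | _, _, _, _, .letIn t u, r, s => by
      simp only [Comp.rename, Comp.subst, t.subst_rename r s, u.subst_rename r.lift s.lift,
        Sub.lift_comp_ren]

end

theorem Sub.lift_rename {Γ Δ Θ : Ctx} {σ : Ty} (s : Sub Γ Δ) (r : Ren Δ Θ) :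
    (fun τ x => ((s.lift (σ := σ)) τ x).rename r.lift) =
      Sub.lift fun τ x => (s τ x).rename r := by
  funext τ x
  cases x with
  | here => rfl
  | there x =>
    change ((s τ x).rename _).rename _ = ((s τ x).rename r).rename _
    rw [Val.rename_rename, Val.rename_rename]
    rfl

mutual

theorem Val.rename_subst : {Γ Δ Θ : Ctx} → {τ : Ty} → (v : Val Γ τ) → (s : Sub Γ Δ) →
    (r : Ren Δ Θ) → (v.subst s).rename r = v.subst fun τ x => (s τ x).rename r
  | _, _, _, _, .var _, _, _ => rfl
  | _, _, _, _, .star, _, _ => rfl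
  | _, _, _, _, .inl v, s, r => by simp only [Val.rename, Val.subst, v.rename_subst s r]
  | _, _, _, _, .inr v, s, r => by simp only [Val.rename, Val.subst, v.rename_subst s r]
  | _, _, _, _, .pair v w, s, r => by
      simp only [Val.rename, Val.subst, v.rename_subst s r, w.rename_subst s r]
  | _, _, _, _, .zero, _, _ => rfl
  | _, _, _, _, .succ v, s, r => by simp only [Val.rename, Val.subst, v.rename_subst s r]
  | _, _, _, _, .lam t, s, r => by
      simp only [Val.rename, Val.subst, t.rename_subst s.lift r.lift, Sub.lift_rename]
  | _, _, _, _, .recFun t, s, r => by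
      simp only [Val.rename, Val.subst, t.rename_subst s.lift.lift r.lift.lift, Sub.lift_rename]

theorem Comp.rename_subst : {Γ Δ Θ : Ctx} → {τ : Ty} → (t : Comp Γ τ) → (s : Sub Γ Δ) →
    (r : Ren Δ Θ) → (t.subst s).rename r = t.subst fun τ x => (s τ x).rename r
  | _, _, _, _, .caseEmpty v, s, r => by simp only [Comp.rename, Comp.subst, v.rename_subst s r]
  | _, _, _, _, .ret v, s, r => by simp only [Comp.rename, Comp.subst, v.rename_subst s r]
  | _, _, _, _, .caseSum v t u, s, r => by
      simp only [Comp.rename, Comp.subst, v.rename_subst s r, t.rename_subst s.lift r.lift,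
        u.rename_subst s.lift r.lift, Sub.lift_rename]
  | _, _, _, _, .fst v, s, r => by simp only [Comp.rename, Comp.subst, v.rename_subst s r]
  | _, _, _, _, .snd v, s, r => by simp only [Comp.rename, Comp.subst, v.rename_subst s r]
  | _, _, _, _, .app v w, s, r => by
      simp only [Comp.rename, Comp.subst, v.rename_subst s r, w.rename_subst s r]
  | _, _, _, _, .caseNat v t u, s, r => by
      simp only [Comp.rename, Comp.subst, v.rename_subst s r, t.rename_subst s r,
        u.rename_subst s.lift r.lift, Sub.lift_rename]
  | _, _, _, _, .letIn t u, s, r => by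
      simp only [Comp.rename, Comp.subst, t.rename_subst s r, u.rename_subst s.lift r.lift,
        Sub.lift_rename]

end

theorem Sub.lift_subst {Γ Δ Θ : Ctx} {σ : Ty} (s : Sub Γ Δ) (s' : Sub Δ Θ) :
    (fun τ x => ((s.lift (σ := σ)) τ x).subst s'.lift) =
      Sub.lift fun τ x => (s τ x).subst s' := by
  funext τ x
  cases x with
  | here => rfl
  | there x =>
    change ((s τ x).rename _).subst _ = ((s τ x).subst s').rename _
    rw [Val.subst_rename, Val.rename_subst]
    rfl

mutual

theorem Val.subst_subst : {Γ Δ Θ : Ctx} → {τ : Ty} → (v : Val Γ τ) → (s : Sub Γ Δ) →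
    (s' : Sub Δ Θ) → (v.subst s).subst s' = v.subst fun τ x => (s τ x).subst s'
  | _, _, _, _, .var _, _, _ => rfl
  | _, _, _, _, .star, _, _ => rfl
  | _, _, _, _, .inl v, s, s' => by simp only [Val.subst, v.subst_subst s s']
  | _, _, _, _, .inr v, s, s' => by simp only [Val.subst, v.subst_subst s s']
  | _, _, _, _, .pair v w, s, s' => by
      simp only [Val.subst, v.subst_subst s s', w.subst_subst s s']
  | _, _, _, _, .zero, _, _ => rfl
  | _, _, _, _, .succ v, s, s' => by simp only [Val.subst, v.subst_subst s s']
  | _, _, _, _, .lam t, s, s' => by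
      simp only [Val.subst, t.subst_subst s.lift s'.lift, Sub.lift_subst]
  | _, _, _, _, .recFun t, s, s' => by
      simp only [Val.subst, t.subst_subst s.lift.lift s'.lift.lift, Sub.lift_subst]

theorem Comp.subst_subst : {Γ Δ Θ : Ctx} → {τ : Ty} → (t : Comp Γ τ) → (s : Sub Γ Δ) →
    (s' : Sub Δ Θ) → (t.subst s).subst s' = t.subst fun τ x => (s τ x).subst s'
  | _, _, _, _, .caseEmpty v, s, s' => by simp only [Comp.subst, v.subst_subst s s']
  | _, _, _, _, .ret v, s, s' => by simp only [Comp.subst, v.subst_subst s s']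
  | _, _, _, _, .caseSum v t u, s, s' => by
      simp only [Comp.subst, v.subst_subst s s', t.subst_subst s.lift s'.lift,
        u.subst_subst s.lift s'.lift, Sub.lift_subst]
  | _, _, _, _, .fst v, s, s' => by simp only [Comp.subst, v.subst_subst s s']
  | _, _, _, _, .snd v, s, s' => by simp only [Comp.subst, v.subst_subst s s']
  | _, _, _, _, .app v w, s, s' => by
      simp only [Comp.subst, v.subst_subst s s', w.subst_subst s s']
  | _, _, _, _, .caseNat v t u, s, s' => by
      simp only [Comp.subst, v.subst_subst s s', t.subst_subst s s',
        u.subst_subst s.lift s'.lift, Sub.lift_subst]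
  | _, _, _, _, .letIn t u, s, s' => by
      simp only [Comp.subst, t.subst_subst s s', u.subst_subst s.lift s'.lift, Sub.lift_subst]

end

theorem Sub.lift_ids {Γ : Ctx} {σ : Ty} : (Sub.ids Γ).lift (σ := σ) = Sub.ids (σ :: Γ) := by
  funext τ x; cases x <;> rfl

mutual

theorem Val.subst_ids : {Γ : Ctx} → {τ : Ty} → (v : Val Γ τ) → v.subst (.ids Γ) = v
  | _, _, .var _ => rfl
  | _, _, .star => rfl
  | _, _, .inl v => by simp only [Val.subst, v.subst_ids]
  | _, _, .inr v => by simp only [Val.subst, v.subst_ids]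
  | _, _, .pair v w => by simp only [Val.subst, v.subst_ids, w.subst_ids]
  | _, _, .zero => rfl
  | _, _, .succ v => by simp only [Val.subst, v.subst_ids]
  | _, _, .lam t => by simp only [Val.subst, Sub.lift_ids, t.subst_ids]
  | _, _, .recFun t => by simp only [Val.subst, Sub.lift_ids, t.subst_ids]

theorem Comp.subst_ids : {Γ : Ctx} → {τ : Ty} → (t : Comp Γ τ) → t.subst (.ids Γ) = t
  | _, _, .caseEmpty v => by simp only [Comp.subst, v.subst_ids]
  | _, _, .ret v => by simp only [Comp.subst, v.subst_ids]
  | _, _, .caseSum v t u => by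
      simp only [Comp.subst, Sub.lift_ids, v.subst_ids, t.subst_ids, u.subst_ids]
  | _, _, .fst v => by simp only [Comp.subst, v.subst_ids]
  | _, _, .snd v => by simp only [Comp.subst, v.subst_ids]
  | _, _, .app v w => by simp only [Comp.subst, v.subst_ids, w.subst_ids]
  | _, _, .caseNat v t u => by
      simp only [Comp.subst, Sub.lift_ids, v.subst_ids, t.subst_ids, u.subst_ids]
  | _, _, .letIn t u => by simp only [Comp.subst, Sub.lift_ids, t.subst_ids, u.subst_ids]

end

/-- Substitution under a binder, followed by the instantiation of the bound variable. -/
theorem Sub.lift_subst_cons {Γ Δ Θ : Ctx} {σ : Ty} (s : Sub Γ Δ) (w : Val Θ σ) (s' : Sub Δ Θ) :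
    (fun τ x => (s.lift τ x).subst (Sub.cons w s')) = Sub.cons w fun τ x => (s τ x).subst s' := by
  funext τ x
  cases x with
  | here => rfl
  | there x => exact (s τ x).subst_rename _ _

theorem Sub.subst_ids {Γ Δ : Ctx} (s : Sub Γ Δ) : (fun τ x => (s τ x).subst (Sub.ids Δ)) = s := by
  funext τ x; exact (s τ x).subst_ids

theorem Comp.inst_subst_lift {Γ Δ : Ctx} {σ τ : Ty} (t : Comp (σ :: Γ) τ) (s : Sub Γ Δ)
    (w : Val Δ σ) : (t.subst s.lift).inst w = t.subst (.cons w s) := by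
  rw [Comp.inst, Comp.subst_subst, Sub.lift_subst_cons, Sub.subst_ids]

theorem Comp.inst2_subst_lift {Γ Δ : Ctx} {σ σ' τ : Ty} (t : Comp (σ :: σ' :: Γ) τ) (s : Sub Γ Δ)
    (v : Val Δ σ) (w : Val Δ σ') :
    (t.subst s.lift.lift).inst2 v w = t.subst (.cons v (.cons w s)) := by
  rw [Comp.inst2, Comp.subst_subst, Sub.lift_subst_cons, Sub.lift_subst_cons, Sub.subst_ids]

/-! ### Substitution in the semantics -/

/-- The map `ρ` interprets the renaming `r`. -/
def Ren.Represents {Γ Δ : Ctx} (r : Ren Γ Δ) (ρ : Ctx.den Δ ⟶ Ctx.den Γ) : Prop :=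
  ∀ τ (x : Var Γ τ), (r τ x).den = ρ ≫ x.den

theorem Ren.Represents.lift {Γ Δ : Ctx} {r : Ren Γ Δ} {ρ : Ctx.den Δ ⟶ Ctx.den Γ}
    (h : r.Represents ρ) {σ : Ty} : (r.lift (σ := σ)).Represents (σ.den ◁ ρ) := by
  rintro τ (_ | x)
  · rfl
  · exact congrArg (CartesianMonoidalCategory.snd σ.den _ ≫ ·) (h τ x)

theorem comp_curry {Γ Γ' A Y : VSet} (ρ : Γ' ⟶ Γ) (f : A ⊗ Γ ⟶ Y) :
    MonoidalClosed.curry (A ◁ ρ ≫ f) = ρ ≫ MonoidalClosed.curry f :=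
  MonoidalClosed.curry_natural_left _ _

variable (h : TypesComplete)

mutual

theorem Val.den_rename : {Γ Δ : Ctx} → {τ : Ty} → (v : Val Γ τ) → {r : Ren Γ Δ} →
    {ρ : Ctx.den Δ ⟶ Ctx.den Γ} → r.Represents ρ → (v.rename r).den h = ρ ≫ v.den h
  | _, _, _, .var x, _, _, hr => hr _ x
  | _, _, _, .star, _, _, _ => rfl
  | _, _, _, .inl v, _, _, hr => congrArg (· ≫ _) (v.den_rename hr)
  | _, _, _, .inr v, _, _, hr => congrArg (· ≫ _) (v.den_rename hr)
  | _, _, _, .pair v w, _, _, hr =>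
      (congrArg₂ lift (v.den_rename hr) (w.den_rename hr)).trans (comp_lift _ _ _).symm
  | _, _, _, .zero, _, _, _ => rfl
  | _, _, _, .succ v, _, _, hr => congrArg (· ≫ _) (v.den_rename hr)
  | _, _, _, .lam t, _, ρ, hr =>
      (congrArg MonoidalClosed.curry (t.den_rename hr.lift)).trans (comp_curry ρ (t.den h))
  | _, _, _, .recFun (σ := σ) (τ := τ) t, _, ρ, hr =>
      (congrArg (lifting.recMap (h (.arrow σ τ))) (t.den_rename hr.lift.lift)).trans
        (comp_recMap (h (.arrow σ τ)) (t.den h) ρ)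

theorem Comp.den_rename : {Γ Δ : Ctx} → {τ : Ty} → (t : Comp Γ τ) → {r : Ren Γ Δ} →
    {ρ : Ctx.den Δ ⟶ Ctx.den Γ} → r.Represents ρ → (t.rename r).den h = ρ ≫ t.den h
  | _, _, _, .caseEmpty v, _, _, hr => congrArg (· ≫ _) (v.den_rename hr)
  | _, _, _, .ret v, _, _, hr => congrArg (· ≫ _) (v.den_rename hr)
  | _, _, _, .caseSum v t u, _, ρ, hr => by
      simp only [Comp.rename, Comp.den]
      rw [v.den_rename hr, t.den_rename hr.lift, u.den_rename hr.lift]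
      exact (comp_caseMap ρ (v.den h) (t.den h) (u.den h)).symm
  | _, _, _, .fst v, _, _, hr => congrArg (· ≫ _) (v.den_rename hr)
  | _, _, _, .snd v, _, _, hr => congrArg (· ≫ _) (v.den_rename hr)
  | _, _, _, .app v w, _, _, hr =>
      congrArg (· ≫ _) ((congrArg₂ lift (w.den_rename hr) (v.den_rename hr)).trans
        (comp_lift _ _ _).symm)
  | _, _, _, .caseNat v t u, _, ρ, hr => by
      simp only [Comp.rename, Comp.den]
      rw [v.den_rename hr, t.den_rename hr, u.den_rename hr.lift]
      exact (comp_caseMap ρ (v.den h ≫ natCases) (CartesianMonoidalCategory.snd _ _ ≫ t.den h)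
        (u.den h)).symm
  | _, _, _, .letIn t u, _, ρ, hr => by
      simp only [Comp.rename, Comp.den]
      rw [t.den_rename hr, u.den_rename hr.lift]
      exact (comp_bind ρ (t.den h) (u.den h)).symm

end

/-- The map `ρ` interprets the substitution `s`. -/
def Sub.Represents {Γ Δ : Ctx} (s : Sub Γ Δ) (ρ : Ctx.den Δ ⟶ Ctx.den Γ) : Prop :=
  ∀ τ (x : Var Γ τ), (s τ x).den h = ρ ≫ x.den

variable {h}

theorem Sub.Represents.lift {Γ Δ : Ctx} {s : Sub Γ Δ} {ρ : Ctx.den Δ ⟶ Ctx.den Γ}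
    (hs : s.Represents h ρ) {σ : Ty} : (s.lift (σ := σ)).Represents h (σ.den ◁ ρ) := by
  rintro τ (_ | x)
  · rfl
  · exact ((s τ x).den_rename h (ρ := CartesianMonoidalCategory.snd σ.den _) fun _ _ => rfl).trans
      (congrArg (CartesianMonoidalCategory.snd σ.den _ ≫ ·) (hs τ x))

variable (h)

mutual

theorem Val.den_subst : {Γ Δ : Ctx} → {τ : Ty} → (v : Val Γ τ) → {s : Sub Γ Δ} →
    {ρ : Ctx.den Δ ⟶ Ctx.den Γ} → s.Represents h ρ → (v.subst s).den h = ρ ≫ v.den h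
  | _, _, _, .var x, _, _, hs => hs _ x
  | _, _, _, .star, _, _, _ => rfl
  | _, _, _, .inl v, _, _, hs => congrArg (· ≫ _) (v.den_subst hs)
  | _, _, _, .inr v, _, _, hs => congrArg (· ≫ _) (v.den_subst hs)
  | _, _, _, .pair v w, _, _, hs =>
      (congrArg₂ lift (v.den_subst hs) (w.den_subst hs)).trans (comp_lift _ _ _).symm
  | _, _, _, .zero, _, _, _ => rfl
  | _, _, _, .succ v, _, _, hs => congrArg (· ≫ _) (v.den_subst hs)
  | _, _, _, .lam t, _, ρ, hs =>
      (congrArg MonoidalClosed.curry (t.den_subst hs.lift)).trans (comp_curry ρ (t.den h))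
  | _, _, _, .recFun (σ := σ) (τ := τ) t, _, ρ, hs =>
      (congrArg (lifting.recMap (h (.arrow σ τ))) (t.den_subst hs.lift.lift)).trans
        (comp_recMap (h (.arrow σ τ)) (t.den h) ρ)

theorem Comp.den_subst : {Γ Δ : Ctx} → {τ : Ty} → (t : Comp Γ τ) → {s : Sub Γ Δ} →
    {ρ : Ctx.den Δ ⟶ Ctx.den Γ} → s.Represents h ρ → (t.subst s).den h = ρ ≫ t.den h
  | _, _, _, .caseEmpty v, _, _, hs => congrArg (· ≫ _) (v.den_subst hs)
  | _, _, _, .ret v, _, _, hs => congrArg (· ≫ _) (v.den_subst hs)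
  | _, _, _, .caseSum v t u, _, ρ, hs => by
      simp only [Comp.subst, Comp.den]
      rw [v.den_subst hs, t.den_subst hs.lift, u.den_subst hs.lift]
      exact (comp_caseMap ρ (v.den h) (t.den h) (u.den h)).symm
  | _, _, _, .fst v, _, _, hs => congrArg (· ≫ _) (v.den_subst hs)
  | _, _, _, .snd v, _, _, hs => congrArg (· ≫ _) (v.den_subst hs)
  | _, _, _, .app v w, _, _, hs =>
      congrArg (· ≫ _) ((congrArg₂ lift (w.den_subst hs) (v.den_subst hs)).trans
        (comp_lift _ _ _).symm)
  | _, _, _, .caseNat v t u, _, ρ, hs => by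
      simp only [Comp.subst, Comp.den]
      rw [v.den_subst hs, t.den_subst hs, u.den_subst hs.lift]
      exact (comp_caseMap ρ (v.den h ≫ natCases) (CartesianMonoidalCategory.snd _ _ ≫ t.den h)
        (u.den h)).symm
  | _, _, _, .letIn t u, _, ρ, hs => by
      simp only [Comp.subst, Comp.den]
      rw [t.den_subst hs, u.den_subst hs.lift]
      exact (comp_bind ρ (t.den h) (u.den h)).symm

end

theorem Sub.represents_ids (Γ : Ctx) : (Sub.ids Γ).Represents h (𝟙 _) :=
  fun _ _ => (Category.id_comp _).symm

variable {h}

theorem Sub.Represents.cons {Γ Δ : Ctx} {s : Sub Γ Δ} {ρ : Ctx.den Δ ⟶ Ctx.den Γ}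
    (hs : s.Represents h ρ) {σ : Ty} (v : Val Δ σ) :
    (Sub.cons v s).Represents h (CartesianMonoidalCategory.lift (v.den h) ρ) := by
  rintro τ (_ | x)
  · exact (lift_fst _ _).symm
  · refine (hs τ x).trans ?_
    change _ = CartesianMonoidalCategory.lift (v.den h) ρ ≫ snd _ _ ≫ x.den
    rw [lift_snd_assoc]

variable (h)

/-- The substitution lemma for one variable. -/
theorem Comp.fn_den_inst {Γ : Ctx} {σ τ : Ty} (t : Comp (σ :: Γ) τ) (v : Val Γ σ)
    (γ : (Ctx.den Γ).el) :
    fn ((t.inst v).den h) γ = fn (t.den h) (VSet.pair (fn (v.den h) γ) γ) :=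
  congrArg (fun f => fn f γ) (t.den_subst h ((Sub.represents_ids h Γ).cons v))

/-- The substitution lemma for two variables. -/
theorem Comp.fn_den_inst2 {Γ : Ctx} {σ σ' τ : Ty} (t : Comp (σ :: σ' :: Γ) τ) (v : Val Γ σ)
    (w : Val Γ σ') (γ : (Ctx.den Γ).el) :
    fn ((t.inst2 v w).den h) γ =
      fn (t.den h) (VSet.pair (fn (v.den h) γ) (VSet.pair (fn (w.den h) γ) γ)) :=
  congrArg (fun f => fn f γ) (t.den_subst h (((Sub.represents_ids h Γ).cons w).cons v))

/-- The interpretation of a recursive function unfolds, by the fixed point equation. -/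
theorem Val.ev_den_recFun {Γ : Ctx} {σ τ : Ty} (t : Comp (σ :: .arrow σ τ :: Γ) τ) (a : σ.den.el)
    (γ : (Ctx.den Γ).el) :
    ev a (fn ((Val.recFun t).den h) γ : (Arr σ.den τ.den).el) =
      fn (t.den h) (VSet.pair a (VSet.pair (fn ((Val.recFun t).den h) γ) γ)) := by
  have h1 := fn_recMap (h (.arrow σ τ)) (t.den h) γ
  exact (congrArg (ev a) h1).trans (ev_curry (t.den h) a _)

theorem Val.ev_den_lam {Γ : Ctx} {σ τ : Ty} (t : Comp (σ :: Γ) τ) (a : σ.den.el)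
    (γ : (Ctx.den Γ).el) :
    ev a (fn ((Val.lam t).den h) γ : (Arr σ.den τ.den).el) = fn (t.den h) (VSet.pair a γ) :=
  ev_curry (t.den h) a γ

/-- Soundness, on elements. -/
theorem BigStep.fn_den {τ : Ty} {t : Comp [] τ} {v : Val [] τ} (hb : BigStep t v) :
    fn (t.den h) pt = VSet.cons 0 (fn (v.den h) pt) := by
  induction hb with
  | ret v => rfl
  | fst v w => rfl
  | snd v w => rfl
  | caseInl _ ih =>
    exact (fn_caseMap_inl _ _ _ _ _ rfl).trans ((Comp.fn_den_inst h (Γ := []) _ _ pt).symm.trans ih)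
  | caseInr _ ih =>
    exact (fn_caseMap_inr _ _ _ _ _ rfl).trans ((Comp.fn_den_inst h (Γ := []) _ _ pt).symm.trans ih)
  | appRec _ ih =>
    exact (Val.ev_den_recFun h _ _ _).trans ((Comp.fn_den_inst2 h (Γ := []) _ _ _ pt).symm.trans ih)
  | appLam _ ih =>
    exact (Val.ev_den_lam h _ _ _).trans ((Comp.fn_den_inst h (Γ := []) _ _ pt).symm.trans ih)
  | letIn _ _ ih1 ih2 =>
    exact (fn_bind_cons _ _ _ _ _ ih1).trans ((fn_mu_cons_zero _).trans
      ((Comp.fn_den_inst h (Γ := []) _ _ pt).symm.trans ih2))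
  | caseZero _ ih => exact (fn_caseMap_inl _ _ _ pt pt rfl).trans ih
  | caseSucc _ ih =>
    exact (fn_caseMap_inr _ _ _ _ _ rfl).trans ((Comp.fn_den_inst h (Γ := []) _ _ pt).symm.trans ih)

end PCFv

/-! ### The logical relation -/

namespace PCFv

open VSet

/-- Evaluation is deterministic. -/
theorem BigStep.unique {τ : Ty} {t : Comp [] τ} {v w : Val [] τ} (hv : BigStep t v)
    (hw : BigStep t w) : v = w := by
  induction hv with
  | ret v => cases hw; rfl
  | fst v w => cases hw; rfl
  | snd v w => cases hw; rfl
  | caseInl _ ih => cases hw with | caseInl h => exact ih h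
  | caseInr _ ih => cases hw with | caseInr h => exact ih h
  | appRec _ ih => cases hw with | appRec h => exact ih h
  | appLam _ ih => cases hw with | appLam h => exact ih h
  | letIn _ _ ih1 ih2 =>
    cases hw with
    | letIn h1 h2 =>
      obtain rfl := ih1 h1
      exact ih2 h2
  | caseZero _ ih => cases hw with | caseZero h => exact ih h
  | caseSucc _ ih => cases hw with | caseSucc h => exact ih h

/-- The global points of a presheaf, as the elements that are fixed by the action. -/
def IsPoint {X : VSet} (x : X.el) : Prop := ∀ e, X.act e x = x

theorem IsPoint.fn {X Y : VSet} {x : X.el} (hx : IsPoint x) (f : X ⟶ Y) : IsPoint (VSet.fn f x) :=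
  fun e => by rw [← fn_act, hx]

theorem IsPoint.pair {X Y : VSet} {x : X.el} {y : Y.el} (hx : IsPoint x) (hy : IsPoint y) :
    IsPoint (VSet.pair x y) := fun e => by rw [act_pair, hx, hy]

theorem IsPoint.of_inl {X Y : VSet} {x : X.el} (h : IsPoint (inl x : (Coprod X Y).el)) :
    IsPoint x := fun e => inl_injective (h e)

theorem IsPoint.of_inr {X Y : VSet} {y : Y.el} (h : IsPoint (inr y : (Coprod X Y).el)) :
    IsPoint y := fun e => inr_injective (h e)

theorem IsPoint.of_cons_zero {X : VSet} {x : X.el} (h : IsPoint (VSet.cons 0 x)) : IsPoint x :=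
  fun e => (cons_inj.mp ((act_cons_zero e x).symm.trans (h e))).2

/-- The closed value for a natural number. -/
def numeral : ℕ → Val [] .nat
  | 0 => .zero
  | n + 1 => .succ (numeral n)

/-- A relation between elements of `L X` and closed computations: if the chain starts with an
element of `X`, then the computation has a value related to that element. -/
def RelLift {X : VSet} {τ : Ty} (R : X.el → Val [] τ → Prop) (l : (Lift X).el) (t : Comp [] τ) :
    Prop := ∀ d, l = VSet.cons 0 d → ∃ u, BigStep t u ∧ R d u

/-- The logical relation between elements of the interpretation of a type and closed values. Only
global points are tested as arguments of functions. -/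
def Rel : (τ : Ty) → τ.den.el → Val [] τ → Prop
  | .empty, _, _ => False
  | .unit, _, _ => True
  | .nat, x, v => ∃ n, x = num n ∧ v = numeral n
  | .sum σ τ, z, v => (∃ x w, z = inl x ∧ v = .inl w ∧ Rel σ x w) ∨
      ∃ y w, z = inr y ∧ v = .inr w ∧ Rel τ y w
  | .prod σ τ, p, v => ∃ x y w w', p = VSet.pair x y ∧ v = .pair w w' ∧ Rel σ x w ∧ Rel τ y w'
  | .arrow σ τ, k, v => ∀ (a : σ.den.el) (w : Val [] σ), IsPoint a → Rel σ a w →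
      RelLift (Rel τ) (ev a (show (Arr σ.den τ.den).el from k)) (.app v w)

/-- A relation that passes from the finite stages of a chain to its limit. -/
def IsAdmissible {X : VSet} {τ : Ty} (R : X.el → Val [] τ → Prop) : Prop :=
  ∀ s v, (∀ j : ℕ, R (X.act (VEnd.const j) s) v) → R (X.act (VEnd.const ⊤) s) v

/-- The entry at the index `n + i` of the chain `s` preceded by `n` copies of `⊥`. -/
theorem act_const_cons {X : VSet} (n : ℕ) (i : ℕ∞) (s : X.el) :
    (Lift X).act (VEnd.const (n + i)) (VSet.cons n s) = VSet.cons 0 (X.act (VEnd.const i) s) := by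
  have hk : (VEnd.const (n + i)).Hits n 0 := hits_zero_iff.mpr le_self_add
  have hs : (VEnd.const (n + i)).shift n 0 = VEnd.const i := by
    ext j
    exact (ENat.addLECancellable_natCast n).add_tsub_cancel_left
  rw [act_cons hk, hs]

/-- If a chain in `L X` is defined at `∞`, it is `s` preceded by `n` copies of `⊥`. Its entries from
`n` on are related to the same value of `t`, so the limit of `s` is related to it, too. -/
theorem IsAdmissible.relLift {X : VSet} {τ : Ty} {R : X.el → Val [] τ → Prop} (hR : IsAdmissible R)
    (l : (Lift X).el) (t : Comp [] τ)
    (hl : ∀ j : ℕ, RelLift R ((Lift X).act (VEnd.const j) l) t) :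
    RelLift R ((Lift X).act (VEnd.const ⊤) l) t := by
  intro d hd
  rcases liftObj_cases l with rfl | ⟨n, s, rfl⟩
  · exact absurd hd.symm cons_ne_bot
  have hfin : ∀ j : ℕ, ∃ u, BigStep t u ∧ R (X.act (VEnd.const j) s) u := fun j =>
    hl (n + j) _ (by rw [Nat.cast_add]; exact act_const_cons n j s)
  have htop := act_const_cons n ⊤ s
  rw [add_top, hd, cons_inj] at htop
  obtain ⟨u, hu, -⟩ := hfin 0
  refine ⟨u, hu, htop.2 ▸ hR s u fun j => ?_⟩
  obtain ⟨u', hu', h⟩ := hfin j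
  rwa [hu.unique hu']

/-- The logical relation is admissible at all types. -/
theorem isAdmissible_rel (τ : Ty) : IsAdmissible (Rel τ) := by
  induction τ with
  | empty => exact fun s v h => h 0
  | unit => exact fun s v h => h 0
  | nat => exact fun s v h => h 0
  | sum σ τ hσ hτ =>
    intro s v h
    rcases coprod_cases s with ⟨x, rfl⟩ | ⟨y, rfl⟩
    · have key : ∀ j : ℕ, ∃ w, v = .inl w ∧ Rel σ (σ.den.act (VEnd.const j) x) w := by
        intro j
        rcases h j with ⟨x', w, hx, hv, hw⟩ | ⟨y', w, hy, -⟩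
        · obtain rfl := inl_injective hx
          exact ⟨w, hv, hw⟩
        · exact absurd hy inl_ne_inr
      obtain ⟨w, rfl, -⟩ := key 0
      refine Or.inl ⟨_, w, rfl, rfl, hσ x w fun j => ?_⟩
      obtain ⟨w', hw, h'⟩ := key j
      rwa [Val.inl.inj hw]
    · have key : ∀ j : ℕ, ∃ w, v = .inr w ∧ Rel τ (τ.den.act (VEnd.const j) y) w := by
        intro j
        rcases h j with ⟨x', w, hx, -⟩ | ⟨y', w, hy, hv, hw⟩
        · exact absurd hx.symm inl_ne_inr
        · obtain rfl := inr_injective hy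
          exact ⟨w, hv, hw⟩
      obtain ⟨w, rfl, -⟩ := key 0
      refine Or.inr ⟨_, w, rfl, rfl, hτ y w fun j => ?_⟩
      obtain ⟨w', hw, h'⟩ := key j
      rwa [Val.inr.inj hw]
  | prod σ τ hσ hτ =>
    intro s v h
    obtain ⟨x, y, rfl⟩ := exists_eq_pair s
    have key : ∀ j : ℕ, ∃ w w', v = .pair w w' ∧ Rel σ (σ.den.act (VEnd.const j) x) w ∧
        Rel τ (τ.den.act (VEnd.const j) y) w' := by
      intro j
      obtain ⟨x', y', w, w', hp, hv, hx, hy⟩ := h j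
      obtain ⟨rfl, rfl⟩ := pair_inj.mp hp
      exact ⟨w, w', hv, hx, hy⟩
    obtain ⟨w, w', rfl, -⟩ := key 0
    refine ⟨_, _, w, w', rfl, rfl, hσ x w fun j => ?_, hτ y w' fun j => ?_⟩
    · obtain ⟨u, u', hu, h1, -⟩ := key j
      rwa [(Val.pair.inj hu).1]
    · obtain ⟨u, u', hu, -, h2⟩ := key j
      rwa [(Val.pair.inj hu).2]
  | arrow σ τ _ hτ =>
    intro s v h a w ha hw
    have key : ∀ c, (Lift τ.den).act c (ev a (show (Arr σ.den τ.den).el from s)) =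
        ev a ((Arr σ.den τ.den).act c s) := fun c => by rw [ev_act, ha]
    have h1 := hτ.relLift (ev a (show (Arr σ.den τ.den).el from s)) (.app v w) fun j => by
      rw [key]
      exact h j a w ha hw
    rw [key] at h1
    exact h1

variable (h : TypesComplete)

/-- A point of a context together with a closing substitution by related values. -/
structure RelEnv {Γ : Ctx} (γ : (Ctx.den Γ).el) (s : Sub Γ []) : Prop where
  isPoint : IsPoint γ
  rel : ∀ τ (x : Var Γ τ), Rel τ (fn x.den γ) (s τ x)

theorem RelEnv.cons {Γ : Ctx} {γ : (Ctx.den Γ).el} {s : Sub Γ []} (hs : RelEnv γ s) {σ : Ty}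
    {a : σ.den.el} {w : Val [] σ} (ha : IsPoint a) (hw : Rel σ a w) :
    RelEnv (Γ := σ :: Γ) (VSet.pair a γ) (.cons w s) where
  isPoint := ha.pair hs.isPoint
  rel := by
    rintro τ (_ | x)
    · exact hw
    · exact hs.rel τ x

/-- Recursive definitions respect the logical relation if their bodies do. -/
theorem rel_recFun {Γ : Ctx} {σ τ : Ty} (t : Comp (σ :: .arrow σ τ :: Γ) τ) {γ : (Ctx.den Γ).el}
    {s : Sub Γ []} (hs : RelEnv γ s)
    (ht : ∀ {γ' : (Ctx.den (σ :: .arrow σ τ :: Γ)).el} {s' : Sub (σ :: .arrow σ τ :: Γ) []},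
      RelEnv γ' s' → RelLift (Rel τ) (fn (t.den h) γ') (t.subst s')) :
    Rel (.arrow σ τ) (fn ((Val.recFun t).den h) γ) ((Val.recFun t).subst s) := by
  obtain ⟨C, hC, hC'⟩ := exists_isRecChain (h (.arrow σ τ)) (t.den h)
  -- the chain of approximations, with limit the recursive function
  let c : (Arr σ.den τ.den).el := fn (arrAlg σ.den τ.den) (fn C (VSet.pair γ (bar 1)))
  have hc : ∀ e, (Arr σ.den τ.den).act e c =
      fn (arrAlg σ.den τ.den) (fn C (VSet.pair γ (bar e))) := by
    intro e
    rw [← fn_act, ← fn_act, act_pair, hs.isPoint]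
    rfl
  have key : ∀ j : ℕ, Rel (.arrow σ τ) ((Arr σ.den τ.den).act (VEnd.const j) c)
      ((Val.recFun t).subst s) := by
    intro j
    induction j with
    | zero =>
      intro a w _ _ d hd
      rw [hc, Nat.cast_zero, hC.bot, ev_arrAlg_bot] at hd
      exact absurd hd.symm cons_ne_bot
    | succ j ih =>
      intro a w ha hw d hd
      have e1 : VEnd.const (j + 1 : ℕ) = VEnd.delay 0 (VEnd.const j) := by
        rw [VEnd.delay_zero_const, Nat.cast_succ, add_comm]
      rw [hc, e1, hC.cons, arrAlg_cons_zero, hs.isPoint, ← hc] at hd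
      have hp : IsPoint (X := Ty.den (.arrow σ τ)) ((Arr σ.den τ.den).act (VEnd.const j) c) :=
        fun e => (act_mul _ _ _ _).symm
      obtain ⟨u, hu, hdu⟩ := ht ((hs.cons hp ih).cons ha hw) d
        ((ev_curry (t.den h) a _).symm.trans hd)
      refine ⟨u, BigStep.appRec ?_, hdu⟩
      rw [Comp.inst2_subst_lift]
      exact hu
  have h1 := isAdmissible_rel (.arrow σ τ) c _ key
  have h2 : fn ((Val.recFun t).den h) γ = (Arr σ.den τ.den).act (VEnd.const ⊤) c :=
    (hC' γ).trans (hc _).symm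
  rw [h2]
  exact h1

mutual

/-- The fundamental lemma for values. -/
theorem Val.rel : {Γ : Ctx} → {τ : Ty} → (v : Val Γ τ) → {γ : (Ctx.den Γ).el} → {s : Sub Γ []} →
    RelEnv γ s → Rel τ (fn (v.den h) γ) (v.subst s)
  | _, _, .var x, _, _, hs => hs.rel _ x
  | _, _, .star, _, _, _ => trivial
  | _, _, .inl v, _, _, hs => Or.inl ⟨_, _, rfl, rfl, v.rel hs⟩
  | _, _, .inr v, _, _, hs => Or.inr ⟨_, _, rfl, rfl, v.rel hs⟩
  | _, _, .pair v w, _, _, hs => ⟨_, _, _, _, rfl, rfl, v.rel hs, w.rel hs⟩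
  | _, _, .zero, _, _, _ => ⟨0, rfl, rfl⟩
  | _, _, .succ v, _, _, hs => by
      obtain ⟨n, hn, hv⟩ := v.rel hs
      refine ⟨n + 1, ?_, congrArg Val.succ hv⟩
      exact congrArg (fn natSucc) hn
  | _, _, .lam t, γ, s, hs => by
      intro a w ha hw d hd
      obtain ⟨u, hu, hdu⟩ := t.rel (hs.cons ha hw) d ((Val.ev_den_lam h t a γ).symm.trans hd)
      refine ⟨u, BigStep.appLam ?_, hdu⟩
      rw [Comp.inst_subst_lift]
      exact hu
  | _, _, .recFun t, _, _, hs => rel_recFun h t hs t.rel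

/-- The fundamental lemma for computations. -/
theorem Comp.rel : {Γ : Ctx} → {τ : Ty} → (t : Comp Γ τ) → {γ : (Ctx.den Γ).el} → {s : Sub Γ []} →
    RelEnv γ s → RelLift (Rel τ) (fn (t.den h) γ) (t.subst s)
  | _, _, .caseEmpty v, _, _, hs => (v.rel hs).elim
  | _, _, .ret v, _, s, hs => fun d hd =>
      ⟨v.subst s, .ret _, (cons_inj.mp hd).2 ▸ v.rel hs⟩
  | _, _, .caseSum v t u, γ, s, hs => by
      intro d hd
      have hp := hs.isPoint.fn (v.den h)
      rcases v.rel hs with ⟨x, w, hx, hv, hw⟩ | ⟨y, w, hy, hv, hw⟩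
      · rw [hx] at hp
        obtain ⟨r, hr, hdr⟩ := t.rel (hs.cons hp.of_inl hw) d
          ((fn_caseMap_inl _ _ _ γ x hx).symm.trans hd)
        refine ⟨r, ?_, hdr⟩
        rw [Comp.subst, hv]
        refine .caseInl ?_
        rwa [Comp.inst_subst_lift]
      · rw [hy] at hp
        obtain ⟨r, hr, hdr⟩ := u.rel (hs.cons hp.of_inr hw) d
          ((fn_caseMap_inr _ _ _ γ y hy).symm.trans hd)
        refine ⟨r, ?_, hdr⟩
        rw [Comp.subst, hv]
        refine .caseInr ?_
        rwa [Comp.inst_subst_lift]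
  | _, _, .fst v, γ, s, hs => by
      intro d hd
      obtain ⟨x, y, w, w', hp, hv, hx, hy⟩ := v.rel hs
      refine ⟨w, ?_, ?_⟩
      · rw [Comp.subst, hv]; exact .fst _ _
      · have : VSet.cons 0 x = VSet.cons 0 d := (congrArg (fun p =>
          VSet.cons 0 (fn (CartesianMonoidalCategory.fst (Ty.den _) (Ty.den _)) p)) hp).symm.trans hd
        exact (cons_inj.mp this).2 ▸ hx
  | _, _, .snd v, γ, s, hs => by
      intro d hd
      obtain ⟨x, y, w, w', hp, hv, hx, hy⟩ := v.rel hs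
      refine ⟨w', ?_, ?_⟩
      · rw [Comp.subst, hv]; exact .snd _ _
      · have : VSet.cons 0 y = VSet.cons 0 d := (congrArg (fun p =>
          VSet.cons 0 (fn (CartesianMonoidalCategory.snd (Ty.den _) (Ty.den _)) p)) hp).symm.trans hd
        exact (cons_inj.mp this).2 ▸ hy
  | _, _, .app v w, _, _, hs => v.rel hs _ _ (hs.isPoint.fn (w.den h)) (w.rel hs)
  | _, _, .caseNat v t u, γ, s, hs => by
      intro d hd
      obtain ⟨n, hn, hv⟩ := v.rel hs
      have hc : fn (v.den h ≫ natCases) γ = fn natCases (num n) := congrArg (fn natCases) hn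
      cases n with
      | zero =>
        obtain ⟨r, hr, hdr⟩ := t.rel hs d ((fn_caseMap_inl _ _ _ γ pt hc).symm.trans hd)
        refine ⟨r, ?_, hdr⟩
        rw [Comp.subst, hv]
        exact .caseZero hr
      | succ n =>
        obtain ⟨r, hr, hdr⟩ := u.rel (hs.cons (σ := .nat) (a := num n) (w := numeral n)
          (fun _ => rfl) ⟨n, rfl, rfl⟩) d ((fn_caseMap_inr _ _ _ γ (num n) hc).symm.trans hd)
        refine ⟨r, ?_, hdr⟩
        rw [Comp.subst, hv]
        refine .caseSucc ?_
        rwa [Comp.inst_subst_lift]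
  | _, _, .letIn t u, γ, s, hs => by
      intro d hd
      have hp := hs.isPoint.fn (t.den h)
      rcases liftObj_cases (fn (t.den h) γ) with hl | ⟨n, a, hl⟩
      · exact absurd (hd.symm.trans (fn_bind_bot _ (u.den h) γ hl)) cons_ne_bot
      -- a global point of `L X` does not start with `⊥` unless it is `⊥`
      · obtain rfl : n = 0 := by
          have h1 := act_add_cons n a
          rw [← hl, hp, hl] at h1
          exact (cons_inj.mp h1).1
        have hd' := (fn_bind_cons _ (u.den h) γ 0 a hl).symm.trans hd
        rw [fn_mu_cons_zero, hs.isPoint] at hd'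
        rw [hl] at hp
        obtain ⟨w, hw, haw⟩ := t.rel hs a hl
        obtain ⟨r, hr, hdr⟩ := u.rel (hs.cons hp.of_cons_zero haw) d hd'
        refine ⟨r, .letIn hw ?_, hdr⟩
        rwa [Comp.inst_subst_lift]

end

/-! ### Soundness and adequacy -/

theorem Val.exists_eq_numeral : (v : Val [] .nat) →
    ∃ n, fn (v.den h) (pt : (Ctx.den []).el) = num n ∧ v = numeral n
  | .var x => nomatch x
  | .zero => ⟨0, rfl, rfl⟩
  | .succ v => by
      obtain ⟨n, hn, hv⟩ := v.exists_eq_numeral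
      exact ⟨n + 1, congrArg (fn natSucc) hn, congrArg Val.succ hv⟩

/-- On closed values of ground type, the logical relation is equality. -/
theorem eq_of_rel {τ : Ty} (hτ : τ.IsGround) (v w : Val [] τ)
    (hvw : Rel τ (fn (v.den h) (pt : (Ctx.den []).el)) w) : v = w := by
  induction τ with
  | empty => exact hvw.elim
  | unit =>
    cases v with
    | var x => nomatch x
    | star => cases w with
      | var x => nomatch x
      | star => rfl
  | nat =>
    obtain ⟨n, hn, rfl⟩ := v.exists_eq_numeral h
    obtain ⟨m, hm, rfl⟩ := hvw
    rw [num_injective (hn.symm.trans hm)]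
  | sum σ τ hσ hτ' =>
    cases v with
    | var x => nomatch x
    | inl v =>
      rcases hvw with ⟨x, w, hx, rfl, hw⟩ | ⟨y, w, hy, -⟩
      · obtain rfl := inl_injective hx
        exact congrArg Val.inl (hσ hτ.1 v w hw)
      · exact absurd hy inl_ne_inr
    | inr v =>
      rcases hvw with ⟨x, w, hx, -⟩ | ⟨y, w, hy, rfl, hw⟩
      · exact absurd hx.symm inl_ne_inr
      · obtain rfl := inr_injective hy
        exact congrArg Val.inr (hτ' hτ.2 v w hw)
  | prod σ τ hσ hτ' =>
    cases v with
    | var x => nomatch x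
    | pair v v' =>
      obtain ⟨x, y, w, w', hp, rfl, hw, hw'⟩ := hvw
      obtain ⟨rfl, rfl⟩ := pair_inj.mp hp
      rw [hσ hτ.1 v w hw, hτ' hτ.2 v' w' hw']
  | arrow σ τ => exact hτ.elim

theorem den_eq_of_bigStep {τ : Ty} {t : Comp [] τ} {v : Val [] τ} (hb : BigStep t v) :
    t.den h = v.den h ≫ lifting.L.η.app τ.den :=
  hom_ext fun _ => hb.fn_den h

theorem bigStep_of_den_eq {τ : Ty} (hτ : τ.IsGround) {t : Comp [] τ} {v : Val [] τ}
    (ht : t.den h = v.den h ≫ lifting.L.η.app τ.den) : BigStep t v := by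
  have hs : RelEnv (Γ := []) pt (Sub.ids []) := ⟨fun _ => rfl, fun _ x => nomatch x⟩
  obtain ⟨w, hw, hvw⟩ := t.rel h hs (fn (v.den h) pt) (congrArg (fun f => fn f pt) ht)
  rw [t.subst_ids] at hw
  rwa [eq_of_rel h hτ v w hvw]

end PCFv

theorem mainTheorem3 :
    IsNormalModel VSet.truth VSet.lifting ∧
    ∃ h : PCFv.TypesComplete,
      (∀ (τ : PCFv.Ty) (t : PCFv.Comp [] τ) (v : PCFv.Val [] τ),
        PCFv.BigStep t v →
          t.den h = v.den h ≫ VSet.lifting.L.η.app τ.den) ∧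
      (∀ (τ : PCFv.Ty), τ.IsGround → ∀ (t : PCFv.Comp [] τ) (v : PCFv.Val [] τ),
        t.den h = v.den h ≫ VSet.lifting.L.η.app τ.den →
          PCFv.BigStep t v) :=
  ⟨VSet.isNormalModel, PCFv.typesComplete,
    fun _ _ _ hb => PCFv.den_eq_of_bigStep PCFv.typesComplete hb,
    fun _ hτ _ _ ht => PCFv.bigStep_of_den_eq PCFv.typesComplete hτ ht⟩

end
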